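/- \textbf{Conventions.} An sc-Banach space is a Banach space $E=E_0$ with Banach spaces $E_0\supset E_1\supset\cdots$, all inclusions $E_{m+1}\to E_m$ compact, and $E_\infty=\bigcap_m E_m$ dense in every $E_m$; $(E^1)_m=E_{m+1}$, $TU=U^1\oplus E$. A map is sc$^0$ if it is continuous $U\cap E_m\to F_m$ for all $m$; it is sc$^{k+1}$ if it is sc$^0$, for every $x\in U\cap E_1$ there is $Df(x)\in L(E_0,F_0)$ with $\|f(x+h)-f(x)-Df(x)h\|_0/\|h\|_1\to0$ as $h\to 0$ in $E_1$, and $Tf(x,h)=(f(x),Df(x)h)$ is sc$^k$ on $TU$; sc-smooth means sc$^k$ for all $k$. A germ at $0$ is given by neighbourhoods of $0$ on every level $m$ (which may shrink with $m$ and with $k$). An sc-smooth splicing $(\pi,E,V)$ consists of a relatively open subset $V$ of a partial cone $[0,\infty)^k\times\mathbb R^{n-k}$ and linear sc-projections $\pi_v$ of $E$, $v\in V$, with $(v,e)\mapsto\pi_v(e)$ sc-smooth; its core is $K=\{(v,e)\in V\oplus E: \pi_v(e)=e\}$. An M-polyfold $X$ is a second countable Hausdorff space with a maximal atlas of homeomorphisms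 from open sets of $X$ onto open subsets of splicing cores, with transition maps $\phi$ sc-smooth in the sense that $(v,e)\mapsto\phi(v,\pi_v e)$ is sc-smooth. It has a filtration $X_m$, $X_\infty=\bigcap_m X_m$, and $\partial X$ is the set of points with at least one vanishing coordinate among the first $k$ ones in a chart. A strong M-polyfold bundle $b:Y\to X$ has charts, linear on fibres, onto $\{(v,e,h): (v,e)\in O,\ \sigma_v h=h\}$, with $O$ open in the core of $(\pi,E,V)$ and $(\sigma,H,V)$ a second splicing, whose transition maps are sc-smooth both for the fibre $H$ and for the fibre $H^1$ (sc$_\triangleleft$-smooth); again the atlas is maximal and $Y$ is second countable and Hausdorff. $Y_{m,k}$ $(0\le k\le m+1)$ is the set of vectors over $X_m$ whose fibre coordinate lies in $H_k$. A section $f$ of $b$ is sc-Fredholm if it is sc-smooth, if it is regularizing ($f(x)\in Y_{m,m+1}$ implies $x\in X_{m+1}$), and if for every $q\in X_\infty$ there are: (i) a strong bundle chart taking $q$ to $0$, in which $f$ has principal part $\bar f$; (ii) an sc-smooth germ $\hat f$ at $0$ from $V\oplus E$ to $H$ with $\hat f(v,u+u^c)=\bar f(v,u)+\bar f^c(v,u,u^c)$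 for $u=\pi_v(u+u^c)$, where $u^c\mapsto\bar f^c(v,u,u^c)$ is a linear sc-isomorphism $\ker\pi_v\to\ker\sigma_v$ (near $0$ on each level, the isomorphism holding on that level); (iii) an sc-Banach space $W$, a finite-dimensional space $R$, an open neighbourhood $B$ of $0$ in a partial cone, and a germ at $0$ of an sc$_\triangleleft$-smooth vector bundle isomorphism $\Psi:(V\oplus E)\triangleleft H\to(B\oplus W)\triangleleft(R\oplus W)$, covering a map that sends $0$ to $0$, such that, with $\bar g$ the principal part of the push-forward $\Psi_*\hat f$ and $P:R\oplus W\to W$ the projection, $P\bar g(b,w)-P\bar g(0,0)=w-A(b,w)$ is an sc$^0$-germ and, for every $m$, there is $\Theta_m\in(0,1)$ with $\|A(b,w)-A(b,w')\|_m\le\Theta_m\|w-w'\|_m$ for $b,w,w'$ sufficiently close to $0$ on level $m$. The tangent space $T_qX$ at a smooth point $q$ with coordinates $p$ in a chart consists of the vectors of $\mathbb R^n\oplus E_0$ fixed by the sc-derivative at $p$ of $r(v,e)=(v,\pi_v e)$, and at a zero $q$ of $f$ the linearization $f'(q):T_qX\to Y_q$ is the sc-derivative of $\bar f\circ r$ at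 $p$ (independent of the charts). \textbf{Theorem.} Let $f$ be an sc-Fredholm section of a strong M-polyfold bundle $b:Y\to X$ with $\partial X=\emptyset$. Suppose that $f(q)=0$ and that $f'(q):T_qX\to Y_q$ is onto. Then $\ker f'(q)$ is finite-dimensional, and there is an open neighbourhood $U$ of $q$ in $X$ such that the solution set $S=\{x\in U: f(x)=0\}$ is contained in $X_\infty$ and, with the subspace topology, carries a (necessarily unique) structure of a smooth manifold of dimension $\dim\ker f'(q)$ for which, for every $d$ and every open $D\subset\mathbb R^d$, a map $D\to S$ is smooth if and only if it is sc-smooth as a map into $X$. -/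

import Mathlib

open Set Filter Topology
open scoped Manifold ContDiff

universe u v w

/-! ### Banach spaces with an sc-structure -/

/-- A sequence of Banach spaces `lvl 0 ⊇ lvl 1 ⊇ ⋯` with continuous linear injections
`incl m : lvl (m + 1) → lvl m` playing the role of the inclusions. -/
structure BanachScale where
  lvl : ℕ → Type u
  [grp : ∀ m, NormedAddCommGroup (lvl m)]
  [spc : ∀ m, NormedSpace ℝ (lvl m)]
  [cpl : ∀ m, CompleteSpace (lvl m)]
  incl : ∀ m, lvl (m + 1) →L[ℝ] lvl m
  incl_injective : ∀ m, Function.Injective (incl m)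

attribute [instance] BanachScale.grp BanachScale.spc BanachScale.cpl

namespace BanachScale

/-- The inclusion of level `m` into level `0`. -/
def emb (E : BanachScale.{u}) : ∀ m, E.lvl m →L[ℝ] E.lvl 0
  | 0 => ContinuousLinearMap.id ℝ _
  | m + 1 => (E.emb m).comp (E.incl m)

/-- The set `E_m`, as a subset of `E_0`. -/
def level (E : BanachScale.{u}) (m : ℕ) : Set (E.lvl 0) := range (E.emb m)

/-- The set `E_∞` of smooth points, as a subset of `E_0`. -/
def smoothPts (E : BanachScale.{u}) : Set (E.lvl 0) := ⋂ m, E.level m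

/-- `E` with the filtration shifted by one, i.e. `E¹`. -/
abbrev shift (E : BanachScale.{u}) : BanachScale.{u} where
  lvl m := E.lvl (m + 1)
  incl m := E.incl (m + 1)
  incl_injective m := E.incl_injective (m + 1)

/-- The direct sum `E ⊕ F`. -/
noncomputable abbrev prod (E : BanachScale.{u}) (F : BanachScale.{v}) : BanachScale.{max u v} where
  lvl m := E.lvl m × F.lvl m
  incl m := (E.incl m).prodMap (F.incl m)
  incl_injective m := (E.incl_injective m).prodMap (F.incl_injective m)

theorem emb_injective (E : BanachScale.{u}) : ∀ m, Function.Injective (E.emb m)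
  | 0 => fun _ _ h => h
  | m + 1 => (E.emb_injective m).comp (E.incl_injective m)

theorem emb_shift (E : BanachScale.{u}) :
    ∀ (m : ℕ) (x : E.lvl (m + 1)), E.emb (m + 1) x = E.incl 0 (E.shift.emb m x)
  | 0, _ => rfl
  | m + 1, x => emb_shift E m (E.incl (m + 1) x)

theorem emb_prod (E : BanachScale.{u}) (F : BanachScale.{v}) :
    ∀ (m : ℕ) (x : E.lvl m × F.lvl m), (E.prod F).emb m x = (E.emb m x.1, F.emb m x.2)
  | 0, _ => rfl
  | m + 1, x => emb_prod E F m (E.incl m x.1, F.incl m x.2)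

end BanachScale

/-- A Banach space `E_0` with an sc-smooth structure: the inclusions `E_{m+1} → E_m` are compact
and `E_∞` is dense in every `E_m`. -/
structure ScBanach extends BanachScale.{u} where
  incl_compact : ∀ m, IsCompactOperator (incl m)
  dense_smooth : ∀ m, Dense (toBanachScale.emb m ⁻¹' toBanachScale.smoothPts)

namespace ScBanach

/-- The shifted space `E¹`, `(E¹)_m = E_{m+1}`. -/
abbrev shift (E : ScBanach.{u}) : ScBanach.{u} where
  toBanachScale := E.toBanachScale.shift
  incl_compact m := E.incl_compact (m + 1)
  dense_smooth m := by
    refine (E.dense_smooth (m + 1)).mono ?_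
    intro x hx
    simp only [mem_preimage, BanachScale.smoothPts, mem_iInter] at hx ⊢
    intro k
    obtain ⟨y, hy⟩ := hx (k + 1)
    refine ⟨y, E.incl_injective 0 ?_⟩
    rw [← BanachScale.emb_shift, ← BanachScale.emb_shift, hy]

/-- The direct sum `E ⊕ F`, `(E ⊕ F)_m = E_m ⊕ F_m`. -/
noncomputable abbrev prod (E : ScBanach.{u}) (F : ScBanach.{v}) : ScBanach.{max u v} where
  toBanachScale := E.toBanachScale.prod F.toBanachScale
  incl_compact m := by
    obtain ⟨K, hK, hK'⟩ := E.incl_compact m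
    obtain ⟨L, hL, hL'⟩ := F.incl_compact m
    exact ⟨K ×ˢ L, hK.prod hL, prod_mem_nhds hK' hL'⟩
  dense_smooth m := by
    refine ((E.dense_smooth m).prod (F.dense_smooth m)).mono ?_
    rintro ⟨x, y⟩ ⟨hx, hy⟩
    simp only [mem_preimage, BanachScale.smoothPts, mem_iInter] at hx hy ⊢
    intro k
    obtain ⟨x', hx'⟩ := hx k
    obtain ⟨y', hy'⟩ := hy k
    refine ⟨(x', y'), ?_⟩
    rw [BanachScale.emb_prod, BanachScale.emb_prod]
    exact Prod.ext hx' hy'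

/-- The tangent space `TE = E¹ ⊕ E`. -/
noncomputable abbrev tangent (E : ScBanach.{u}) : ScBanach.{u} := E.shift.prod E

end ScBanach

/-- `ℝⁿ`. -/
abbrev Rn (n : ℕ) : Type := EuclideanSpace ℝ (Fin n)

/-- `ℝⁿ` as a constant Banach scale. -/
noncomputable abbrev scaleR (n : ℕ) : BanachScale.{0} where
  lvl _ := Rn n
  incl _ := ContinuousLinearMap.id ℝ _
  incl_injective _ := Function.injective_id

theorem scaleR_emb (n : ℕ) : ∀ (m : ℕ) (x : Rn n), (scaleR n).emb m x = x
  | 0, _ => rfl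
  | m + 1, x => scaleR_emb n m x

/-- `ℝⁿ` with its (only, constant) sc-structure. -/
noncomputable abbrev scR (n : ℕ) : ScBanach.{0} where
  toBanachScale := scaleR n
  incl_compact _ := ⟨Metric.closedBall 0 1, isCompact_closedBall _ _,
    Metric.closedBall_mem_nhds _ one_pos⟩
  dense_smooth m := by
    have : (scaleR n).emb m ⁻¹' (scaleR n).smoothPts = univ := by
      ext x
      simp only [mem_preimage, BanachScale.smoothPts, mem_iInter, mem_univ, iff_true]
      exact fun k => ⟨x, by rw [scaleR_emb, scaleR_emb]⟩
    rw [this]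
    exact dense_univ

/-! ### sc-maps

A map between sc-spaces is represented by a function on level `0`.  Its domain is a decreasing
family of sets `U m ⊆ E_m`.  For a map defined on a subset `A` of `E_0` this is the family
`U m = A ∩ E_m`; for a germ at `0` it is a family of neighbourhoods of `0`, one on each level. -/

/-- The family `A ∩ E_m`. -/
def ScBanach.levels (E : ScBanach.{u}) (A : Set (E.lvl 0)) (m : ℕ) : Set (E.lvl m) :=
  E.emb m ⁻¹' A

/-- A linear sc-operator: it is bounded on every level. -/
def IsScOperator {E : ScBanach.{u}} {F : ScBanach.{v}} (T : E.lvl 0 →L[ℝ] F.lvl 0) : Prop :=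
  ∀ m, ∃ Tm : E.lvl m →L[ℝ] F.lvl m, ∀ x, F.emb m (Tm x) = T (E.emb m x)

/-- `f` is `sc⁰` on `U`: it maps `U m` continuously into `F_m`, for every `m`. -/
def ScCont {E : ScBanach.{u}} {F : ScBanach.{v}} (f : E.lvl 0 → F.lvl 0)
    (U : ∀ m, Set (E.lvl m)) : Prop :=
  ∀ m, ∃ g : E.lvl m → F.lvl m, ContinuousOn g (U m) ∧ ∀ x ∈ U m, F.emb m (g x) = f (E.emb m x)

/-- The bounded operator `D : E_0 → F_0` is the sc-derivative of `f` at `x ∈ E_1`, relative to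
`A ⊆ E_1`: `‖f (x + h) - f x - D h‖_0 / ‖h‖_1 → 0` as `h → 0` in `E_1` with `x + h ∈ A`. -/
def HasScDeriv {E : ScBanach.{u}} {F : ScBanach.{v}} (f : E.lvl 0 → F.lvl 0)
    (A : Set (E.lvl 1)) (x : E.lvl 1) (D : E.lvl 0 →L[ℝ] F.lvl 0) : Prop :=
  HasFDerivWithinAt (fun y : E.lvl 1 => f (E.incl 0 y)) (D.comp (E.incl 0)) A x

/-- The domain `TU = U¹ ⊕ E` of the tangent map. -/
def tangentDom {E : ScBanach.{u}} (U : ∀ m, Set (E.lvl m)) (m : ℕ) : Set (E.tangent.lvl m) :=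
  {p : E.lvl (m + 1) × E.lvl m | p.1 ∈ U (m + 1)}

/-- `f` is `scᵏ` on `U`; it is `sc^{k+1}` if it is `sc⁰`, has at every `x ∈ U 1` an sc-derivative
`Df(x)`, and the tangent map `Tf (x, h) = (f x, Df(x) h)` on `TU` is `scᵏ`. -/
def ScDiff : ℕ → ∀ {E : ScBanach.{u}} {F : ScBanach.{v}},
    (E.lvl 0 → F.lvl 0) → (∀ m, Set (E.lvl m)) → Prop
  | 0, _, _, f, U => ScCont f U
  | k + 1, E, F, f, U => ScCont f U ∧
      ∃ Tf : E.lvl 1 × E.lvl 0 → F.lvl 1 × F.lvl 0,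
        (∀ x ∈ U 1, ∃ D : E.lvl 0 →L[ℝ] F.lvl 0, HasScDeriv f (U 1) x D ∧
          ∀ h, F.incl 0 (Tf (x, h)).1 = f (E.incl 0 x) ∧ (Tf (x, h)).2 = D h) ∧
        ScDiff k (E := E.tangent) (F := F.tangent) Tf (tangentDom U)

/-- `f` is sc-smooth on the subset `A` of `E_0`. -/
def ScSmoothOn {E : ScBanach.{u}} {F : ScBanach.{v}} (f : E.lvl 0 → F.lvl 0)
    (A : Set (E.lvl 0)) : Prop :=
  ∀ k, ScDiff k f (E.levels A)

open Classical in
/-- The sc-derivative of `f`, defined on `A ⊆ E_0`, at the point `x` (which has to lie in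
`E_1`). -/
noncomputable def scDeriv {E : ScBanach.{u}} {F : ScBanach.{v}} (f : E.lvl 0 → F.lvl 0)
    (A : Set (E.lvl 0)) (x : E.lvl 0) : E.lvl 0 →L[ℝ] F.lvl 0 :=
  if h : ∃ D : E.lvl 0 →L[ℝ] F.lvl 0, ∃ x₁ : E.lvl 1,
      E.incl 0 x₁ = x ∧ HasScDeriv f (E.incl 0 ⁻¹' A) x₁ D
  then h.choose else 0

/-- The map `(u, h) ↦ (a u, ℓ u h)` between local strong bundles `U ◁ H → U' ◁ H'` is `scᵏ_◁`: it
is `scᵏ` as a map `U ⊕ H → U' ⊕ H'` and as a map `U ⊕ H¹ → U' ⊕ H'¹`. -/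
def ScTriDiff (k : ℕ) {E E' H H' : ScBanach.{u}} (a : E.lvl 0 → E'.lvl 0)
    (l : E.lvl 0 → H.lvl 0 → H'.lvl 0) (U : ∀ m, Set (E.lvl m)) : Prop :=
  ScDiff k (E := E.prod H) (F := E'.prod H')
      (fun p : E.lvl 0 × H.lvl 0 => (a p.1, l p.1 p.2)) (fun m => {p | p.1 ∈ U m}) ∧
  ∃ l₁ : E.lvl 0 → H.lvl 1 → H'.lvl 1,
    (∀ x ∈ U 0, ∀ h, H'.incl 0 (l₁ x h) = l x (H.incl 0 h)) ∧
    ScDiff k (E := E.prod H.shift) (F := E'.prod H'.shift)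
      (fun p : E.lvl 0 × H.lvl 1 => (a p.1, l₁ p.1 p.2)) (fun m => {p | p.1 ∈ U m})

/-! ### Germs at `0` -/

/-- `U` is a decreasing family of (relatively open in `C`) neighbourhoods of `0`, one for the
topology of each level. -/
def IsGermDomain {E : ScBanach.{u}} (C : Set (E.lvl 0)) (U : ∀ m, Set (E.lvl m)) : Prop :=
  ∀ m, (∃ O : Set (E.lvl m), IsOpen O ∧ 0 ∈ O ∧ U m = O ∩ E.levels C m) ∧
    MapsTo (E.incl m) (U (m + 1)) (U m)

/-- `f` represents an sc-smooth germ at `0` on `C`. -/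
def IsScSmoothGerm {E : ScBanach.{u}} {F : ScBanach.{v}} (f : E.lvl 0 → F.lvl 0)
    (C : Set (E.lvl 0)) : Prop :=
  ∀ k, ∃ U, IsGermDomain C U ∧ ScDiff k f U

/-- `(u, h) ↦ (a u, ℓ u h)` represents an `sc_◁`-smooth germ, over the point `0` of the base. -/
def IsScTriSmoothGerm {E E' H H' : ScBanach.{u}} (a : E.lvl 0 → E'.lvl 0)
    (l : E.lvl 0 → H.lvl 0 → H'.lvl 0) (C : Set (E.lvl 0)) : Prop :=
  ∀ k, ∃ U, IsGermDomain C U ∧ ScTriDiff k a l U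

/-! ### Splicings -/

/-- The partial cone `[0,∞)ᵏ × ℝⁿ⁻ᵏ`. -/
def partialCone (n k : ℕ) : Set (Rn n) := {x | ∀ i : Fin n, (i : ℕ) < k → 0 ≤ x i}

/-- A relatively open subset `V` of the partial cone `[0,∞)ᵏ × ℝⁿ⁻ᵏ`. -/
structure ConeDomain where
  n : ℕ
  k : ℕ
  k_le : k ≤ n
  V : Set (Rn n)
  isOpen : ∃ O : Set (Rn n), IsOpen O ∧ V = O ∩ partialCone n k

/-- An sc-smooth splicing `(π, E, V)`. -/
structure Splicing (D : ConeDomain) where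
  E : ScBanach.{u}
  proj : Rn D.n → E.lvl 0 →L[ℝ] E.lvl 0
  isScOperator : ∀ v ∈ D.V, IsScOperator (proj v)
  idem : ∀ v ∈ D.V, ∀ e, proj v (proj v e) = proj v e
  smooth : ScSmoothOn (E := (scR D.n).prod E) (F := E)
    (fun p : Rn D.n × E.lvl 0 => proj p.1 p.2) {p | p.1 ∈ D.V}

namespace Splicing

variable {D : ConeDomain} (S : Splicing.{u} D)

/-- The sc-space `ℝⁿ ⊕ E` that contains the splicing core. -/
noncomputable abbrev amb : ScBanach.{u} := (scR D.n).prod S.E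

/-- The set `V ⊕ E`. -/
def full : Set (Rn D.n × S.E.lvl 0) := {p | p.1 ∈ D.V}

/-- The splicing core `K = {(v, e) | π_v e = e}`. -/
def core : Set (Rn D.n × S.E.lvl 0) := {p | p.1 ∈ D.V ∧ S.proj p.1 p.2 = p.2}

/-- The map `(v, e) ↦ (v, π_v e)` of `V ⊕ E` onto the splicing core. -/
def retr (p : Rn D.n × S.E.lvl 0) : Rn D.n × S.E.lvl 0 := (p.1, S.proj p.1 p.2)

end Splicing

/-! ### M-polyfolds -/

/-- An M-polyfold chart: a homeomorphism of an open subset (`source`) of `X` onto an open subset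
(`target`) of a splicing core. -/
structure PolyfoldChart (X : Type v) [TopologicalSpace X] where
  D : ConeDomain
  S : Splicing.{u} D
  map : PartialEquiv X (Rn D.n × S.E.lvl 0)
  open_source : IsOpen map.source
  open_target : ∃ O : Set (Rn D.n × S.E.lvl 0), IsOpen O ∧ map.target = O ∩ S.core
  continuousOn : ContinuousOn map map.source
  continuousOn_symm : ContinuousOn map.symm map.target

namespace PolyfoldChart

variable {X : Type v} [TopologicalSpace X]

/-- The map `(v, e) ↦ φ⁻¹ (v, π_v e)`. -/
def inv (c : PolyfoldChart.{u} X) (p : Rn c.D.n × c.S.E.lvl 0) : X := c.map.symm (c.S.retr p)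

/-- The set of `(v, e) ∈ V ⊕ E` such that `φ⁻¹ (v, π_v e)` is defined and lies in `A`. -/
def dom (c : PolyfoldChart.{u} X) (A : Set X) : Set (Rn c.D.n × c.S.E.lvl 0) :=
  {p | p.1 ∈ c.D.V ∧ c.S.retr p ∈ c.map.target ∧ c.inv p ∈ A}

/-- The transition map `φ' ∘ φ⁻¹` is sc-smooth, i.e. `(v, e) ↦ φ' (φ⁻¹ (v, π_v e))` is. -/
def TransSmooth (c c' : PolyfoldChart.{u} X) : Prop :=
  ScSmoothOn (E := c.S.amb) (F := c'.S.amb) (fun p => c'.map (c.inv p)) (c.dom c'.map.source)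

/-- The number of vanishing coordinates of `x` among the first `k` ones, in the chart `c`. -/
noncomputable def degeneracy (c : PolyfoldChart.{u} X) (x : X) : ℕ :=
  {i : Fin c.D.n | (i : ℕ) < c.D.k ∧ (c.map x).1 i = 0}.ncard

end PolyfoldChart

/-- An M-polyfold structure on `X`: a maximal atlas of compatible M-polyfold charts. -/
structure MPolyfold (X : Type v) [TopologicalSpace X] where
  atlas : Set (PolyfoldChart.{u} X)
  cover : ∀ x, ∃ c ∈ atlas, x ∈ c.map.source
  compatible : ∀ c ∈ atlas, ∀ c' ∈ atlas, c.TransSmooth c'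
  maximal : ∀ c, (∀ c' ∈ atlas, c.TransSmooth c' ∧ c'.TransSmooth c) → c ∈ atlas

namespace MPolyfold

variable {X : Type v} [TopologicalSpace X] (P : MPolyfold.{u} X)

/-- The subset `X_m` of `X`. -/
def level (m : ℕ) : Set X := {x | ∃ c ∈ P.atlas, x ∈ c.map.source ∧ (c.map x).2 ∈ c.S.E.level m}

/-- The set `X_∞` of smooth points. -/
def smoothPts : Set X := ⋂ m, P.level m

/-- The boundary `∂X`: the points of degeneracy at least `1`. -/
def boundary : Set X := {x | ∃ c ∈ P.atlas, x ∈ c.map.source ∧ 1 ≤ c.degeneracy x}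

/-- A chart around `q`. -/
noncomputable def chartAt (q : X) : PolyfoldChart.{u} X := (P.cover q).choose

/-- The tangent space `T_qX` at a point `q` (of `X_1`), represented in the chart `chartAt q`: with
`(v, e)` the coordinates of `q`, it consists of the `(δv, δe) ∈ ℝⁿ ⊕ E` that are fixed by the
derivative of `(v, e) ↦ (v, π_v e)`, i.e. of the fibre over `(v, e)` of the core of the tangent
splicing. -/
noncomputable def tangentSpace (q : X) :
    Submodule ℝ (Rn (P.chartAt q).D.n × (P.chartAt q).S.E.lvl 0) :=
  LinearMap.eqLocus
    (scDeriv (E := (P.chartAt q).S.amb) (F := (P.chartAt q).S.amb) (P.chartAt q).S.retr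
      (P.chartAt q).S.full ((P.chartAt q).map q)).toLinearMap LinearMap.id

/-- The map `γ`, defined on the subset `W` of `ℝᵈ`, is sc-smooth as a map into `X`. -/
def ScSmoothInto {d : ℕ} (γ : Rn d → X) (W : Set (Rn d)) : Prop :=
  ContinuousOn γ W ∧ ∀ c ∈ P.atlas,
    ScSmoothOn (E := scR d) (F := c.S.amb) (fun t => c.map (γ t)) (W ∩ γ ⁻¹' c.map.source)

/-- The subset `M` of `X` (with the subspace topology) is in a natural way a smooth manifold of
dimension `n`: it consists of smooth points, and it has a smooth structure for which the smooth
maps from open subsets of `ℝᵈ` into `M` are exactly those that are sc-smooth as maps into `X`.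
(There is at most one such structure, and the inclusion of `M` into `X` is sc-smooth for it.) -/
def IsSmoothSubmanifold (M : Set X) (n : ℕ) : Prop :=
  M ⊆ P.smoothPts ∧
  ∃ _ : ChartedSpace (Rn n) M, IsManifold (𝓡 n) ∞ M ∧
    ∀ (d : ℕ) (W : Set (Rn d)), IsOpen W → ∀ γ : Rn d → M,
      ContMDiffOn (𝓡 d) (𝓡 n) ∞ γ W ↔ P.ScSmoothInto (fun t => (γ t : X)) W

end MPolyfold

/-! ### Strong M-polyfold bundles -/

/-- The total space of the family `Y` of fibres (the first argument of `TotalSpace` is unused). -/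
abbrev Tot {X : Type v} (Y : X → Type w) := Bundle.TotalSpace Unit Y

/-- A strong bundle chart: over a chart `φ : U → O` of the base, with splicing `(π, E, V)`, and with
a second splicing `(σ, H, V)`, a homeomorphism
`Y|U → {(v, e, h) | (v, e) ∈ O, σ_v h = h}`, `(x, y) ↦ (φ x, toFib x y)`,
that is linear on fibres.  For `x ∈ U` the linear map `ofFib x` is `(toFib x)⁻¹ ∘ σ_v`. -/
structure BundleChart {X : Type v} [TopologicalSpace X] (Y : X → Type w)
    [∀ x, AddCommGroup (Y x)] [∀ x, Module ℝ (Y x)] [TopologicalSpace (Tot Y)] where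
  base : PolyfoldChart.{u} X
  fib : Splicing.{u} base.D
  toFib : ∀ x, Y x →ₗ[ℝ] fib.E.lvl 0
  ofFib : ∀ x, fib.E.lvl 0 →ₗ[ℝ] Y x
  ofFib_toFib : ∀ x ∈ base.map.source, ∀ y, ofFib x (toFib x y) = y
  toFib_ofFib : ∀ x ∈ base.map.source, ∀ h, toFib x (ofFib x h) = fib.proj (base.map x).1 h
  isEmbedding : IsEmbedding (fun y : {y : Tot Y // y.proj ∈ base.map.source} =>
    ((base.map y.1.proj, toFib y.1.proj y.1.snd) :
      (Rn base.D.n × base.S.E.lvl 0) × fib.E.lvl 0))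

namespace BundleChart

variable {X : Type v} [TopologicalSpace X] {Y : X → Type w}
    [∀ x, AddCommGroup (Y x)] [∀ x, Module ℝ (Y x)] [TopologicalSpace (Tot Y)]

/-- The transition map `(v, e, h) ↦ (φ' x, toFib' x (ofFib x h))`, `x = φ⁻¹ (v, π_v e)`, is
`sc_◁`-smooth. -/
def TransSmooth (c c' : BundleChart.{u} Y) : Prop :=
  ∀ k, ScTriDiff k (E := c.base.S.amb) (E' := c'.base.S.amb) (H := c.fib.E) (H' := c'.fib.E)
    (fun p => c'.base.map (c.base.inv p))
    (fun p h => c'.toFib (c.base.inv p) (c.ofFib (c.base.inv p) h))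
    (c.base.S.amb.levels (c.base.dom c'.base.map.source))

/-- The principal part `(v, e) ↦ f̄ (v, π_v e)` of the section `f` in the chart `c`. -/
def principal (c : BundleChart.{u} Y) (f : ∀ x, Y x) (p : Rn c.base.D.n × c.base.S.E.lvl 0) :
    c.fib.E.lvl 0 :=
  c.toFib (c.base.inv p) (f (c.base.inv p))

end BundleChart

/-- A strong M-polyfold bundle `b : Y → X` over the M-polyfold `X`: a maximal atlas of compatible
strong bundle charts over charts of `X`. -/
structure StrongBundle {X : Type v} [TopologicalSpace X] (P : MPolyfold.{u} X) (Y : X → Type w)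
    [∀ x, AddCommGroup (Y x)] [∀ x, Module ℝ (Y x)] [TopologicalSpace (Tot Y)] where
  continuous_proj : Continuous (fun y : Tot Y => y.proj)
  atlas : Set (BundleChart.{u} Y)
  base_mem : ∀ c ∈ atlas, c.base ∈ P.atlas
  cover : ∀ x, ∃ c ∈ atlas, x ∈ c.base.map.source
  compatible : ∀ c ∈ atlas, ∀ c' ∈ atlas, c.TransSmooth c'
  maximal : ∀ c, c.base ∈ P.atlas → (∀ c' ∈ atlas, c.TransSmooth c' ∧ c'.TransSmooth c) →
    c ∈ atlas

/-! ### Fredholm sections -/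

/-- `T` restricts, on level `m`, to a linear isomorphism `ker π ∩ E_m → ker σ ∩ H_m`. -/
def IsLevelIso {E H : ScBanach.{u}} (m : ℕ) (T : E.lvl 0 → H.lvl 0)
    (π : E.lvl 0 →L[ℝ] E.lvl 0) (σ : H.lvl 0 →L[ℝ] H.lvl 0) : Prop :=
  ∃ (A : E.lvl m →L[ℝ] H.lvl m) (B : H.lvl m →L[ℝ] E.lvl m),
    (∀ x, π (E.emb m x) = 0 →
      H.emb m (A x) = T (E.emb m x) ∧ σ (H.emb m (A x)) = 0 ∧ B (A x) = x) ∧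
    (∀ h, σ (H.emb m h) = 0 → π (E.emb m (B h)) = 0 ∧ A (B h) = h)

/-- The sc-smooth germ `f̂` at `0` on `V ⊕ E` is a filled version of the section `f` in the chart
`c`: writing `e = u + uᶜ` with `u = π_v e`, one has `f̂ (v, e) = f̄ (v, u) + f̄ᶜ (v, u, uᶜ)`, where
`uᶜ ↦ f̄ᶜ (v, u, uᶜ)` is a linear sc-isomorphism `ker π_v → ker σ_v`. -/
def BundleChart.IsFilling {X : Type v} [TopologicalSpace X] {Y : X → Type w}
    [∀ x, AddCommGroup (Y x)] [∀ x, Module ℝ (Y x)] [TopologicalSpace (Tot Y)]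
    (c : BundleChart.{u} Y) (f : ∀ x, Y x)
    (fhat : Rn c.base.D.n × c.base.S.E.lvl 0 → c.fib.E.lvl 0) : Prop :=
  IsScSmoothGerm (E := c.base.S.amb) (F := c.fib.E) fhat c.base.S.full ∧
  ∃ fc : Rn c.base.D.n → c.base.S.E.lvl 0 → c.base.S.E.lvl 0 → c.fib.E.lvl 0,
    (∀ᶠ p in 𝓝[c.base.S.full] (0 : Rn c.base.D.n × c.base.S.E.lvl 0),
      fhat p = c.principal f p +
        fc p.1 (c.base.S.proj p.1 p.2) (p.2 - c.base.S.proj p.1 p.2)) ∧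
    ∀ m, ∀ᶠ p in 𝓝 (0 : Rn c.base.D.n × c.base.S.E.lvl m),
      (p.1, c.base.S.E.emb m p.2) ∈ c.base.S.core →
        IsLevelIso m (fc p.1 (c.base.S.E.emb m p.2)) (c.base.S.proj p.1) (c.fib.proj p.1)

/-- A germ at `0` of a strong bundle isomorphism
`Ψ : C ◁ H → C' ◁ H'`, `Ψ (x, h) = (a x, φ x h)`, over subsets `C`, `C'` of the sc-spaces `E`, `E'`,
with `a 0 = 0`, and with inverse `(y, k) ↦ (a' y, φ' y k)`. -/
structure StrongBundleIsoGerm (E E' H H' : ScBanach.{u}) (C : Set (E.lvl 0))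
    (C' : Set (E'.lvl 0)) where
  a : E.lvl 0 → E'.lvl 0
  a' : E'.lvl 0 → E.lvl 0
  φ : E.lvl 0 → H.lvl 0 →ₗ[ℝ] H'.lvl 0
  φ' : E'.lvl 0 → H'.lvl 0 →ₗ[ℝ] H.lvl 0
  smooth : IsScTriSmoothGerm a (fun x h => φ x h) C
  smooth' : IsScTriSmoothGerm a' (fun y k => φ' y k) C'
  map_zero : a 0 = 0
  map_zero' : a' 0 = 0
  left_inv : ∀ᶠ x in 𝓝[C] 0, a x ∈ C' ∧ a' (a x) = x ∧ ∀ h, φ' (a x) (φ x h) = h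
  right_inv : ∀ᶠ y in 𝓝[C'] 0, a' y ∈ C ∧ a (a' y) = y ∧ ∀ k, φ (a' y) (φ' y k) = k

/-- `f` represents an `sc⁰`-contraction germ on `V ⊕ W` at `0`:
`f (v, u) = u - B (v, u)` where, on every level `m`, `u ↦ B (v, u)` is near `0` a contraction with a
constant `Θ_m < 1`. -/
def IsContractionGerm {n : ℕ} (V : Set (Rn n)) {W : ScBanach.{u}}
    (f : Rn n × W.lvl 0 → W.lvl 0) : Prop :=
  f 0 = 0 ∧
  (∃ U, IsGermDomain (E := (scR n).prod W) {p : Rn n × W.lvl 0 | p.1 ∈ V} U ∧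
    ScCont (E := (scR n).prod W) (F := W) f U) ∧
  ∀ m, ∃ Θ : ℝ, 0 < Θ ∧ Θ < 1 ∧ ∃ N ∈ 𝓝 (0 : Rn n × W.lvl m),
    ∃ B : Rn n × W.lvl m → W.lvl m,
      (∀ v u, v ∈ V → (v, u) ∈ N → W.emb m (B (v, u)) = W.emb m u - f (v, W.emb m u)) ∧
      ∀ v u u', v ∈ V → (v, u) ∈ N → (v, u') ∈ N → ‖B (v, u) - B (v, u')‖ ≤ Θ * ‖u - u'‖

namespace StrongBundle

variable {X : Type v} [TopologicalSpace X] {P : MPolyfold.{u} X} {Y : X → Type w}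
    [∀ x, AddCommGroup (Y x)] [∀ x, Module ℝ (Y x)] [TopologicalSpace (Tot Y)]
    (b : StrongBundle P Y)

/-- `y ∈ Y_x` belongs to `Y_{m,k}`. -/
def MemLevel (m k : ℕ) {x : X} (y : Y x) : Prop :=
  x ∈ P.level m ∧ ∃ c ∈ b.atlas, x ∈ c.base.map.source ∧ c.toFib x y ∈ c.fib.E.level k

/-- `f` is an sc-smooth section. -/
def IsScSmoothSection (f : ∀ x, Y x) : Prop :=
  ∀ c ∈ b.atlas, ScSmoothOn (E := c.base.S.amb) (F := c.fib.E) (c.principal f) (c.base.dom univ)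

/-- `f` is regularizing: `f x ∈ Y_{m,m+1}` implies `x ∈ X_{m+1}`. -/
def IsRegularizing (f : ∀ x, Y x) : Prop :=
  ∀ m x, b.MemLevel m (m + 1) (f x) → x ∈ P.level (m + 1)

/-- `f` is an sc-Fredholm section: it is sc-smooth and regularizing, and around every smooth point
`q` there are a strong bundle chart `c` that maps `q` to `0`, a filled version `f̂` of `f` in this
chart, and a strong bundle isomorphism germ
`Ψ : (V ⊕ E) ◁ H → (Q ⊕ W) ◁ (ℝʳ ⊕ W)`, with `Q` open in a partial cone, such that for the principal
part `g` of the push-forward of `f̂` by `Ψ`, and the projection `pr : ℝʳ ⊕ W → W`, the germ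
`y ↦ pr (g y) - pr (g 0)` is an `sc⁰`-contraction germ. -/
def IsFredholm (f : ∀ x, Y x) : Prop :=
  b.IsScSmoothSection f ∧ b.IsRegularizing f ∧
  ∀ q ∈ P.smoothPts, ∃ c ∈ b.atlas, q ∈ c.base.map.source ∧ c.base.map q = 0 ∧
    ∃ fhat, c.IsFilling f fhat ∧
    ∃ (W : ScBanach.{u}) (r : ℕ) (Q : ConeDomain), 0 ∈ Q.V ∧
    ∃ Ψ : StrongBundleIsoGerm c.base.S.amb ((scR Q.n).prod W) c.fib.E ((scR r).prod W)
        c.base.S.full {p : Rn Q.n × W.lvl 0 | p.1 ∈ Q.V},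
      IsContractionGerm Q.V (W := W) (fun y =>
        ((Ψ.φ (Ψ.a' y) (fhat (Ψ.a' y)) : Rn r × W.lvl 0)).2 -
          ((Ψ.φ (Ψ.a' 0) (fhat (Ψ.a' 0)) : Rn r × W.lvl 0)).2)

/-- A strong bundle chart around `q`. -/
noncomputable def chartAt (q : X) : BundleChart.{u} Y := (b.cover q).choose

/-- The linearization `f'(q) : T_qX → Y_q` of `f` at a (smooth) point `q` with `f q = 0`: the
sc-derivative at `q` of the principal part of `f`.  At a zero of `f` it does not depend on the
charts that are used to compute it. -/
noncomputable def linearization (f : ∀ x, Y x) (q : X) : P.tangentSpace q →ₗ[ℝ] Y q :=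
  ((b.chartAt q).ofFib q ∘ₗ
    (scDeriv (E := (P.chartAt q).S.amb) (F := (b.chartAt q).fib.E)
      (fun p => (b.chartAt q).toFib ((P.chartAt q).inv p) (f ((P.chartAt q).inv p)))
      ((P.chartAt q).dom (b.chartAt q).base.map.source)
      ((P.chartAt q).map q)).toLinearMap) ∘ₗ (P.tangentSpace q).subtype

end StrongBundle

/-! ### The chain rule -/

section Abstract

variable {E₀ E₁ F₀ F₁ G₀ : Type*} [NormedAddCommGroup E₀] [NormedSpace ℝ E₀]
  [NormedAddCommGroup E₁] [NormedSpace ℝ E₁] [NormedAddCommGroup F₀] [NormedSpace ℝ F₀]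
  [NormedAddCommGroup F₁] [NormedSpace ℝ F₁] [NormedAddCommGroup G₀] [NormedSpace ℝ G₀]

/-! Near `q` the filled section, pushed forward by the bundle isomorphism, is a map `g` from `ℝⁿ ⊕
W` to `ℝʳ ⊕ W` whose `W`-part differs from the identity by a contraction on every level. Solving the
`W`-part for the second variable gives a germ `w = δ(b)`, and the zeros of `g` become the zeros of
the finite-dimensional map `b ↦ (g (b, δ b)).1`. If the linearization is onto, this reduced map is a
submersion at `0`, and its zero set, carried back to the polyfold, is a manifold.

The analytic core is that `δ` is of class `Cᵏ` into every level (`IsLevelContraction.scPlotAt`). The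
usual implicit function theorem does not apply, since sc-derivatives are not continuous in operator
norm and differentiating costs levels. Instead, the derivative `(b, h) ↦ δ'(b) h` itself solves an
equation, the linearization of the original one along `δ`. That equation is again a level
contraction with the same constants (`norm_sub_deriv_le`), over the parameter space of pairs `(b,
h)` and with one order of sc-smoothness less. Induction on `k`, over all parameter spaces and all
equations at once, gives the regularity. Differentiability itself is first shown into level `0`
(`hasFDerivAt_solution`) and then lifted to level `m` by the fundamental theorem of calculus
(`hasFDerivAt_of_injective_comp`).

The sc-calculus rests on the chain rule, where compactness of the inclusions turns strong continuity
of derivatives into norm continuity (`HasFDerivWithinAt.comp_of_isCompactOperator`), and on the fact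
that an `scᵏ` map sends a `Cᵏ` plot into level `m + k` to a `Cᵏ` plot into level `m`
(`ScDiff.exists_contDiffOn_comp`).

Filling changes neither the zeros nor, up to isomorphism, the kernel and cokernel of the
linearization, because the added part is an isomorphism of the complements
(`BundleChart.IsFilling.eventually`, `BundleChart.IsFilling.exists_deriv_eq`). As `X` has no
boundary, all domains are open, and the cone on the target side can then have no active constraint
at `0` (`StrongBundleIsoGerm.cone_mem_nhds`).

A last difficulty is that all this yields germs: the neighbourhood on which the parametrization `Γ`
is `Cᵏ` into level `m` may shrink with `k` and `m`. On a fixed neighbourhood `Γ` is only known to be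
`C¹` into level `1`. However, the linearization stays onto at nearby solutions
(`FilledGerm.exists_solution`), so the local theorem can be applied again at each of them. The new
parametrization is smooth at its own centre, and comparing it with `Γ` by the inverse function
theorem shows that `Γ` is smooth there too (`StrongBundle.IsFredholm.scPlotAt_of_parametrization`).
Since `Γ` has a linear left inverse, it gives a single global chart of the solution set
(`MPolyfold.isSmoothSubmanifold_of_plot`). -/

theorem ContinuousLinearMap.norm_apply_le_of_closedBall {r c : ℝ} (hr : 0 < r) (T : E₀ →L[ℝ] F₀)
    (h : ∀ z ∈ Metric.closedBall (0 : E₀) r, ‖T z‖ ≤ c) (z : E₀) : ‖T z‖ ≤ c / r * ‖z‖ := by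
  rcases eq_or_ne z 0 with rfl | hz
  · simp
  have hz' : 0 < ‖z‖ := norm_pos_iff.2 hz
  have h1 := h ((r / ‖z‖) • z) (by
    rw [mem_closedBall_zero_iff, norm_smul, Real.norm_of_nonneg (by positivity),
      div_mul_cancel₀ _ hz'.ne'])
  rw [map_smul, norm_smul, Real.norm_of_nonneg (by positivity), div_mul_eq_mul_div,
    div_le_iff₀ hz'] at h1
  rw [div_mul_eq_mul_div, le_div_iff₀ hr]
  linarith

/-- Derivatives in the sc-calculus are continuous only jointly in the point and the vector.
Continuity at `(y₀, 0)` keeps `B y z` bounded for `z` in a fixed ball and `y` near `y₀`, and scaling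
turns this into a bound on the norms. -/
theorem eventually_opNorm_le_of_continuousAt {B : F₁ → F₀ →L[ℝ] G₀} {y₀ : F₁}
    (hB : ContinuousAt (fun p : F₁ × F₀ => B p.1 p.2) (y₀, 0)) :
    ∃ C, 0 ≤ C ∧ ∀ᶠ y in 𝓝 y₀, ‖B y‖ ≤ C := by
  have h1 : ∀ᶠ p : F₁ × F₀ in 𝓝 y₀ ×ˢ 𝓝 0, ‖B p.1 p.2‖ < 1 := by
    have := hB.norm
    rw [ContinuousAt, nhds_prod_eq] at this
    refine this.eventually_lt_const ?_
    simp
  obtain ⟨p, hp, s, hs, h⟩ := eventually_prod_iff.1 h1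
  obtain ⟨r, hr, hrs⟩ := Metric.nhds_basis_closedBall.eventually_iff.1 hs
  refine ⟨1 / r, by positivity, hp.mono fun y hy => ?_⟩
  refine ContinuousLinearMap.opNorm_le_bound _ (by positivity) fun z => ?_
  exact ContinuousLinearMap.norm_apply_le_of_closedBall hr (B y)
    (fun z hz => (h hy (hrs hz)).le) z

/-- A compact operator sends some ball into a compact set `K`, and on `K` the convergence of `B y`
to `B y₀` is uniform. Precomposition with a compact operator thus upgrades strong continuity to norm
continuity. -/
theorem eventually_norm_comp_sub_le {B : F₁ → F₀ →L[ℝ] G₀} {y₀ : F₁}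
    (hB : ∀ k, ContinuousAt (fun p : F₁ × F₀ => B p.1 p.2) (y₀, k)) {i : E₁ →L[ℝ] F₀}
    (hi : IsCompactOperator i) {ε : ℝ} (hε : 0 < ε) :
    ∀ᶠ y in 𝓝 y₀, ∀ h, ‖B y (i h) - B y₀ (i h)‖ ≤ ε * ‖h‖ := by
  obtain ⟨K, hK, hK'⟩ := hi
  obtain ⟨r, hr, hrK⟩ := Metric.nhds_basis_closedBall.mem_iff.1 hK'
  have h1 : ∀ᶠ y in 𝓝 y₀, ∀ k ∈ K, ‖B y k - B y₀ k‖ ≤ ε * r := by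
    refine hK.eventually_forall_of_forall_eventually fun k _ => ?_
    have h2 : ContinuousAt (fun p : F₁ × F₀ => ‖B p.1 p.2 - B y₀ p.2‖) (y₀, k) :=
      ((hB k).sub ((B y₀).continuous.continuousAt.comp continuousAt_snd)).norm
    refine (h2.eventually_lt_const (u := ε * r) ?_).mono fun _ h => h.le
    simp only [sub_self, norm_zero]; positivity
  refine h1.mono fun y hy h => ?_
  have := ContinuousLinearMap.norm_apply_le_of_closedBall hr ((B y - B y₀).comp i)
    (fun z hz => hy _ (hrK hz)) h
  rwa [mul_div_cancel_right₀ _ hr.ne'] at this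

/-- The mean value inequality is used on the segment from `f x₀` to `f x` in `F₁`. The error is `B
y` applied to the linearization error of `f` in `F₀`, small because `‖B y‖` is locally bounded, plus
`B y - B (f x₀)` on the image of the compact operator `A ∘ i`. As a map into `F₁`, `f` only has to
be continuous. -/
theorem HasFDerivWithinAt.comp_of_isCompactOperator {i : E₁ →L[ℝ] E₀} (hi : IsCompactOperator i)
    {j : F₁ →L[ℝ] F₀} {f : E₁ → F₁} {U : Set E₁} {x₀ : E₁} {V : Set F₁} (hV : IsOpen V)
    (hx : f x₀ ∈ V) (hfc : ContinuousWithinAt f U x₀) {A : E₀ →L[ℝ] F₀}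
    (hf : HasFDerivWithinAt (fun x => j (f x)) (A.comp i) U x₀) {g : F₁ → G₀}
    {B : F₁ → F₀ →L[ℝ] G₀} (hg : ∀ y ∈ V, HasFDerivAt g ((B y).comp j) y)
    (hB : ContinuousOn (fun p : F₁ × F₀ => B p.1 p.2) (V ×ˢ univ)) :
    HasFDerivWithinAt (fun x => g (f x)) (((B (f x₀)).comp A).comp i) U x₀ := by
  have hB' : ∀ k, ContinuousAt (fun p : F₁ × F₀ => B p.1 p.2) (f x₀, k) := fun k =>
    hB.continuousAt ((hV.prod isOpen_univ).mem_nhds ⟨hx, mem_univ _⟩)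
  obtain ⟨C, hC0, hC⟩ := eventually_opNorm_le_of_continuousAt (hB' 0)
  rw [hasFDerivWithinAt_iff_isLittleO, Asymptotics.isLittleO_iff]
  intro c hc
  have h2 := eventually_norm_comp_sub_le hB' (i := A.comp i) (hi.clm_comp A) (half_pos hc)
  obtain ⟨R, hR, hball⟩ := Metric.nhds_basis_ball.eventually_iff.1
    ((hC.and h2).and (hV.eventually_mem hx))
  rw [hasFDerivWithinAt_iff_isLittleO, Asymptotics.isLittleO_iff] at hf
  -- This share of the error survives multiplication by `‖B y‖ ≤ C`; the `+ 1` covers `C = 0`.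
  have hc1 : 0 < c / 2 / (C + 1) := by positivity
  filter_upwards [hf hc1, hfc.eventually_mem (Metric.ball_mem_nhds _ hR)] with x hx1 hx2
  set h := x - x₀
  have hmem : ∀ t ∈ Icc (0 : ℝ) 1, f x₀ + t • (f x - f x₀) ∈ Metric.ball (f x₀) R := by
    intro t ht
    rw [Metric.mem_ball, dist_eq_norm] at hx2 ⊢
    rw [add_sub_cancel_left, norm_smul, Real.norm_of_nonneg ht.1]
    exact (mul_le_of_le_one_left (norm_nonneg _) ht.2).trans_lt hx2
  have key := norm_image_sub_le_of_norm_deriv_le_segment_01'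
    (f := fun t : ℝ => g (f x₀ + t • (f x - f x₀)) - t • B (f x₀) (A (i h)))
    (f' := fun t => B (f x₀ + t • (f x - f x₀)) (j (f x - f x₀)) - B (f x₀) (A (i h)))
    (C := c * ‖h‖) ?_ ?_
  · simp only [one_smul, zero_smul, add_zero, sub_zero, add_sub_cancel] at key
    rwa [sub_right_comm] at key
  · intro t ht
    have h3 := (hg _ (hball (hmem t ht)).2).comp_hasDerivAt t
      (((hasDerivAt_id t).smul_const (f x - f x₀)).const_add (f x₀))
    have h4 := (hasDerivAt_id t).smul_const (B (f x₀) (A (i h)))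
    rw [one_smul] at h3 h4
    exact (h3.sub h4).hasDerivWithinAt
  · intro t ht
    have h3 := (hball (hmem t ⟨ht.1, ht.2.le⟩)).1
    set y := f x₀ + t • (f x - f x₀)
    have h4 : B y (j (f x - f x₀)) - B (f x₀) (A (i h)) =
        B y (j (f x) - j (f x₀) - A (i h)) + (B y (A (i h)) - B (f x₀) (A (i h))) := by
      simp only [map_sub]; abel
    rw [h4]
    refine (norm_add_le _ _).trans ?_
    have h5 : ‖B y (j (f x) - j (f x₀) - A (i h))‖ ≤ C * (c / 2 / (C + 1) * ‖h‖) :=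
      ((B y).le_opNorm _).trans (mul_le_mul h3.1 hx1 (norm_nonneg _) hC0)
    have h6 : C * (c / 2 / (C + 1) * ‖h‖) ≤ c / 2 * ‖h‖ := by
      have : C * (c / 2 / (C + 1)) ≤ c / 2 := by
        rw [mul_div_assoc', div_le_iff₀ (by positivity)]; nlinarith
      rw [← mul_assoc]; gcongr
    have h7 := h3.2 h
    simp only [ContinuousLinearMap.comp_apply] at h7
    linarith

end Abstract

/-! ### Sc-differentiable maps: restriction, composition and uniqueness of derivatives. -/

section ScCalculus

universe u₁ u₂ u₃

/-- The sets `U m` decrease with the level. -/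
def NestedFamily {E : ScBanach.{u}} (U : ∀ m, Set (E.lvl m)) : Prop :=
  ∀ m, MapsTo (E.incl m) (U (m + 1)) (U m)

/-- On every level, `f` maps `U` to `V`. -/
def ScMapsTo {E : ScBanach.{u}} {F : ScBanach.{v}} (f : E.lvl 0 → F.lvl 0)
    (U : ∀ m, Set (E.lvl m)) (V : ∀ m, Set (F.lvl m)) : Prop :=
  ∀ m, ∀ x ∈ U m, ∀ y, F.emb m y = f (E.emb m x) → y ∈ V m

variable {E : ScBanach.{u₁}} {F : ScBanach.{u₂}} {G : ScBanach.{u₃}}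

namespace NestedFamily

variable {U : ∀ m, Set (E.lvl m)}

theorem emb_mem (hU : NestedFamily U) : ∀ {m : ℕ} {x : E.lvl m}, x ∈ U m → E.emb m x ∈ U 0
  | 0, _, hx => hx
  | m + 1, _, hx => emb_mem hU (m := m) (hU m hx)

theorem shift (hU : NestedFamily U) : NestedFamily (E := E.shift) (fun m => U (m + 1)) :=
  fun m _ hx => hU (m + 1) hx

theorem tangentDom (hU : NestedFamily U) : NestedFamily (E := E.tangent) (tangentDom U) :=
  fun m _ hx => hU (m + 1) hx

end NestedFamily

theorem nestedFamily_levels (A : Set (E.lvl 0)) : NestedFamily (E.levels A) :=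
  fun _ _ hx => hx

theorem isOpen_levels {A : Set (E.lvl 0)} (hA : IsOpen A) (m : ℕ) : IsOpen (E.levels A m) :=
  hA.preimage (E.emb m).continuous

theorem isOpen_tangentDom {U : ∀ m, Set (E.lvl m)} (hU : ∀ m, IsOpen (U m)) (m : ℕ) :
    IsOpen (tangentDom U m) :=
  (hU (m + 1)).preimage continuous_fst

theorem ScCont.continuousOn_zero {f : E.lvl 0 → F.lvl 0} {U : ∀ m, Set (E.lvl m)}
    (h : ScCont f U) : ContinuousOn f (U 0) := by
  obtain ⟨g, hg, hg'⟩ := h 0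
  exact hg.congr fun x hx => (hg' x hx).symm

theorem ScDiff.scCont {k : ℕ} {f : E.lvl 0 → F.lvl 0} {U : ∀ m, Set (E.lvl m)}
    (h : ScDiff k f U) : ScCont f U := by
  cases k with
  | zero => exact h
  | succ k => exact h.1

theorem ScDiff.of_succ {k : ℕ} : ∀ {E : ScBanach.{u₁}} {F : ScBanach.{u₂}}
    {f : E.lvl 0 → F.lvl 0} {U : ∀ m, Set (E.lvl m)}, ScDiff (k + 1) f U → ScDiff k f U := by
  induction k with
  | zero => exact fun h => h.1
  | succ k ih => exact fun ⟨h, Tf, h1, h2⟩ => ⟨h, Tf, h1, ih h2⟩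

theorem ScDiff.of_le {k l : ℕ} (hkl : k ≤ l) {f : E.lvl 0 → F.lvl 0} {U : ∀ m, Set (E.lvl m)}
    (h : ScDiff l f U) : ScDiff k f U := by
  induction hkl with
  | refl => exact h
  | step _ ih => exact ih h.of_succ

theorem ScCont.mono {f : E.lvl 0 → F.lvl 0} {U U' : ∀ m, Set (E.lvl m)} (hU : ∀ m, U' m ⊆ U m)
    (h : ScCont f U) : ScCont f U' := fun m =>
  let ⟨g, hg, hg'⟩ := h m
  ⟨g, hg.mono (hU m), fun x hx => hg' x (hU m hx)⟩

theorem ScDiff.mono {k : ℕ} : ∀ {E : ScBanach.{u₁}} {F : ScBanach.{u₂}}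
    {f : E.lvl 0 → F.lvl 0} {U U' : ∀ m, Set (E.lvl m)}, (∀ m, U' m ⊆ U m) →
    ScDiff k f U → ScDiff k f U' := by
  induction k with
  | zero => exact fun hU h => ScCont.mono hU h
  | succ k ih =>
    rintro E F f U U' hU ⟨h, Tf, h1, h2⟩
    refine ⟨h.mono hU, Tf, fun x hx => ?_, ih (fun m p hp => hU (m + 1) hp) h2⟩
    obtain ⟨D, hD, hD'⟩ := h1 x (hU 1 hx)
    exact ⟨D, HasFDerivWithinAt.mono hD (hU 1), hD'⟩

theorem ScCont.congr {f g : E.lvl 0 → F.lvl 0} {U : ∀ m, Set (E.lvl m)}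
    (hfg : ∀ m, ∀ x ∈ U m, g (E.emb m x) = f (E.emb m x)) (h : ScCont f U) : ScCont g U :=
  fun m =>
  let ⟨F', hF, hF'⟩ := h m
  ⟨F', hF, fun x hx => (hF' x hx).trans (hfg m x hx).symm⟩

theorem ScDiff.congr {k : ℕ} {f g : E.lvl 0 → F.lvl 0} {U : ∀ m, Set (E.lvl m)}
    (hfg : ∀ m, ∀ x ∈ U m, g (E.emb m x) = f (E.emb m x)) (h : ScDiff k f U) : ScDiff k g U := by
  cases k with
  | zero => exact ScCont.congr hfg h
  | succ k =>
    obtain ⟨h, Tf, h1, h2⟩ := h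
    refine ⟨h.congr hfg, Tf, fun x hx => ?_, h2⟩
    obtain ⟨D, hD, hD'⟩ := h1 x hx
    exact ⟨D, HasFDerivWithinAt.congr hD (fun y hy => hfg 1 y hy) (hfg 1 x hx),
      fun h => ⟨(hD' h).1.trans (hfg 1 x hx).symm, (hD' h).2⟩⟩

theorem ScCont.comp {f : E.lvl 0 → F.lvl 0} {g : F.lvl 0 → G.lvl 0} {U : ∀ m, Set (E.lvl m)}
    {V : ∀ m, Set (F.lvl m)} (hg : ScCont g V) (hf : ScCont f U) (h : ScMapsTo f U V) :
    ScCont (fun x => g (f x)) U := by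
  intro m
  obtain ⟨f', hf, hf'⟩ := hf m
  obtain ⟨g', hg, hg'⟩ := hg m
  have hm : MapsTo f' (U m) (V m) := fun x hx => h m x hx _ (hf' x hx)
  exact ⟨fun x => g' (f' x), hg.comp hf hm, fun x hx => by rw [hg' _ (hm hx), hf' x hx]⟩

/-- A tangent map maps `TU` to `TV`. -/
theorem ScMapsTo.tangentDom {f : E.lvl 0 → F.lvl 0} {U : ∀ m, Set (E.lvl m)}
    {V : ∀ m, Set (F.lvl m)} (h : ScMapsTo f U V) (hU : NestedFamily U)
    {Tf : E.lvl 1 × E.lvl 0 → F.lvl 1 × F.lvl 0}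
    (hT : ∀ x ∈ U 1, ∀ h, F.incl 0 (Tf (x, h)).1 = f (E.incl 0 x)) :
    ScMapsTo (E := E.tangent) (F := F.tangent) Tf (tangentDom U) (tangentDom V) := by
  rintro m ⟨x, k⟩ hx ⟨y, l⟩ hy
  refine h (m + 1) x hx y ?_
  rw [BanachScale.emb_prod, BanachScale.emb_prod] at hy
  have hx' : E.shift.emb m x ∈ U 1 := hU.shift.emb_mem (m := m) hx
  rw [BanachScale.emb_shift, BanachScale.emb_shift, ← hT _ hx' (E.emb m k)]
  exact congrArg (fun p : F.lvl 1 × F.lvl 0 => F.incl 0 p.1) hy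

/-- Induction through `T(g ∘ f) = Tg ∘ Tf`. The strong continuity that the chain rule demands of the
derivative of `g` is the level `0` continuity of `Tg`. -/
theorem ScDiff.comp {k : ℕ} : ∀ {E : ScBanach.{u₁}} {F : ScBanach.{u₂}} {G : ScBanach.{u₃}}
    {f : E.lvl 0 → F.lvl 0} {g : F.lvl 0 → G.lvl 0} {U : ∀ m, Set (E.lvl m)}
    {V : ∀ m, Set (F.lvl m)}, ScDiff k g V → ScDiff k f U → NestedFamily U →
    (∀ m, IsOpen (V m)) → ScMapsTo f U V → ScDiff k (fun x => g (f x)) U := by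
  induction k with
  | zero => exact fun hg hf _ _ h => ScCont.comp hg hf h
  | succ k ih =>
    rintro E F G f g U V ⟨hg, Tg, hTg, hTg'⟩ ⟨hf, Tf, hTf, hTf'⟩ hU hV h
    refine ⟨hg.comp hf h, fun p => Tg (Tf p), fun x hx => ?_, ih hTg' hTf' hU.tangentDom
      (isOpen_tangentDom hV) (h.tangentDom hU fun x hx l => ?_)⟩
    · choose! B hB hB' using hTg
      obtain ⟨A, hA, hA'⟩ := hTf x hx
      obtain ⟨f₁, hf₁, hf₁'⟩ := hf 1
      have hf₂ : ∀ y ∈ U 1, F.incl 0 (f₁ y) = f (E.incl 0 y) := hf₁'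
      have hxV : f₁ x ∈ V 1 := h 1 x hx _ (hf₁' x hx)
      have hTx : ∀ l, Tf (x, l) = (f₁ x, A l) := fun l => Prod.ext
        (F.incl_injective 0 ((hA' l).1.trans (hf₂ x hx).symm)) (hA' l).2
      refine ⟨(B (f₁ x)).comp A, ?_, fun l => ?_⟩
      · refine HasFDerivWithinAt.congr (f := fun y : E.lvl 1 => g (F.incl 0 (f₁ y))) ?_
          (fun y hy => congrArg g (hf₂ y hy).symm) (congrArg g (hf₂ x hx).symm)
        refine HasFDerivWithinAt.comp_of_isCompactOperator (j := F.incl 0) (E.incl_compact 0)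
          (hV 1) hxV (hf₁ x hx) (hA.congr hf₂ (hf₂ x hx))
          (fun y hy => (hB y hy).hasFDerivAt ((hV 1).mem_nhds hy)) ?_
        refine (continuous_snd.comp_continuousOn hTg'.scCont.continuousOn_zero).congr_mono
          (s₁ := (V 1) ×ˢ univ) ?_ (fun p hp => hp.1)
        exact fun p hp => (hB' p.1 hp.1 p.2).2.symm
      · beta_reduce
        rw [hTx, (hB' _ hxV _).1, (hB' _ hxV _).2, hf₂ x hx]
        exact ⟨rfl, rfl⟩
    · obtain ⟨A, hA, hA'⟩ := hTf x hx
      exact (hA' l).1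

theorem ScBanach.denseRange_incl (E : ScBanach.{u₁}) (m : ℕ) : DenseRange (E.incl m) := by
  refine (E.dense_smooth m).mono fun x hx => ?_
  obtain ⟨y, hy⟩ := mem_iInter.1 hx (m + 1)
  exact ⟨y, E.emb_injective m hy⟩

theorem HasScDeriv.hasFDerivAt {f : E.lvl 0 → F.lvl 0} {A : Set (E.lvl 1)} {x : E.lvl 1}
    {D : E.lvl 0 →L[ℝ] F.lvl 0} (h : HasScDeriv f A x D) (hA : A ∈ 𝓝 x) :
    HasFDerivAt (fun y : E.lvl 1 => f (E.incl 0 y)) (D.comp (E.incl 0)) x :=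
  HasFDerivWithinAt.hasFDerivAt h hA

/-- The difference quotients only determine the derivative on `E₁`; density of `E₁` in `E₀` does the
rest. -/
theorem HasScDeriv.unique {f : E.lvl 0 → F.lvl 0} {A A' : Set (E.lvl 1)} {x : E.lvl 1}
    {D D' : E.lvl 0 →L[ℝ] F.lvl 0} (h : HasScDeriv f A x D) (hA : A ∈ 𝓝 x)
    (h' : HasScDeriv f A' x D') (hA' : A' ∈ 𝓝 x) : D = D' := by
  have h1 := (h.hasFDerivAt hA).unique (h'.hasFDerivAt hA')
  exact ContinuousLinearMap.coe_inj.1 <| LinearMap.coe_injective <|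
    (E.denseRange_incl 0).equalizer D.continuous D'.continuous (congrArg DFunLike.coe h1)

theorem ScDiff.exists_hasScDeriv {f : E.lvl 0 → F.lvl 0} {U : ∀ m, Set (E.lvl m)}
    (h : ScDiff 1 f U) {x : E.lvl 1} (hx : x ∈ U 1) : ∃ D, HasScDeriv f (U 1) x D :=
  let ⟨_, _, h1, _⟩ := h
  let ⟨D, hD, _⟩ := h1 x hx
  ⟨D, hD⟩

/-- The chain rule for sc-derivatives. -/
theorem HasScDeriv.comp {f : E.lvl 0 → F.lvl 0} {g : F.lvl 0 → G.lvl 0} {U : ∀ m, Set (E.lvl m)}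
    {V : ∀ m, Set (F.lvl m)} (hg : ScDiff 1 g V) (hV : ∀ m, IsOpen (V m)) (hf : ScCont f U)
    {x : E.lvl 1} (hx : x ∈ U 1) {y : F.lvl 1} (hxy : F.incl 0 y = f (E.incl 0 x)) (hy : y ∈ V 1)
    {A : E.lvl 0 →L[ℝ] F.lvl 0} (hA : HasScDeriv f (U 1) x A)
    {V' : Set (F.lvl 1)} (hV' : V' ∈ 𝓝 y)
    {B : F.lvl 0 →L[ℝ] G.lvl 0} (hB : HasScDeriv g V' y B) :
    HasScDeriv (fun z => g (f z)) (U 1) x (B.comp A) := by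
  obtain ⟨hg, Tg, hTg, hTg'⟩ := hg
  choose! B' hB₁ hB' using hTg
  obtain ⟨f₁, hf₁, hf₁'⟩ := hf 1
  have hf₂ : ∀ y ∈ U 1, F.incl 0 (f₁ y) = f (E.incl 0 y) := hf₁'
  obtain rfl : y = f₁ x := F.incl_injective 0 (hxy.trans (hf₂ x hx).symm)
  obtain rfl : B = B' (f₁ x) := hB.unique hV' (hB₁ _ hy) ((hV 1).mem_nhds hy)
  refine HasFDerivWithinAt.congr (f := fun y : E.lvl 1 => g (F.incl 0 (f₁ y))) ?_
    (fun y hy => congrArg g (hf₂ y hy).symm) (congrArg g (hf₂ x hx).symm)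
  refine HasFDerivWithinAt.comp_of_isCompactOperator (j := F.incl 0) (E.incl_compact 0)
    (hV 1) hy (hf₁ x hx) (hA.congr hf₂ (hf₂ x hx))
    (fun y hy => (hB₁ y hy).hasFDerivAt ((hV 1).mem_nhds hy)) ?_
  refine (continuous_snd.comp_continuousOn hTg'.scCont.continuousOn_zero).congr_mono
    (s₁ := (V 1) ×ˢ univ) ?_ (fun p hp => hp.1)
  exact fun p hp => (hB' p.1 hp.1 p.2).2.symm

end ScCalculus

/-! ### Levelwise smooth maps, linear sc-operators and pairs of maps. -/

section Levelwise

universe u₁ u₂ u₃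

/-- On level `m` the tangent map consists of `g (m + 1)` on the base and the Fréchet derivative of
`g m` on the fibre, so an order of differentiability is spent but no level. These fibre parts are
compatible because, seen in level `0`, they all differentiate the same map. -/
theorem ScDiff.of_contDiffOn {k : ℕ} : ∀ {E : ScBanach.{u₁}} {F : ScBanach.{u₂}}
    {f : E.lvl 0 → F.lvl 0} {U : ∀ m, Set (E.lvl m)}, (∀ m, IsOpen (U m)) → NestedFamily U →
    (∀ m, ∃ g : E.lvl m → F.lvl m, ContDiffOn ℝ k g (U m) ∧
      ∀ x ∈ U m, F.emb m (g x) = f (E.emb m x)) → ScDiff k f U := by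
  induction k with
  | zero =>
    intro E F f U _ _ h m
    obtain ⟨g, hg, hg'⟩ := h m
    exact ⟨g, hg.continuousOn, hg'⟩
  | succ k ih =>
    intro E F f U hU hN h
    choose g hg hg' using h
    have hg0 : ∀ x ∈ U 0, g 0 x = f x := hg' 0
    have hd : ∀ m, ∀ x ∈ U m, DifferentiableAt ℝ (g m) x := fun m x hx =>
      ((hg m).contDiffAt ((hU m).mem_nhds hx)).differentiableAt (by simp)
    refine ⟨fun m => ⟨g m, (hg m).continuousOn, hg' m⟩,
      fun p => (g 1 p.1, fderiv ℝ (g 0) (E.incl 0 p.1) p.2), fun x hx =>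
        ⟨fderiv ℝ (g 0) (E.incl 0 x), ?_, fun l => ⟨hg' 1 x hx, rfl⟩⟩,
      ih (isOpen_tangentDom hU) hN.tangentDom fun m => ?_⟩
    · refine HasFDerivWithinAt.congr (f := fun y => g 0 (E.incl 0 y)) ?_
        (fun y hy => (hg0 _ (hN 0 hy)).symm) (hg0 _ (hN 0 hx)).symm
      exact ((hd 0 _ (hN 0 hx)).hasFDerivAt.comp x (E.incl 0).hasFDerivAt).hasFDerivWithinAt
    · refine ⟨fun p => (g (m + 1) p.1, fderiv ℝ (g m) (E.incl m p.1) p.2), ?_, ?_⟩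
      · refine ContDiffOn.prodMk ?_ ?_
        · exact ((hg (m + 1)).of_le (by norm_cast; omega)).comp contDiff_fst.contDiffOn
            fun p hp => hp
        · have h1 : ContDiffOn ℝ k (fderiv ℝ (g m)) (U m) :=
            (hg m).fderiv_of_isOpen (hU m) (by norm_cast)
          exact (h1.comp ((E.incl m).contDiff.comp contDiff_fst).contDiffOn
            fun p hp => hN m hp).clm_apply contDiff_snd.contDiffOn
      · rintro ⟨x, l⟩ hx
        have hx : x ∈ U (m + 1) := hx
        have hx' : E.shift.emb m x ∈ U 1 := hN.shift.emb_mem (m := m) hx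
        rw [BanachScale.emb_prod, BanachScale.emb_prod]
        refine Prod.ext (F.incl_injective 0 ?_) ?_
        · change F.incl 0 (F.shift.emb m (g (m + 1) x)) = F.incl 0 (g 1 (E.shift.emb m x))
          rw [← BanachScale.emb_shift, hg' _ _ hx, BanachScale.emb_shift]
          exact (hg' 1 _ hx').symm
        · change F.emb m (fderiv ℝ (g m) (E.incl m x) l) =
            fderiv ℝ (g 0) (E.incl 0 (E.shift.emb m x)) (E.emb m l)
          rw [← BanachScale.emb_shift]
          have h1 := hN m hx
          have h2 : HasFDerivAt (fun z => F.emb m (g m z))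
              ((F.emb m).comp (fderiv ℝ (g m) (E.incl m x))) (E.incl m x) :=
            (F.emb m).hasFDerivAt.comp _ (hd m _ h1).hasFDerivAt
          have h3 : HasFDerivAt (fun z => g 0 (E.emb m z))
              ((fderiv ℝ (g 0) (E.emb m (E.incl m x))).comp (E.emb m)) (E.incl m x) :=
            (hd 0 _ (hN.emb_mem h1)).hasFDerivAt.comp _ (E.emb m).hasFDerivAt
          have h4 := h2.congr_of_eventuallyEq (f₁ := fun z => g 0 (E.emb m z))
            (by filter_upwards [(hU m).mem_nhds h1] with z hz
                rw [hg' m z hz, hg0 _ (hN.emb_mem hz)])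
          exact DFunLike.congr_fun (h4.unique h3) l

theorem ScDiff.of_isScOperator {k : ℕ} {E : ScBanach.{u₁}} {F : ScBanach.{u₂}}
    {T : E.lvl 0 →L[ℝ] F.lvl 0} (hT : IsScOperator T) (U : ∀ m, Set (E.lvl m)) : ScDiff k T U := by
  refine ScDiff.mono (U := fun _ => univ) (fun _ => subset_univ _)
    (ScDiff.of_contDiffOn (fun _ => isOpen_univ) (fun _ _ _ => mem_univ _) fun m => ?_)
  obtain ⟨Tm, hTm⟩ := hT m
  exact ⟨Tm, Tm.contDiff.contDiffOn, fun x _ => hTm x⟩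

variable {E : ScBanach.{u₁}} {F : ScBanach.{u₂}} {G : ScBanach.{u₃}}

theorem isScOperator_fst : IsScOperator (E := F.prod G) (F := F)
    (ContinuousLinearMap.fst ℝ (F.lvl 0) (G.lvl 0)) := fun m =>
  ⟨ContinuousLinearMap.fst ℝ (F.lvl m) (G.lvl m), fun x => by rw [BanachScale.emb_prod]; rfl⟩

theorem isScOperator_snd : IsScOperator (E := F.prod G) (F := G)
    (ContinuousLinearMap.snd ℝ (F.lvl 0) (G.lvl 0)) := fun m =>
  ⟨ContinuousLinearMap.snd ℝ (F.lvl m) (G.lvl m), fun x => by rw [BanachScale.emb_prod]; rfl⟩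

theorem ScDiff.clm_comp {k : ℕ} {f : E.lvl 0 → F.lvl 0} {U : ∀ m, Set (E.lvl m)}
    (hf : ScDiff k f U) (hU : NestedFamily U) {T : F.lvl 0 →L[ℝ] G.lvl 0} (hT : IsScOperator T) :
    ScDiff k (fun x => T (f x)) U :=
  (ScDiff.of_isScOperator hT fun _ => univ).comp hf hU (fun _ => isOpen_univ)
    (fun _ _ _ _ _ => mem_univ _)

theorem ScDiff.fst {k : ℕ} {f : E.lvl 0 → F.lvl 0 × G.lvl 0} {U : ∀ m, Set (E.lvl m)}
    (hf : ScDiff (F := F.prod G) k f U) (hU : NestedFamily U) :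
    ScDiff (F := F) k (fun x => (f x).1) U :=
  hf.clm_comp hU isScOperator_fst

theorem ScDiff.snd {k : ℕ} {f : E.lvl 0 → F.lvl 0 × G.lvl 0} {U : ∀ m, Set (E.lvl m)}
    (hf : ScDiff (F := F.prod G) k f U) (hU : NestedFamily U) :
    ScDiff (F := G) k (fun x => (f x).2) U :=
  hf.clm_comp hU isScOperator_snd

theorem ScCont.prodMk {f : E.lvl 0 → F.lvl 0} {g : E.lvl 0 → G.lvl 0}
    {U : ∀ m, Set (E.lvl m)} (hf : ScCont f U) (hg : ScCont g U) :
    ScCont (F := F.prod G) (fun x => (f x, g x)) U := by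
  intro m
  obtain ⟨f', hf, hf'⟩ := hf m
  obtain ⟨g', hg, hg'⟩ := hg m
  refine ⟨fun x => (f' x, g' x), hf.prodMk hg, fun x hx => ?_⟩
  rw [BanachScale.emb_prod]
  exact Prod.ext (hf' x hx) (hg' x hx)

theorem ScDiff.prodMk {k : ℕ} : ∀ {E : ScBanach.{u₁}} {F : ScBanach.{u₂}} {G : ScBanach.{u₃}}
    {f : E.lvl 0 → F.lvl 0} {g : E.lvl 0 → G.lvl 0} {U : ∀ m, Set (E.lvl m)}, ScDiff k f U →
    ScDiff k g U → NestedFamily U → ScDiff (F := F.prod G) k (fun x => (f x, g x)) U := by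
  induction k with
  | zero => exact fun hf hg _ => ScCont.prodMk hf hg
  | succ k ih =>
    rintro E F G f g U ⟨hf, Tf, hTf, hTf'⟩ ⟨hg, Tg, hTg, hTg'⟩ hU
    refine ⟨hf.prodMk hg, fun p => (((Tf p).1, (Tg p).1), ((Tf p).2, (Tg p).2)),
      fun x hx => ?_, ?_⟩
    · obtain ⟨A, hA, hA'⟩ := hTf x hx
      obtain ⟨B, hB, hB'⟩ := hTg x hx
      exact ⟨A.prod B, HasFDerivWithinAt.prodMk hA hB, fun l =>
        ⟨Prod.ext (hA' l).1 (hB' l).1, Prod.ext (hA' l).2 (hB' l).2⟩⟩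
    · have h := ih hTf' hTg' hU.tangentDom
      -- `TF ⊕ TG` and `T(F ⊕ G)` differ by a permutation of the four factors, which is a linear
      -- sc-operator.
      let S : ∀ m, (F.lvl (m + 1) × F.lvl m) × (G.lvl (m + 1) × G.lvl m) →L[ℝ]
          (F.lvl (m + 1) × G.lvl (m + 1)) × (F.lvl m × G.lvl m) := fun m =>
        (((ContinuousLinearMap.fst ℝ _ _).comp (ContinuousLinearMap.fst ℝ _ _)).prod
          ((ContinuousLinearMap.fst ℝ _ _).comp (ContinuousLinearMap.snd ℝ _ _))).prod
        (((ContinuousLinearMap.snd ℝ _ _).comp (ContinuousLinearMap.fst ℝ _ _)).prod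
          ((ContinuousLinearMap.snd ℝ _ _).comp (ContinuousLinearMap.snd ℝ _ _)))
      refine h.clm_comp (G := (F.prod G).tangent) hU.tangentDom (T := S 0) fun m => ⟨S m, ?_⟩
      rintro ⟨⟨a, b⟩, ⟨c, d⟩⟩
      have e₁ := BanachScale.emb_prod F.shift.toBanachScale F.toBanachScale m (a, b)
      have e₂ := BanachScale.emb_prod G.shift.toBanachScale G.toBanachScale m (c, d)
      have e₃ := BanachScale.emb_prod F.tangent.toBanachScale G.tangent.toBanachScale m
        ((a, b), (c, d))
      have e₄ := BanachScale.emb_prod F.shift.toBanachScale G.shift.toBanachScale m (a, c)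
      have e₅ := BanachScale.emb_prod F.toBanachScale G.toBanachScale m (b, d)
      have e₆ := BanachScale.emb_prod (F.prod G).shift.toBanachScale (F.prod G).toBanachScale m
        ((a, c), (b, d))
      exact e₆.trans ((congrArg₂ Prod.mk e₄ e₅).trans
        (congrArg (S 0) (e₃.trans (congrArg₂ Prod.mk e₁ e₂))).symm)

end Levelwise

/-! ### Sc-smooth maps along finite-dimensional plots. -/

section Plots

/-- The identity `G s - G t = ∫ D` holds in `A` because it holds in `B` after applying the injective
`j`; continuity of `D` into `A` then gives the derivative. This raises differentiability from level
`0` to a higher level once a continuous candidate for the derivative exists there. -/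
theorem hasFDerivAt_of_injective_comp {P A B : Type*} [NormedAddCommGroup P] [NormedSpace ℝ P]
    [NormedAddCommGroup A] [NormedSpace ℝ A] [CompleteSpace A] [NormedAddCommGroup B]
    [NormedSpace ℝ B] [CompleteSpace B] {j : A →L[ℝ] B} (hj : Function.Injective j) {G : P → A}
    {D : P → P →L[ℝ] A} {W : Set P} (hW : IsOpen W)
    (hG : ∀ t ∈ W, HasFDerivAt (fun s => j (G s)) (j.comp (D t)) t) (hD : ContinuousOn D W)
    {t : P} (ht : t ∈ W) : HasFDerivAt G (D t) t := by
  rw [hasFDerivAt_iff_isLittleO, Asymptotics.isLittleO_iff]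
  intro c hc
  have h1 : ∀ᶠ s in 𝓝 t, s ∈ W ∧ ‖D s - D t‖ ≤ c := by
    refine (hW.eventually_mem ht).and ?_
    have := (hD.continuousAt (hW.mem_nhds ht)).sub_const (D t)
    refine (this.norm.eventually_lt_const (u := c) (by simpa using hc)).mono fun s hs => hs.le
  obtain ⟨r, hr, hball⟩ := Metric.nhds_basis_ball.eventually_iff.1 h1
  filter_upwards [Metric.ball_mem_nhds t hr] with s hs
  have hseg : ∀ θ ∈ Icc (0 : ℝ) 1, t + θ • (s - t) ∈ Metric.ball t r := fun θ hθ => by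
    rw [Metric.mem_ball, dist_eq_norm] at hs ⊢
    rw [add_sub_cancel_left, norm_smul, Real.norm_of_nonneg hθ.1]
    exact (mul_le_of_le_one_left (norm_nonneg _) hθ.2).trans_lt hs
  have hcont : ContinuousOn (fun θ : ℝ => D (t + θ • (s - t)) (s - t)) (Icc 0 1) :=
    (hD.comp (by fun_prop) fun θ hθ => (hball (hseg θ hθ)).1).clm_apply continuousOn_const
  have hint : IntervalIntegrable (fun θ : ℝ => D (t + θ • (s - t)) (s - t))
      MeasureTheory.volume 0 1 := by
    rw [← uIcc_of_le zero_le_one] at hcont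
    exact hcont.intervalIntegrable
  have hmain : G s - G t = ∫ θ in (0 : ℝ)..1, D (t + θ • (s - t)) (s - t) := by
    apply hj
    rw [← ContinuousLinearMap.intervalIntegral_comp_comm _ hint, map_sub]
    have := intervalIntegral.integral_eq_sub_of_hasDerivAt
      (f := fun θ : ℝ => j (G (t + θ • (s - t))))
      (f' := fun θ => j (D (t + θ • (s - t)) (s - t))) (a := 0) (b := 1) ?_ ?_
    · rw [this]; simp
    · intro θ hθ
      rw [uIcc_of_le zero_le_one] at hθ
      have h2 := (hG _ (hball (hseg θ hθ)).1).comp_hasDerivAt θ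
        (((hasDerivAt_id θ).smul_const (s - t)).const_add t)
      rw [one_smul] at h2
      exact h2
    · rw [← uIcc_of_le zero_le_one] at hcont
      exact (j.continuous.comp_continuousOn hcont).intervalIntegrable
  have h3 : D t (s - t) = ∫ θ in (0 : ℝ)..1, D t (s - t) := by simp
  rw [hmain, h3, ← intervalIntegral.integral_sub hint (by simp)]
  have := intervalIntegral.norm_integral_le_of_norm_le_const (a := (0 : ℝ)) (b := 1)
    (f := fun θ => D (t + θ • (s - t)) (s - t) - D t (s - t)) (C := c * ‖s - t‖) ?_
  · simpa using this
  · intro θ hθ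
    rw [uIoc_of_le zero_le_one] at hθ
    rw [← sub_apply]
    exact ((D _ - D t).le_opNorm _).trans
      (mul_le_mul_of_nonneg_right (hball (hseg θ ⟨hθ.1.le, hθ.2⟩)).2 (norm_nonneg _))

universe u₁ u₂ u₃

/-- Each order of sc-differentiability costs at most one level. In the induction the tangent map is
composed with the plot `(t, τ) ↦ (γ t, γ'(t) τ)`, whose fibre part is put one level lower. The first
component of the result lifts `f ∘ γ` and the second one is its derivative. -/
theorem ScDiff.exists_contDiffOn_comp {k : ℕ} : ∀ {E : ScBanach.{u₁}} {F : ScBanach.{u₂}}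
    {f : E.lvl 0 → F.lvl 0} {U : ∀ m, Set (E.lvl m)}, ScDiff k f U → NestedFamily U →
    ∀ {P : Type u₃} [NormedAddCommGroup P] [NormedSpace ℝ P] [FiniteDimensional ℝ P]
    {W : Set P}, IsOpen W → ∀ {m : ℕ} {γ : P → E.lvl (m + k)}, ContDiffOn ℝ k γ W →
    MapsTo γ W (U (m + k)) → ∃ g : P → F.lvl m, ContDiffOn ℝ k g W ∧
      ∀ t ∈ W, F.emb m (g t) = f (E.emb (m + k) (γ t)) := by
  induction k with
  | zero =>
    intro E F f U hf hU P _ _ _ W hW m γ hγ hm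
    obtain ⟨g, hg, hg'⟩ := hf m
    exact ⟨fun t => g (γ t), contDiffOn_zero.2 (hg.comp hγ.continuousOn hm),
      fun t ht => hg' _ (hm ht)⟩
  | succ k ih =>
    rintro E F f U ⟨-, Tf, hTf, hTf'⟩ hU P _ _ _ W hW m γ hγ hm
    have hγd : ∀ t ∈ W, DifferentiableAt ℝ γ t := fun t ht =>
      (hγ.contDiffAt (hW.mem_nhds ht)).differentiableAt (by simp)
    obtain ⟨g, hg, hg'⟩ := ih hTf' hU.tangentDom (P := P × P) (W := W ×ˢ univ)
      (hW.prod isOpen_univ) (m := m)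
      (γ := fun p => (γ p.1, E.incl (m + k) (fderiv ℝ γ p.1 p.2)))
      (by
        refine ContDiffOn.prodMk ?_ ?_
        · exact (hγ.of_le (by norm_cast; omega)).comp contDiff_fst.contDiffOn fun p hp => hp.1
        · have h1 : ContDiffOn ℝ k (fderiv ℝ γ) W := hγ.fderiv_of_isOpen hW (by norm_cast)
          exact (E.incl (m + k)).contDiff.comp_contDiffOn
            ((h1.comp contDiff_fst.contDiffOn fun p hp => hp.1).clm_apply contDiff_snd.contDiffOn))
      (fun p hp => hm hp.1)
    have hx : ∀ t ∈ W, E.shift.emb (m + k) (γ t) ∈ U 1 := fun t ht =>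
      hU.shift.emb_mem (m := m + k) (hm ht)
    choose! B hB hB' using hTf
    have hg1 : ∀ t ∈ W, ∀ τ, F.shift.emb m (g (t, τ)).1 =
        (Tf (E.shift.emb (m + k) (γ t), E.emb (m + k + 1) (fderiv ℝ γ t τ))).1 := by
      intro t ht τ
      have := hg' (t, τ) ⟨ht, mem_univ _⟩
      rw [BanachScale.emb_prod, BanachScale.emb_prod] at this
      exact congrArg Prod.fst this
    have hg2 : ∀ t ∈ W, ∀ τ, F.emb m (g (t, τ)).2 =
        B (E.shift.emb (m + k) (γ t)) (E.emb (m + k + 1) (fderiv ℝ γ t τ)) := by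
      intro t ht τ
      have := hg' (t, τ) ⟨ht, mem_univ _⟩
      rw [BanachScale.emb_prod, BanachScale.emb_prod] at this
      exact (congrArg Prod.snd this).trans (hB' _ (hx t ht) _).2
    have hG : ∀ t ∈ W, F.emb m (F.incl m (g (t, 0)).1) = f (E.emb (m + (k + 1)) (γ t)) := by
      intro t ht
      refine (BanachScale.emb_shift F.toBanachScale m _).trans ?_
      rw [hg1 t ht, (hB' _ (hx t ht) _).1, ← BanachScale.emb_shift]
      rfl
    classical
    -- Linearity in `τ` is visible in level `0`, where the value is `B` applied to `γ'(t) τ`, and is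
    -- pulled back to level `m` by injectivity of the embedding.
    let D : P → P →L[ℝ] F.lvl m := fun t => if ht : t ∈ W then
      LinearMap.toContinuousLinearMap
        { toFun := fun τ => (g (t, τ)).2
          map_add' := fun a b => F.emb_injective m (by
            simp only [map_add, hg2 t ht])
          map_smul' := fun c a => F.emb_injective m (by
            simp only [map_smul, hg2 t ht, RingHom.id_apply]) } else 0
    have hD : ∀ t ∈ W, ∀ τ, D t τ = (g (t, τ)).2 := fun t ht τ => by simp [D, ht]
    have hDk : ContDiffOn ℝ k D W := by
      -- As `P` is finite-dimensional, it is enough to test on each vector.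
      refine contDiffOn_clm_apply.2 fun τ => ?_
      refine ContDiffOn.congr (f := fun t => (g (t, τ)).2) ?_ fun t ht => hD t ht τ
      exact contDiff_snd.comp_contDiffOn
        (hg.comp (contDiff_id.prodMk contDiff_const).contDiffOn fun t ht => ⟨ht, mem_univ _⟩)
    have hder : ∀ t ∈ W, HasFDerivAt (fun t => F.incl m (g (t, 0)).1) (D t) t := by
      intro t ht
      refine hasFDerivAt_of_injective_comp (F.emb_injective m) hW (fun t ht => ?_)
        hDk.continuousOn ht
      have h1 : HasFDerivWithinAt (fun t => E.shift.emb (m + k) (γ t))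
          ((E.shift.emb (m + k)).comp (fderiv ℝ γ t)) W t :=
        ((E.shift.emb (m + k)).hasFDerivAt.comp t (hγd t ht).hasFDerivAt).hasFDerivWithinAt
      have h2 := (HasFDerivWithinAt.comp t (hB _ (hx t ht)) h1 hx).hasFDerivAt (hW.mem_nhds ht)
      refine (h2.congr_of_eventuallyEq ?_).congr_fderiv ?_
      · filter_upwards [hW.mem_nhds ht] with s hs
        rw [hG s hs]
        exact congrArg f (BanachScale.emb_shift E.toBanachScale (m + k) _)
      · ext τ
        simp only [ContinuousLinearMap.comp_apply]
        rw [hD t ht, hg2 t ht]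
        exact congrArg _ (BanachScale.emb_shift E.toBanachScale (m + k) _).symm
    refine ⟨fun t => F.incl m (g (t, 0)).1, ?_, hG⟩
    push_cast
    rw [contDiffOn_succ_iff_fderiv_of_isOpen hW]
    exact ⟨fun t ht => (hder t ht).differentiableAt.differentiableWithinAt, by simp,
      hDk.congr fun t ht => (hder t ht).fderiv⟩

end Plots

/-! ### Germs at `0`, plots into all levels, and level contractions. -/

section Germs

universe u₁ u₂ u₃

/-- A finite dimensional space with its constant sc-structure. -/
noncomputable abbrev scConst (P : Type u) [NormedAddCommGroup P] [NormedSpace ℝ P]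
    [FiniteDimensional ℝ P] : ScBanach.{u} where
  lvl _ := P
  cpl _ := FiniteDimensional.complete ℝ P
  incl _ := ContinuousLinearMap.id ℝ _
  incl_injective _ := Function.injective_id
  incl_compact _ := by
    have := FiniteDimensional.proper_real P
    exact ⟨Metric.closedBall 0 1, isCompact_closedBall _ _, Metric.closedBall_mem_nhds _ one_pos⟩
  dense_smooth m := by
    refine dense_univ.mono fun x _ => mem_iInter.2 fun k => ?_
    have h : ∀ (m : ℕ) (x : P), BanachScale.emb
        { lvl _ := P
          cpl _ := FiniteDimensional.complete ℝ P
          incl _ := ContinuousLinearMap.id ℝ _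
          incl_injective _ := Function.injective_id } m x = x := by
      intro m
      induction m with
      | zero => exact fun _ => rfl
      | succ m ih => exact ih
    exact ⟨x, (h k x).trans (h m x).symm⟩

theorem scConst_emb (P : Type u) [NormedAddCommGroup P] [NormedSpace ℝ P]
    [FiniteDimensional ℝ P] : ∀ (m : ℕ) (x : P), (scConst P).emb m x = x
  | 0, _ => rfl
  | m + 1, x => scConst_emb P m x

/-- `f` is `scᵏ` on a nested family of open neighbourhoods of `0`. -/
def ScGermDiff {E : ScBanach.{u₁}} {F : ScBanach.{u₂}} (k : ℕ) (f : E.lvl 0 → F.lvl 0) : Prop :=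
  ∃ U : ∀ m, Set (E.lvl m), (∀ m, IsOpen (U m)) ∧ (∀ m, (0 : E.lvl m) ∈ U m) ∧
    NestedFamily U ∧ ScDiff k f U

/-- The curve `δ` lifts to a map of class `Cᵏ` near `t₀` on every level. -/
def ScPlotAt {P : Type u₁} [NormedAddCommGroup P] [NormedSpace ℝ P] {W : ScBanach.{u₂}} (k : ℕ)
    (δ : P → W.lvl 0) (t₀ : P) : Prop :=
  ∀ m, ∃ δm : P → W.lvl m, ContDiffAt ℝ k δm t₀ ∧ ∀ᶠ b in 𝓝 t₀, W.emb m (δm b) = δ b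

/-- On every level, `u ↦ u - F (b, u)` is a contraction near `0`, uniformly in `b`. -/
def IsLevelContraction {P : Type u₁} [NormedAddCommGroup P] {W : ScBanach.{u₂}}
    (F : P × W.lvl 0 → W.lvl 0) : Prop :=
  ∀ m, ∃ Θ : ℝ, 0 ≤ Θ ∧ Θ < 1 ∧ ∃ N : Set (P × W.lvl m), IsOpen N ∧ (0 : P × W.lvl m) ∈ N ∧
    ∀ b u u' y y', (b, u) ∈ N → (b, u') ∈ N → W.emb m y = F (b, W.emb m u) →
      W.emb m y' = F (b, W.emb m u') → ‖(u - y) - (u' - y')‖ ≤ Θ * ‖u - u'‖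

theorem ScDiff.exists_deriv_family {k : ℕ} {E : ScBanach.{u₁}} {F : ScBanach.{u₂}}
    {f : E.lvl 0 → F.lvl 0} {U : ∀ m, Set (E.lvl m)} (h : ScDiff (k + 1) f U)
    (hU : NestedFamily U) : ∃ D : E.lvl 1 → E.lvl 0 →L[ℝ] F.lvl 0,
      (∀ x ∈ U 1, HasScDeriv f (U 1) x (D x)) ∧
      ScDiff (E := E.tangent) (F := F) k (fun p : E.lvl 1 × E.lvl 0 => D p.1 p.2)
        (tangentDom U) := by
  obtain ⟨-, Tf, hTf, hTf'⟩ := h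
  choose! D hD hD' using hTf
  refine ⟨D, hD, (hTf'.snd (F := F.shift) (G := F) hU.tangentDom).congr ?_⟩
  rintro m ⟨x, l⟩ hx
  rw [BanachScale.emb_prod]
  exact (hD' _ (hU.shift.emb_mem (m := m) hx) _).2.symm

end Germs

/-! ### Existence, uniqueness and continuity of the solution of a contraction equation. -/

section Contraction

/-- Since `F (b, ·)` is the identity up to a `Θ`-contraction, it maps a ball onto a neighbourhood of
`0` and satisfies `(1 - Θ) ‖u - u'‖ ≤ ‖F (b, u) - F (b, u')‖`. The inequality gives uniqueness and,
comparing `δ b'` with the fixed `δ b`, continuity at all nearby parameters. -/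
theorem exists_solution_of_contraction {P A : Type*} [NormedAddCommGroup P]
    [NormedAddCommGroup A] [NormedSpace ℝ A] [CompleteSpace A] {F : P × A → A} {O : Set (P × A)}
    (hO : IsOpen O) (h0 : (0 : P × A) ∈ O) (hF : ContinuousOn F O) (hF0 : F 0 = 0) {Θ : ℝ}
    (hΘ0 : 0 ≤ Θ) (hΘ : Θ < 1) (hc : ∀ b u u', (b, u) ∈ O → (b, u') ∈ O →
      ‖(u - F (b, u)) - (u' - F (b, u'))‖ ≤ Θ * ‖u - u'‖) :
    ∃ δ : P → A, δ 0 = 0 ∧ (∀ᶠ b in 𝓝 0, ContinuousAt δ b ∧ F (b, δ b) = 0) ∧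
      ∀ᶠ p in 𝓝 (0 : P × A), F p = 0 → p.2 = δ p.1 := by
  have hest : ∀ b u u', (b, u) ∈ O → (b, u') ∈ O →
      ‖u - u'‖ ≤ (1 - Θ)⁻¹ * ‖F (b, u) - F (b, u')‖ := by
    intro b u u' h h'
    have h1 := hc b u u' h h'
    have h2 : u - u' = ((u - F (b, u)) - (u' - F (b, u'))) + (F (b, u) - F (b, u')) := by abel
    have h3 := norm_add_le ((u - F (b, u)) - (u' - F (b, u'))) (F (b, u) - F (b, u'))
    rw [← h2] at h3
    rw [inv_mul_eq_div, le_div_iff₀ (by linarith)]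
    linarith
  obtain ⟨s, hs, t, ht, hst⟩ := mem_nhds_prod_iff.1 (hO.mem_nhds h0)
  obtain ⟨ε, hε, hεt⟩ := Metric.nhds_basis_closedBall.mem_iff.1 ht
  -- The image of the `ε`-ball contains the ball of radius `(1 - Θ) ε` about `F (b, 0)`, which
  -- therefore has to contain `0`.
  have hcont0 : ∀ᶠ b in 𝓝 (0 : P), ‖F (b, 0)‖ < (1 - Θ) * ε := by
    have h1 : ContinuousAt (fun b : P => F (b, 0)) 0 :=
      ContinuousAt.comp (f := fun b : P => (b, (0 : A))) (g := F)
        (hF.continuousAt (hO.mem_nhds h0)) (by fun_prop)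
    refine h1.norm.eventually_lt_const ?_
    have : F (0, 0) = 0 := hF0
    simp only [this, norm_zero]
    exact mul_pos (by linarith) hε
  obtain ⟨V, hVs, hVo, hV0⟩ := mem_nhds_iff.1 (inter_mem hs hcont0)
  have hex : ∀ b ∈ V, ∃ u ∈ Metric.closedBall (0 : A) ε, F (b, u) = 0 := by
    intro b hb
    have hap : ApproximatesLinearOn (fun u => F (b, u)) (ContinuousLinearMap.id ℝ A)
        (Metric.closedBall 0 ε) ⟨Θ, hΘ0⟩ := by
      intro u hu u' hu'
      have h1 := hc b u u' (hst ⟨(hVs hb).1, hεt hu⟩) (hst ⟨(hVs hb).1, hεt hu'⟩)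
      rw [← norm_neg] at h1
      refine le_trans (le_of_eq ?_) h1
      congr 1
      simp only [ContinuousLinearMap.id_apply]
      abel
    let R : (ContinuousLinearMap.id ℝ A).NonlinearRightInverse :=
      { toFun := id, nnnorm := 1, bound' := by simp, right_inv' := fun _ => rfl }
    have := hap.surjOn_closedBall_of_nonlinearRightInverse R hε.le Subset.rfl
    obtain ⟨u, hu, hu'⟩ := this (a := 0) (by
      rw [mem_closedBall_iff_norm', sub_zero]
      refine (hVs hb).2.le.trans (le_of_eq ?_)
      simp only [R, NNReal.coe_one, inv_one]
      rfl)
    exact ⟨u, hu, hu'⟩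
  choose! δ hδ hδ' using hex
  have hmem : ∀ b ∈ V, (b, δ b) ∈ O := fun b hb => hst ⟨(hVs hb).1, hεt (hδ b hb)⟩
  have huniq : ∀ b ∈ V, ∀ u, (b, u) ∈ O → F (b, u) = 0 → u = δ b := by
    intro b hb u hu h
    have := hest b u (δ b) hu (hmem b hb)
    rw [h, hδ' b hb, sub_zero, norm_zero, mul_zero] at this
    exact sub_eq_zero.1 (norm_le_zero_iff.1 this)
  refine ⟨δ, (huniq 0 hV0 0 h0 hF0).symm, ?_, ?_⟩
  · filter_upwards [hVo.mem_nhds hV0] with b hb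
    refine ⟨?_, hδ' b hb⟩
    have hcb : ContinuousAt (fun b' => F (b', δ b)) b :=
      ContinuousAt.comp (f := fun b' : P => (b', δ b)) (g := F)
        (hF.continuousAt (hO.mem_nhds (hmem b hb))) (by fun_prop)
    rw [ContinuousAt, tendsto_iff_norm_sub_tendsto_zero]
    refine squeeze_zero' (Eventually.of_forall fun _ => norm_nonneg _)
      (g := fun b' => (1 - Θ)⁻¹ * ‖F (b', δ b)‖) ?_ ?_
    · have h1 : ∀ᶠ b' in 𝓝 b, (b', δ b) ∈ O :=
        (Continuous.continuousAt (by fun_prop : Continuous fun b' : P => (b', δ b))).eventually_mem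
          (hO.mem_nhds (hmem b hb))
      filter_upwards [hVo.mem_nhds hb, h1] with b' hb' h1
      have := hest b' (δ b') (δ b) (hmem b' hb') h1
      rwa [hδ' b' hb', zero_sub, norm_neg] at this
    · have := (hcb.norm.tendsto).const_mul (1 - Θ)⁻¹
      rwa [hδ' b hb, norm_zero, mul_zero] at this
  · filter_upwards [hO.mem_nhds h0, continuousAt_fst.eventually_mem (hVo.mem_nhds hV0)] with p hp hb h
    exact huniq p.1 hb p.2 hp h

universe u₁ u₂

variable {P : Type u₁} [NormedAddCommGroup P] [NormedSpace ℝ P] [FiniteDimensional ℝ P]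
  {W : ScBanach.{u₂}} {F : P × W.lvl 0 → W.lvl 0}

theorem scConst_prod_emb (m : ℕ) (b : P) (x : W.lvl m) :
    ((scConst P).prod W).emb m (b, x) = (b, W.emb m x) := by
  rw [BanachScale.emb_prod, scConst_emb]

/-- The solution germ of a level contraction. -/
theorem IsLevelContraction.exists_solution (hc : IsLevelContraction F) (hF0 : F 0 = 0)
    (hF : ScGermDiff (E := (scConst P).prod W) (F := W) 0 F) :
    ∃ δ : P → W.lvl 0, δ 0 = 0 ∧ ScPlotAt 0 δ 0 ∧
      ∀ᶠ p in 𝓝 (0 : P × W.lvl 0), F p = 0 ↔ p.2 = δ p.1 := by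
  obtain ⟨U, hU, hU0, hUn, hF⟩ := hF
  have key : ∀ m, ∃ δ : P → W.lvl m, δ 0 = 0 ∧
      (∀ᶠ b in 𝓝 0, ContinuousAt δ b ∧ F (b, W.emb m (δ b)) = 0) ∧
      ∀ᶠ p in 𝓝 (0 : P × W.lvl m), F (p.1, W.emb m p.2) = 0 → p.2 = δ p.1 := by
    intro m
    obtain ⟨Fm, hFm, hFm'⟩ := hF m
    obtain ⟨Θ, hΘ0, hΘ, N, hN, hN0, h⟩ := hc m
    have hFm' : ∀ b x, (b, x) ∈ U m → W.emb m (Fm (b, x)) = F (b, W.emb m x) := fun b x hx => by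
      rw [hFm' (b, x) hx, scConst_prod_emb]
    have hFm0 : Fm 0 = 0 := W.emb_injective m (by
      have := hFm' 0 0 (hU0 m)
      rw [map_zero] at this ⊢
      exact this.trans hF0)
    obtain ⟨δ, h1, h2, h3⟩ := exists_solution_of_contraction (P := P) (A := W.lvl m)
      (O := U m ∩ N) (F := Fm) ((hU m).inter hN) ⟨hU0 m, hN0⟩ (hFm.mono inter_subset_left) hFm0
      hΘ0 hΘ (fun b u u' hu hu' => h b u u' _ _ hu.2 hu'.2 (hFm' _ _ hu.1) (hFm' _ _ hu'.1))
    refine ⟨δ, h1, ?_, ?_⟩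
    · have h4 : ContinuousAt (fun b => (b, δ b)) 0 := continuousAt_id.prodMk h2.self_of_nhds.1
      have h5 : ∀ᶠ b in 𝓝 0, (b, δ b) ∈ U m :=
        h4.eventually_mem ((hU m).mem_nhds (by rw [h1]; exact hU0 m))
      filter_upwards [h2, h5] with b hb hb'
      exact ⟨hb.1, by rw [← hFm' _ _ hb', hb.2, map_zero]⟩
    · filter_upwards [h3, (hU m).mem_nhds (hU0 m)] with p hp hp' h
      refine hp (W.emb_injective m ?_)
      rw [map_zero]
      exact (hFm' p.1 p.2 hp').trans h
  obtain ⟨δ, h1, h2, h3⟩ := key 0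
  refine ⟨δ, h1, fun m => ?_, ?_⟩
  · obtain ⟨δm, g1, g2, g3⟩ := key m
    refine ⟨δm, ?_, ?_⟩
    · rw [Nat.cast_zero, contDiffAt_zero]
      exact ⟨_, g2, fun b hb => hb.1.continuousWithinAt⟩
    -- Viewed in level `0`, the solution found on level `m` also solves the equation, so uniqueness
    -- there identifies it with `δ`, on a neighbourhood that may depend on `m`.
    · have h4 : Tendsto (fun b => (b, W.emb m (δm b))) (𝓝 0) (𝓝 (0 : P × W.lvl 0)) := by
        have : ContinuousAt (fun b => (b, W.emb m (δm b))) 0 :=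
          continuousAt_id.prodMk ((W.emb m).continuous.continuousAt.comp g2.self_of_nhds.1)
        rw [ContinuousAt, g1, map_zero] at this
        exact this
      filter_upwards [g2, h4.eventually h3] with b hb hb'
      exact hb' hb.2
  · filter_upwards [h3, (continuousAt_fst (p := (0 : P × W.lvl 0))).eventually h2] with p hp hp'
    refine ⟨hp, fun h => ?_⟩
    have : p = (p.1, δ p.1) := Prod.ext rfl h
    rw [this]
    exact hp'.2

end Contraction

/-! ### The contraction estimate for the partial derivative. -/

section Regularity

universe u₁ u₂

theorem ContinuousLinearMap.exists_inverse_of_norm_sub_le {A : Type*} [NormedAddCommGroup A]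
    [NormedSpace ℝ A] [CompleteSpace A] {M : A →L[ℝ] A} {Θ : ℝ} (hΘ0 : 0 ≤ Θ) (hΘ : Θ < 1)
    (h : ∀ x, ‖x - M x‖ ≤ Θ * ‖x‖) : ∃ R : A →L[ℝ] A, (∀ x, R (M x) = x) ∧ (∀ x, M (R x) = x) ∧
      ∀ x, ‖R x‖ ≤ (1 - Θ)⁻¹ * ‖x‖ := by
  have h1 : ‖(1 : A →L[ℝ] A) - M‖ < 1 :=
    (ContinuousLinearMap.opNorm_le_bound _ hΘ0 fun x => h x).trans_lt hΘ
  let u := Units.oneSub ((1 : A →L[ℝ] A) - M) h1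
  have hu : (u : A →L[ℝ] A) = M := by simp [u]
  have hR : ∀ x, M ((↑u⁻¹ : A →L[ℝ] A) x) = x := fun x => by
    rw [← hu]; exact DFunLike.congr_fun (u.mul_inv) x
  refine ⟨↑u⁻¹, fun x => ?_, hR, fun x => ?_⟩
  · rw [← hu]; exact DFunLike.congr_fun (u.inv_mul) x
  · have h2 := h ((↑u⁻¹ : A →L[ℝ] A) x)
    rw [hR] at h2
    have h3 := norm_sub_norm_le ((↑u⁻¹ : A →L[ℝ] A) x) x
    rw [inv_mul_eq_div, le_div_iff₀ (by linarith)]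
    linarith

variable {P : Type u₁} [NormedAddCommGroup P] [NormedSpace ℝ P] [FiniteDimensional ℝ P]
  {W : ScBanach.{u₂}} {F : P × W.lvl 0 → W.lvl 0}

theorem scConst_prod_shift_emb (m : ℕ) (b : P) (x : W.lvl (m + 1)) :
    ((scConst P).prod W).shift.emb m (b, x) = (b, W.shift.emb m x) := by
  refine (BanachScale.emb_prod (scConst P).shift.toBanachScale W.shift.toBanachScale m _).trans ?_
  exact Prod.ext (scConst_emb P m b) rfl

/-- The contraction estimate passes to difference quotients with the same `Θ`. For a direction `ζ`
in level `m + 1`, the curve `s ↦ F (b, w + s ζ)` is `C¹` into level `m`, one level being lost. All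
directions in level `m` follow by density and continuity of the derivative. -/
theorem norm_sub_deriv_le {U : ∀ m, Set (((scConst P).prod W).lvl m)} (hU : ∀ m, IsOpen (U m))
    (hUn : NestedFamily U) (hF : ScDiff (E := (scConst P).prod W) (F := W) 1 F U)
    {D : P × W.lvl 1 → P × W.lvl 0 →L[ℝ] W.lvl 0}
    (hD : ∀ x ∈ U 1, HasScDeriv (E := (scConst P).prod W) (F := W) F (U 1) x (D x))
    (hDc : ScCont (E := ((scConst P).prod W).tangent) (F := W)
      (fun p : (P × W.lvl 1) × (P × W.lvl 0) => D p.1 p.2) (tangentDom U))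
    {m : ℕ} {Θ : ℝ} (hΘ0 : 0 ≤ Θ) {N : Set (P × W.lvl m)} (hN : IsOpen N)
    (hc : ∀ b u u' y y', (b, u) ∈ N → (b, u') ∈ N → W.emb m y = F (b, W.emb m u) →
      W.emb m y' = F (b, W.emb m u') → ‖(u - y) - (u' - y')‖ ≤ Θ * ‖u - u'‖)
    {b : P} {w : W.lvl (m + 1)} (hw : (b, w) ∈ U (m + 1)) (hwN : (b, W.incl m w) ∈ N)
    {w' y : W.lvl m} (hy : W.emb m y = D (b, W.shift.emb m w) (0, W.emb m w')) :
    ‖w' - y‖ ≤ Θ * ‖w'‖ := by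
  obtain ⟨d, hd, hd'⟩ := hDc m
  have hT : ∀ w', W.emb m (d ((b, w), ((0 : P), w'))) =
      D (b, W.shift.emb m w) (0, W.emb m w') := by
    intro w'
    rw [hd' _ hw, BanachScale.emb_prod]
    simp only
    rw [scConst_prod_shift_emb, scConst_prod_emb]
  have hTc : Continuous fun w' : W.lvl m => d ((b, w), ((0 : P), w')) :=
    hd.comp_continuous (by fun_prop) fun _ => hw
  obtain rfl : y = d ((b, w), ((0 : P), w')) := W.emb_injective m (hy.trans (hT w').symm)
  clear hy
  induction w' using (W.denseRange_incl m).induction_on with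
  | hp => exact isClosed_le (continuous_id.sub hTc).norm (by fun_prop)
  | ih ζ =>
    let γ : ℝ → P × W.lvl (m + 1) := fun s => (b, w + s • ζ)
    have hγ : ContDiff ℝ 1 γ := contDiff_const.prodMk (by fun_prop)
    have hγ0 : γ 0 = (b, w) := by simp [γ]
    have hS : IsOpen (γ ⁻¹' U (m + 1)) := (hU (m + 1)).preimage hγ.continuous
    have h0S : (0 : ℝ) ∈ γ ⁻¹' U (m + 1) := by rw [mem_preimage, hγ0]; exact hw
    obtain ⟨g, hg, hg'⟩ := hF.exists_contDiffOn_comp hUn hS (m := m) (γ := γ) hγ.contDiffOn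
      (fun s hs => hs)
    have hg'' : ∀ s ∈ γ ⁻¹' U (m + 1), W.emb m (g s) = F (b, W.emb m (W.incl m (w + s • ζ))) := by
      intro s hs
      rw [hg' s hs]
      exact congrArg F (scConst_prod_emb (m + 1) _ _)
    have hgd : HasDerivAt g (deriv g 0) 0 :=
      ((hg.contDiffAt (hS.mem_nhds h0S)).differentiableAt (by simp)).hasDerivAt
    have hder : deriv g 0 = d ((b, w), ((0 : P), W.incl m ζ)) := by
      apply W.emb_injective m
      rw [hT]
      have h1 : HasDerivAt (fun s => W.emb m (g s)) (W.emb m (deriv g 0)) 0 :=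
        (W.emb m).hasFDerivAt.comp_hasDerivAt 0 hgd
      have hx : (b, W.shift.emb m w) ∈ U 1 := by
        rw [← scConst_prod_shift_emb]
        exact hUn.shift.emb_mem (m := m) hw
      have h2 : HasDerivAt (fun s : ℝ => ((b, W.shift.emb m (w + s • ζ)) : P × W.lvl 1))
          (0, W.shift.emb m ζ) 0 := by
        refine (hasDerivAt_const _ _).prodMk ?_
        have := (((hasDerivAt_id (0 : ℝ)).smul_const ζ).const_add w)
        have h3 := (W.shift.emb m).hasFDerivAt.comp_hasDerivAt 0 this
        rw [one_smul] at h3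
        exact h3
      have h4 := ((hD _ hx).hasFDerivAt ((hU 1).mem_nhds hx)).comp_hasDerivAt_of_eq 0 h2
        (by rw [zero_smul, add_zero])
      refine h1.unique ((h4.congr_of_eventuallyEq ?_).congr_deriv ?_)
      · filter_upwards [hS.mem_nhds h0S] with s hs
        rw [hg'' s hs]
        exact congrArg (fun z => F (b, z)) (BanachScale.emb_shift _ _ _)
      · exact congrArg (fun z => D (b, W.shift.emb m w) (0, z))
          (BanachScale.emb_shift W.toBanachScale m ζ).symm
    rw [← hder]
    have h5 : HasDerivAt (fun s : ℝ => s • W.incl m ζ - g s) (W.incl m ζ - deriv g 0) 0 := by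
      have := (hasDerivAt_id (0 : ℝ)).smul_const (W.incl m ζ)
      rw [one_smul] at this
      exact this.sub hgd
    refine h5.le_of_lip' (by positivity) ?_
    have hN' : ∀ᶠ s : ℝ in 𝓝 0, (b, W.incl m (w + s • ζ)) ∈ N := by
      refine ContinuousAt.eventually_mem (f := fun s : ℝ => (b, W.incl m (w + s • ζ)))
        (by fun_prop) (hN.mem_nhds ?_)
      simpa using hwN
    filter_upwards [hN', hS.mem_nhds h0S] with s hs hs'
    have h6 := hc b _ _ _ _ hs hN'.self_of_nhds (hg'' s hs') (hg'' 0 h0S)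
    simp only [zero_smul, add_zero, map_add, map_smul, add_sub_cancel_left, norm_smul] at h6
    rw [zero_smul, zero_sub, sub_zero, mul_assoc, mul_comm ‖W.incl m ζ‖]
    refine le_trans (le_of_eq ?_) h6
    congr 1
    abel

end Regularity

/-! ### Differentiability of the solution germ. -/

section Regularity

universe u₁ u₂

variable {P : Type u₁} [NormedAddCommGroup P] [NormedSpace ℝ P] [FiniteDimensional ℝ P]
  {W : ScBanach.{u₂}} {F : P × W.lvl 0 → W.lvl 0}

/-- Sc-differentiability of `F` controls the error only by the level `1` norm, so one first needs
`δ₁ b' - δ₁ b = O(b' - b)` in level `1`. By contraction this difference is bounded by `F (b', δ b)`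
in level `1`, which is `C¹` in `b'` and zero at `b` because `δ b` comes from the level `2` point
`w₂`. Then `D (b' - b, δ b' - δ b) = o(b' - b)`, and `R` solves for `δ b' - δ b`. -/
theorem hasFDerivAt_solution {U : ∀ m, Set (((scConst P).prod W).lvl m)}
    (hU : ∀ m, IsOpen (U m)) (hUn : NestedFamily U)
    (hF : ScDiff (E := (scConst P).prod W) (F := W) 1 F U)
    {D : P × W.lvl 0 →L[ℝ] W.lvl 0} {Θ : ℝ} (hΘ : Θ < 1) {N : Set (P × W.lvl 1)} (hN : IsOpen N)
    (hc : ∀ b u u' y y', (b, u) ∈ N → (b, u') ∈ N → W.emb 1 y = F (b, W.emb 1 u) →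
      W.emb 1 y' = F (b, W.emb 1 u') → ‖(u - y) - (u' - y')‖ ≤ Θ * ‖u - u'‖)
    {δ : P → W.lvl 0} {δ₁ : P → W.lvl 1} {b : P} {w₂ : W.lvl 2} (hw₂ : W.incl 1 w₂ = δ₁ b)
    (hw₂U : (b, w₂) ∈ U 2) (hbN : (b, δ₁ b) ∈ N) (hδc : ContinuousAt δ₁ b)
    (hδ : ∀ᶠ b' in 𝓝 b, W.incl 0 (δ₁ b') = δ b' ∧ F (b', δ b') = 0)
    (hD : HasScDeriv (E := (scConst P).prod W) (F := W) F (U 1) (b, δ₁ b) D)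
    {R : W.lvl 0 →L[ℝ] W.lvl 0} (hR : ∀ x, R (D (0, x)) = x) :
    HasFDerivAt δ (-(R.comp (D.comp (ContinuousLinearMap.inl ℝ P (W.lvl 0))))) b := by
  let γ : P → P × W.lvl 2 := fun b' => (b', w₂)
  have hγ : ContDiff ℝ 1 γ := contDiff_id.prodMk contDiff_const
  have hS : IsOpen (γ ⁻¹' U 2) := (hU 2).preimage hγ.continuous
  obtain ⟨g, hg, hg'⟩ := hF.exists_contDiffOn_comp hUn hS (m := 1) (γ := γ) hγ.contDiffOn
    (fun s hs => hs)
  have hb1 := hδ.self_of_nhds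
  have hg'' : ∀ b' ∈ γ ⁻¹' U 2, W.emb 1 (g b') = F (b', W.emb 1 (δ₁ b)) := by
    intro b' hb'
    rw [hg' b' hb', ← hw₂]
    exact congrArg F (scConst_prod_emb 2 _ _)
  have hgb : g b = 0 := W.emb_injective 1 (by
    rw [hg'' b hw₂U, map_zero]
    exact (congrArg (fun z => F (b, z)) hb1.1).trans hb1.2)
  have hgO : g =O[𝓝 b] fun b' => b' - b := by
    have := ((hg.contDiffAt (hS.mem_nhds hw₂U)).differentiableAt (by simp)).isBigO_sub
    simpa only [hgb, sub_zero] using this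
  have hδO : (fun b' => δ₁ b' - δ₁ b) =O[𝓝 b] fun b' => b' - b := by
    refine Asymptotics.IsBigO.trans (Asymptotics.IsBigO.of_bound (1 - Θ)⁻¹ ?_) hgO
    have h1 : ∀ᶠ b' in 𝓝 b, (b', δ₁ b') ∈ N :=
      (continuousAt_id.prodMk hδc).eventually_mem (hN.mem_nhds hbN)
    have h2 : ∀ᶠ b' in 𝓝 b, (b', δ₁ b) ∈ N :=
      (continuousAt_id.prodMk continuousAt_const).eventually_mem (hN.mem_nhds hbN)
    filter_upwards [h1, h2, hδ, hS.mem_nhds hw₂U] with b' h1 h2 h3 h4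
    have h5 := hc b' _ _ 0 (g b') h1 h2
      (by rw [map_zero]; exact ((congrArg (fun z => F (b', z)) h3.1).trans h3.2).symm) (hg'' b' h4)
    have h6 : δ₁ b' - δ₁ b = (δ₁ b' - 0 - (δ₁ b - g b')) - g b' := by abel
    have h7 := norm_sub_le (δ₁ b' - 0 - (δ₁ b - g b')) (g b')
    rw [← h6] at h7
    rw [inv_mul_eq_div, le_div_iff₀ (by linarith)]
    linarith
  have h1 := (hD.hasFDerivAt ((hU 1).mem_nhds
    (by rw [← hw₂]; exact hUn 1 hw₂U))).isLittleO
  have h2 : Tendsto (fun b' => (b', δ₁ b')) (𝓝 b) (𝓝 ((b, δ₁ b) : P × W.lvl 1)) :=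
    continuousAt_id.prodMk hδc
  have h3 : (fun b' => D (b' - b, δ b' - δ b)) =o[𝓝 b] fun b' => b' - b := by
    have h4 := (h1.comp_tendsto h2).trans_isBigO
      (((Asymptotics.isBigO_refl _ _).prod_left hδO : (fun b' => (b' - b, δ₁ b' - δ₁ b))
        =O[𝓝 b] fun b' => b' - b))
    refine h4.neg_left.congr' ?_ EventuallyEq.rfl
    filter_upwards [hδ] with b' hb'
    have e1 : F (b', W.incl 0 (δ₁ b')) = 0 := (congrArg (fun z => F (b', z)) hb'.1).trans hb'.2
    have e2 : F (b, W.incl 0 (δ₁ b)) = 0 := (congrArg (fun z => F (b, z)) hb1.1).trans hb1.2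
    change -(F (b', W.incl 0 (δ₁ b')) - F (b, W.incl 0 (δ₁ b)) -
      D (b' - b, W.incl 0 (δ₁ b' - δ₁ b))) = _
    rw [e1, e2, map_sub, hb'.1, hb1.1]
    abel
  rw [hasFDerivAt_iff_isLittleO]
  refine (((R.isBigO_comp _ _).trans_isLittleO h3)).congr' ?_ EventuallyEq.rfl
  filter_upwards with b'
  have h4 : ((b' - b, δ b' - δ b) : P × W.lvl 0) = (b' - b, 0) + (0, δ b' - δ b) := by simp
  rw [h4, map_add, map_add, hR]
  simp only [neg_apply, ContinuousLinearMap.comp_apply, ContinuousLinearMap.inl_apply]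
  abel

omit [FiniteDimensional ℝ P] in
theorem ScPlotAt.congr {k : ℕ} {δ δ' : P → W.lvl 0} {t : P} (h : ScPlotAt k δ t)
    (hδ : δ =ᶠ[𝓝 t] δ') : ScPlotAt k δ' t := fun m =>
  let ⟨d, hd, hd'⟩ := h m
  ⟨d, hd, by filter_upwards [hd', hδ] with b h1 h2; rw [h1, h2]⟩

/-- The derivative is rebuilt on level `m` from its values on a basis of `P`, after which
`hasFDerivAt_of_injective_comp` makes `δ` differentiable into that level. -/
theorem ScPlotAt.succ_of_hasFDerivAt {k : ℕ} {δ : P → W.lvl 0} {Δ : P → P →L[ℝ] W.lvl 0}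
    (hδ : ScPlotAt 0 δ 0) (hΔ : ScPlotAt k (fun p : P × P => Δ p.1 p.2) 0)
    (h : ∀ᶠ b in 𝓝 0, HasFDerivAt δ (Δ b) b) : ScPlotAt (k + 1) δ 0 := by
  intro m
  obtain ⟨δm, -, hδm'⟩ := hδ m
  obtain ⟨d, hd, hd'⟩ := hΔ m
  let bs := Module.finBasis ℝ P
  have h1 : ∀ᶠ p : P × P in 𝓝 0, ContDiffAt ℝ k d p ∧ ∀ᶠ q in 𝓝 p, W.emb m (d q) = Δ q.1 q.2 :=
    (hd.eventually (by simp)).and hd'.eventually_nhds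
  have h2 : ∀ i, ∀ᶠ ε : ℝ in 𝓝 0, ContDiffAt ℝ k d (0, ε • bs i) ∧
      ∀ᶠ q in 𝓝 ((0 : P), ε • bs i), W.emb m (d q) = Δ q.1 q.2 := by
    intro i
    have h3 : Tendsto (fun ε : ℝ => ((0 : P), ε • bs i)) (𝓝 0) (𝓝 0) := by
      have : Continuous (fun ε : ℝ => ((0 : P), ε • bs i)) := by fun_prop
      have h4 := this.tendsto 0
      rw [zero_smul] at h4
      exact h4
    exact h3.eventually h1
  obtain ⟨ε, hε, hε0⟩ := (((eventually_all.2 h2).filter_mono nhdsWithin_le_nhds).and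
    (self_mem_nhdsWithin (a := (0 : ℝ)) (s := {0}ᶜ))).exists
  -- The lift `d` is only controlled near `(0, 0)`. It is evaluated on the shrunken basis vectors `ε
  -- • bs i` and rescaled, which is harmless as `Δ b` is linear.
  let Dm : P → P →L[ℝ] W.lvl m := fun b => ∑ i,
    (LinearMap.toContinuousLinearMap (bs.coord i)).smulRight (ε⁻¹ • d (b, ε • bs i))
  have hDm : ContDiffAt ℝ k Dm 0 := by
    refine ContDiffAt.sum fun i _ => ContDiffAt.smulRight contDiffAt_const (ContDiffAt.const_smul _ ?_)
    exact (hε i).1.comp (0 : P) (contDiffAt_id.prodMk contDiffAt_const)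
  have hDm' : ∀ᶠ b in 𝓝 0, (W.emb m).comp (Dm b) = Δ b := by
    have h3 : ∀ i, ∀ᶠ b in 𝓝 (0 : P), W.emb m (d (b, ε • bs i)) = Δ b (ε • bs i) := by
      intro i
      have : ContinuousAt (fun b : P => (b, ε • bs i)) 0 := by fun_prop
      exact this.eventually (hε i).2
    filter_upwards [eventually_all.2 h3] with b hb
    ext x
    simp only [Dm, ContinuousLinearMap.comp_apply, _root_.sum_apply,
      ContinuousLinearMap.smulRight_apply, map_sum, map_smul, hb]
    conv_rhs => rw [← bs.sum_repr x, map_sum]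
    refine Finset.sum_congr rfl fun i _ => ?_
    rw [map_smul, inv_smul_smul₀ hε0]
    rfl
  refine ⟨δm, ?_, hδm'⟩
  push_cast
  rw [contDiffAt_succ_iff_hasFDerivAt]
  refine ⟨Dm, ?_, hDm⟩
  obtain ⟨T, hT, hTo, h0T⟩ := mem_nhds_iff.1 (hδm'.eventually_nhds.and
    (h.and (hDm'.and (hDm.eventually (by simp)))))
  refine ⟨T, hTo.mem_nhds h0T, fun t ht => ?_⟩
  refine hasFDerivAt_of_injective_comp (W.emb_injective m) hTo (fun s hs => ?_)
    (fun s hs => (hT hs).2.2.2.continuousAt.continuousWithinAt) ht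
  rw [(hT hs).2.2.1]
  exact (hT hs).2.1.congr_of_eventuallyEq (hT hs).1

end Regularity

/-! ### Smoothness of the solution germ by induction on the order. -/

section Regularity

universe u₁ u₂

theorem ScGermDiff.of_succ {E : ScBanach.{u₁}} {F : ScBanach.{u₂}} {k : ℕ}
    {f : E.lvl 0 → F.lvl 0} (h : ScGermDiff (k + 1) f) : ScGermDiff k f :=
  let ⟨U, h1, h2, h3, h4⟩ := h
  ⟨U, h1, h2, h3, h4.of_succ⟩

/-- The solution germ of an sc-smooth level contraction is smooth on every level. -/
theorem IsLevelContraction.scPlotAt {k : ℕ} : ∀ {P : Type u₁} [NormedAddCommGroup P]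
    [NormedSpace ℝ P] [FiniteDimensional ℝ P] {W : ScBanach.{u₂}} {F : P × W.lvl 0 → W.lvl 0}
    {δ : P → W.lvl 0}, IsLevelContraction F → F 0 = 0 →
    ScGermDiff (E := (scConst P).prod W) (F := W) k F → δ 0 = 0 → ContinuousAt δ 0 →
    (∀ᶠ b in 𝓝 0, F (b, δ b) = 0) → ScPlotAt k δ 0 := by
  induction k with
  | zero =>
    intro P _ _ _ W F δ hc hF0 hF hδ0 hδc hδ
    obtain ⟨δ', -, h2, h3⟩ := hc.exists_solution hF0 hF
    refine h2.congr ?_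
    have h4 : Tendsto (fun b => (b, δ b)) (𝓝 0) (𝓝 (0 : P × W.lvl 0)) := by
      have : ContinuousAt (fun b => (b, δ b)) 0 := continuousAt_id.prodMk hδc
      rw [ContinuousAt, hδ0] at this
      exact this
    filter_upwards [hδ, h4.eventually h3] with b hb hb'
    exact (hb'.1 hb).symm
  | succ k ih =>
    intro P _ _ _ W F δ hc hF0 hF hδ0 hδc hδ
    -- The induction hypothesis is used twice: here for `δ`, so that the coefficients of the
    -- linearized equation are `scᵏ`, and later for the derivative of `δ`, over the parameter space
    -- `P × P`.
    have hplot := ih hc hF0 hF.of_succ hδ0 hδc hδ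
    choose δm hδm hδm' using hplot
    have hc0 := hc
    choose Θ hΘ0 hΘ N hN hN0 hc using hc
    obtain ⟨U, hU, hU0, hUn, hFk⟩ := hF
    have hF1 : ScDiff (E := (scConst P).prod W) (F := W) 1 F U := hFk.of_le (by omega)
    obtain ⟨D, hD, hDk⟩ := hFk.exists_deriv_family hUn
    have hδm0 : ∀ m, δm m 0 = 0 := fun m => W.emb_injective m (by
      rw [(hδm' m).self_of_nhds, hδ0, map_zero])
    have hgood : ∀ m, ∀ᶠ b in 𝓝 (0 : P), ContDiffAt ℝ k (δm m) b ∧ W.emb m (δm m b) = δ b ∧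
        (b, δm m b) ∈ U m ∧ (b, δm m b) ∈ N m ∧ F (b, δ b) = 0 := by
      intro m
      have h1 : ContinuousAt (fun b => (b, δm m b)) 0 :=
        continuousAt_id.prodMk (hδm m).continuousAt
      have h2 := h1.eventually_mem ((hU m).mem_nhds (by rw [hδm0]; exact hU0 m))
      have h3 := h1.eventually_mem ((hN m).mem_nhds (by rw [hδm0]; exact hN0 m))
      exact ((hδm m).eventually (by simp)).and ((hδm' m).and (h2.and (h3.and hδ)))
    have hgood' := fun m => mem_nhds_iff.1 (hgood m)
    choose O hO hOo hO0 using hgood'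
    -- Level `m` of the linearized equation involves the lift of `δ` to level `m + 1`, so the
    -- conditions up to `j = m + 1` are collected; the finite intersections also make the family
    -- nested.
    let V : ℕ → Set P := fun m => ⋂ j ∈ Finset.range (m + 2), O j
    have hVo : ∀ m, IsOpen (V m) := fun m => isOpen_biInter_finset fun j _ => hOo j
    have hV0 : ∀ m, (0 : P) ∈ V m := fun m => mem_iInter₂.2 fun j _ => hO0 j
    have hVO : ∀ {m j b}, b ∈ V m → j ≤ m + 1 → b ∈ O j := fun {m j b} hb hj =>
      mem_iInter₂.1 hb j (Finset.mem_range.2 (by omega))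
    have hVn : ∀ m, V (m + 1) ⊆ V m := fun m b hb =>
      mem_iInter₂.2 fun j hj => hVO hb (by have := Finset.mem_range.1 hj; omega)
    have hincl : ∀ {m b}, b ∈ V m → W.incl m (δm (m + 1) b) = δm m b := fun {m b} hb =>
      W.emb_injective m ((hO _ (hVO hb le_rfl)).2.1.trans (hO _ (hVO hb (by omega))).2.1.symm)
    have hshift : ∀ {m b}, b ∈ V m → W.shift.emb m (δm (m + 1) b) = δm 1 b := fun {m b} hb =>
      W.incl_injective 0 (((BanachScale.emb_shift _ _ _).symm.trans
        (hO _ (hVO hb le_rfl)).2.1).trans (hO 1 (hVO hb (by omega))).2.1.symm)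
    -- the equation for the derivative of the solution
    let F' : (P × P) × W.lvl 0 → W.lvl 0 := fun p => D (p.1.1, δm 1 p.1.1) (p.1.2, p.2)
    let U' : ∀ m, Set (((scConst (P × P)).prod W).lvl m) :=
      fun m => {p : (P × P) × W.lvl m | p.1.1 ∈ V m}
    have hU'o : ∀ m, IsOpen (U' m) := fun m => (hVo m).preimage (by fun_prop)
    have hU'n : NestedFamily U' := fun m p hp => hVn m hp
    have hι : ScDiff (E := (scConst (P × P)).prod W) (F := ((scConst P).prod W).tangent) k
        (fun p : (P × P) × W.lvl 0 => ((p.1.1, δm 1 p.1.1), (p.1.2, p.2))) U' := by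
      refine ScDiff.of_contDiffOn hU'o hU'n fun m =>
        ⟨fun p : (P × P) × W.lvl m => ((p.1.1, δm (m + 1) p.1.1), (p.1.2, p.2)), ?_, ?_⟩
      · refine ContDiffOn.prodMk (ContDiffOn.prodMk (by fun_prop) ?_) (by fun_prop)
        intro p hp
        exact ((hO _ (hVO (m := m) hp le_rfl)).1.comp p
          (contDiffAt_fst.comp p contDiffAt_fst)).contDiffWithinAt
      · rintro ⟨⟨b, h⟩, x⟩ hp
        have e₁ := BanachScale.emb_prod ((scConst P).prod W).shift.toBanachScale
          ((scConst P).prod W).toBanachScale m ((b, δm (m + 1) b), (h, x))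
        rw [scConst_prod_emb]
        exact e₁.trans (congrArg₂ Prod.mk ((scConst_prod_shift_emb m b _).trans
          (congrArg (Prod.mk b) (hshift hp))) (scConst_prod_emb m h x))
    have hmaps : ScMapsTo (E := (scConst (P × P)).prod W) (F := ((scConst P).prod W).tangent)
        (fun p : (P × P) × W.lvl 0 => ((p.1.1, δm 1 p.1.1), (p.1.2, p.2))) U' (tangentDom U) := by
      rintro m ⟨⟨b, h⟩, x⟩ hp ⟨⟨b', w⟩, y⟩ hy
      have e₁ := BanachScale.emb_prod ((scConst P).prod W).shift.toBanachScale
          ((scConst P).prod W).toBanachScale m ((b', w), y)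
      rw [scConst_prod_emb] at hy
      have h1 : (b', W.shift.emb m w) = (b, δm 1 b) :=
        (scConst_prod_shift_emb (P := P) m b' w).symm.trans (congrArg Prod.fst (e₁.symm.trans hy))
      obtain rfl : b' = b := congrArg Prod.fst h1
      obtain rfl : w = δm (m + 1) b' := W.shift.emb_injective m
        ((congrArg Prod.snd h1).trans (hshift hp).symm)
      exact (hO _ (hVO (m := m) hp le_rfl)).2.2.1
    have hF'k : ScDiff (E := (scConst (P × P)).prod W) (F := W) k F' U' :=
      hDk.comp hι hU'n (isOpen_tangentDom hU) hmaps
    have hbound : ∀ {m b}, b ∈ V m → ∀ {w' y : W.lvl m},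
        W.emb m y = D (b, δm 1 b) (0, W.emb m w') → ‖w' - y‖ ≤ Θ m * ‖w'‖ := by
      intro m b hb w' y hy
      refine norm_sub_deriv_le hU hUn hF1 hD hDk.scCont (hΘ0 m) (hN m) (hc m)
        (hO _ (hVO hb le_rfl)).2.2.1 ?_ (w' := w') (y := y) (by rw [hshift hb]; exact hy)
      rw [hincl hb]
      exact (hO _ (hVO hb (by omega))).2.2.2.1
    have hinv : ∀ b ∈ V 0, ∃ R : W.lvl 0 →L[ℝ] W.lvl 0, (∀ x, R (D (b, δm 1 b) (0, x)) = x) ∧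
        (∀ x, D (b, δm 1 b) (0, R x) = x) ∧ ∀ x, ‖R x‖ ≤ (1 - Θ 0)⁻¹ * ‖x‖ := fun b hb =>
      ContinuousLinearMap.exists_inverse_of_norm_sub_le
        (M := (D (b, δm 1 b)).comp (ContinuousLinearMap.inr ℝ P (W.lvl 0))) (hΘ0 0) (hΘ 0)
        fun x => hbound hb rfl
    choose! R hR hR' hRn using hinv
    -- `x = Δ b h` is the solution of `D (b, δ b) (h, x) = 0`.
    let Δ : P → P →L[ℝ] W.lvl 0 := fun b =>
      -((R b).comp ((D (b, δm 1 b)).comp (ContinuousLinearMap.inl ℝ P (W.lvl 0))))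
    have hΔ : ScPlotAt k (fun p : P × P => Δ p.1 p.2) 0 := by
      -- `F'` is affine in its last variable, so its contraction property is exactly `hbound`, with
      -- the constants `Θ m` of `F`.
      refine ih (F := F') ?_ (map_zero (D (0, δm 1 0))) ⟨U', hU'o, hV0, hU'n, hF'k⟩ (by simp) ?_ ?_
      · intro m
        refine ⟨Θ m, hΘ0 m, hΘ m, U' m, hU'o m, hV0 m, ?_⟩
        rintro ⟨b, h⟩ u u' y y' hu hu' hy hy'
        rw [sub_sub_sub_comm]
        refine hbound hu ?_
        rw [map_sub, hy, hy', map_sub]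
        simp only [F']
        rw [← map_sub, Prod.mk_sub_mk, sub_self]
      · have h1 : ContinuousAt F' 0 :=
          hF'k.scCont.continuousOn_zero.continuousAt ((hU'o 0).mem_nhds (hV0 0))
        have h2 : ContinuousAt (fun p : P × P => F' (p, 0)) 0 :=
          ContinuousAt.comp (f := fun p : P × P => (p, (0 : W.lvl 0))) (g := F') h1 (by fun_prop)
        rw [ContinuousAt, tendsto_iff_norm_sub_tendsto_zero]
        refine squeeze_zero' (Eventually.of_forall fun _ => norm_nonneg _)
          (g := fun p => (1 - Θ 0)⁻¹ * ‖F' (p, 0)‖) ?_ ?_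
        · have h3 : ∀ᶠ p : P × P in 𝓝 0, p.1 ∈ V 0 :=
            continuousAt_fst.eventually_mem ((hVo 0).mem_nhds (hV0 0))
          filter_upwards [h3] with p hp
          simp only [Prod.fst_zero, Prod.snd_zero, map_zero, sub_zero]
          simp only [Δ, neg_apply, norm_neg]
          exact hRn _ hp _
        · have := h2.norm.tendsto.const_mul (1 - Θ 0)⁻¹
          have h4 : F' (0, 0) = 0 := map_zero (D (0, δm 1 0))
          rwa [h4, norm_zero, mul_zero] at this
      · have h3 : ∀ᶠ p : P × P in 𝓝 0, p.1 ∈ V 0 :=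
          continuousAt_fst.eventually_mem ((hVo 0).mem_nhds (hV0 0))
        filter_upwards [h3] with p hp
        have h4 : ((p.2, Δ p.1 p.2) : P × W.lvl 0) = (p.2, 0) + (0, Δ p.1 p.2) := by simp
        simp only [F']
        rw [h4, map_add]
        have h5 : Δ p.1 p.2 = R p.1 (-D (p.1, δm 1 p.1) (p.2, 0)) := by simp [Δ]
        rw [h5, hR' _ hp, add_neg_cancel]
    refine ScPlotAt.succ_of_hasFDerivAt (Δ := Δ) ?_ hΔ ?_
    · exact fun m => ⟨δm m, (hδm m).of_le (by simp), hδm' m⟩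
    -- `V 1` supplies lifts up to level `2`, as required by `hasFDerivAt_solution`.
    · filter_upwards [(hVo 1).mem_nhds (hV0 1)] with b hb
      refine hasFDerivAt_solution hU hUn hF1 (hΘ 1) (hN 1) (hc 1) (δ₁ := δm 1)
        (w₂ := δm 2 b) (hincl hb) (hO _ (hVO hb le_rfl)).2.2.1 (hO _ (hVO hb (by omega))).2.2.2.1
        (hO _ (hVO hb (by omega))).1.continuousAt ?_
        (hD _ (hO _ (hVO hb (by omega))).2.2.1) (hR b (hVn 0 hb))
      filter_upwards [(hOo 1).mem_nhds (hVO hb (by omega))] with b' hb'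
      exact ⟨(hO _ hb').2.1, (hO _ hb').2.2.2.2⟩

end Regularity

/-! ### Charts of an M-polyfold without boundary. -/

section Charts

variable {X : Type v} [TopologicalSpace X]

theorem Splicing.retr_mem_core {D : ConeDomain} (S : Splicing.{u} D)
    {p : Rn D.n × S.E.lvl 0} (hp : p ∈ S.full) : S.retr p ∈ S.core :=
  ⟨hp, S.idem p.1 hp p.2⟩

theorem Splicing.retr_of_mem_core {D : ConeDomain} (S : Splicing.{u} D)
    {p : Rn D.n × S.E.lvl 0} (hp : p ∈ S.core) : S.retr p = p :=
  Prod.ext rfl hp.2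

theorem Splicing.scDiff_retr {D : ConeDomain} (S : Splicing.{u} D) (k : ℕ) :
    ScDiff (E := S.amb) (F := S.amb) k S.retr (S.amb.levels S.full) :=
  (ScDiff.of_isScOperator (E := S.amb) (F := scR D.n)
    (isScOperator_fst (F := scR D.n) (G := S.E)) _).prodMk
    (S.smooth k) (nestedFamily_levels _)

theorem Splicing.continuousOn_retr {D : ConeDomain} (S : Splicing.{u} D) :
    ContinuousOn S.retr S.full :=
  (S.scDiff_retr 0).scCont.continuousOn_zero

namespace PolyfoldChart

variable (c : PolyfoldChart.{u} X)

theorem target_subset_core : c.map.target ⊆ c.S.core := by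
  obtain ⟨O, -, h⟩ := c.open_target
  rw [h]; exact inter_subset_right

theorem retr_map {x : X} (hx : x ∈ c.map.source) : c.S.retr (c.map x) = c.map x :=
  c.S.retr_of_mem_core (c.target_subset_core (c.map.map_source hx))

theorem inv_map {x : X} (hx : x ∈ c.map.source) : c.inv (c.map x) = x := by
  rw [inv, c.retr_map hx, c.map.left_inv hx]

theorem map_mem_dom {x : X} (hx : x ∈ c.map.source) {A : Set X} (hA : x ∈ A) :
    c.map x ∈ c.dom A := by
  refine ⟨(c.target_subset_core (c.map.map_source hx)).1, ?_, ?_⟩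
  · rw [c.retr_map hx]; exact c.map.map_source hx
  · rwa [c.inv_map hx]

variable {c}

theorem map_inv {A : Set X} {p : Rn c.D.n × c.S.E.lvl 0} (hp : p ∈ c.dom A) :
    c.map (c.inv p) = c.S.retr p :=
  c.map.right_inv hp.2.1

theorem inv_mem_source {A : Set X} {p : Rn c.D.n × c.S.E.lvl 0} (hp : p ∈ c.dom A) :
    c.inv p ∈ c.map.source :=
  c.map.map_target hp.2.1

theorem dom_mono {A B : Set X} (h : A ⊆ B) : c.dom A ⊆ c.dom B :=
  fun _ hp => ⟨hp.1, hp.2.1, h hp.2.2⟩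

variable (c)

/-- At degeneracy zero the constrained coordinates are positive, not merely nonnegative, so the cone
constraints hold automatically nearby. -/
theorem full_mem_nhds {x : X} (hx : x ∈ c.map.source) (hd : c.degeneracy x = 0)
    {p : Rn c.D.n × c.S.E.lvl 0} (hp : p.1 = (c.map x).1) : c.S.full ∈ 𝓝 p := by
  have h0 : ∀ i : Fin c.D.n, (i : ℕ) < c.D.k → (c.map x).1 i ≠ 0 := by
    intro i hi h
    have := (ncard_eq_zero (toFinite _)).1 hd
    exact (this ▸ (⟨hi, h⟩ : i ∈ {i : Fin c.D.n | (i : ℕ) < c.D.k ∧ (c.map x).1 i = 0}) :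
      i ∈ (∅ : Set (Fin c.D.n)))
  obtain ⟨O, hO, hV⟩ := c.D.isOpen
  have hpV : (c.map x).1 ∈ c.D.V := (c.target_subset_core (c.map.map_source hx)).1
  rw [hV] at hpV
  have h1 : ∀ᶠ v in 𝓝 p.1, v ∈ O ∧ ∀ i : Fin c.D.n, (i : ℕ) < c.D.k → 0 < v i := by
    rw [hp]
    refine (hO.eventually_mem hpV.1).and (eventually_all.2 fun i => ?_)
    by_cases hi : (i : ℕ) < c.D.k
    · have h2 : ContinuousAt (fun v : Rn c.D.n => v i) (c.map x).1 := by fun_prop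
      filter_upwards [h2.eventually_const_lt ((hpV.2 i hi).lt_of_ne (h0 i hi).symm)] with v hv _
      exact hv
    · exact Eventually.of_forall fun v h => absurd h hi
  filter_upwards [continuousAt_fst.eventually h1] with z hz
  change z.1 ∈ c.D.V
  rw [hV]
  exact ⟨hz.1, fun i hi => (hz.2 i hi).le⟩

end PolyfoldChart

namespace MPolyfold

variable {P : MPolyfold.{u} X}

theorem degeneracy_eq_zero (hX : P.boundary = ∅) {c : PolyfoldChart.{u} X} (hc : c ∈ P.atlas)
    {x : X} (hx : x ∈ c.map.source) : c.degeneracy x = 0 := by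
  by_contra h
  exact (hX ▸ (⟨c, hc, hx, Nat.one_le_iff_ne_zero.2 h⟩ : x ∈ P.boundary) : x ∈ (∅ : Set X))

theorem full_mem_nhds (hX : P.boundary = ∅) {c : PolyfoldChart.{u} X} (hc : c ∈ P.atlas)
    {A : Set X} {p : Rn c.D.n × c.S.E.lvl 0} (hp : p ∈ c.dom A) : c.S.full ∈ 𝓝 p := by
  have hx := PolyfoldChart.inv_mem_source hp
  refine c.full_mem_nhds hx (degeneracy_eq_zero hX hc hx) ?_
  rw [PolyfoldChart.map_inv hp]
  rfl

theorem continuousAt_inv_and_eventually (hX : P.boundary = ∅) {c : PolyfoldChart.{u} X}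
    (hc : c ∈ P.atlas) {A : Set X} {p : Rn c.D.n × c.S.E.lvl 0} (hp : p ∈ c.dom A) :
    ContinuousAt c.inv p ∧ ∀ᶠ z in 𝓝 p, z ∈ c.dom univ := by
  have hf := full_mem_nhds hX hc hp
  have hr : ContinuousAt c.S.retr p := c.S.continuousOn_retr.continuousAt hf
  obtain ⟨O, hO, ht⟩ := c.open_target
  have hpt := hp.2.1
  have h1 : ∀ᶠ z in 𝓝 p, c.S.retr z ∈ c.map.target := by
    have hpO : c.S.retr p ∈ O := by rw [ht] at hpt; exact hpt.1
    filter_upwards [hr.eventually_mem (hO.mem_nhds hpO), hf] with z hz hz'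
    rw [ht]
    exact ⟨hz, c.S.retr_mem_core hz'⟩
  refine ⟨?_, ?_⟩
  · exact (c.continuousOn_symm _ hpt).tendsto.comp
      (tendsto_nhdsWithin_iff.2 ⟨hr, h1⟩)
  · filter_upwards [h1, hf] with z hz hz'
    exact ⟨hz', hz, mem_univ _⟩

/-- Openness, which needs `∂X = ∅`, is what makes sc-derivatives of local representatives unique and
lets the chain rule be applied to them. -/
theorem isOpen_dom (hX : P.boundary = ∅) {c : PolyfoldChart.{u} X} (hc : c ∈ P.atlas) {A : Set X}
    (hA : IsOpen A) : IsOpen (c.dom A) := by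
  refine isOpen_iff_mem_nhds.2 fun p hp => ?_
  obtain ⟨h1, h2⟩ := continuousAt_inv_and_eventually hX hc hp
  filter_upwards [h2, h1.eventually_mem (hA.mem_nhds hp.2.2)] with z hz hz'
  exact ⟨hz.1, hz.2.1, hz'⟩

theorem map_mem_level {m : ℕ} {x : X} (hx : x ∈ P.level m) {c : PolyfoldChart.{u} X}
    (hc : c ∈ P.atlas) (hxc : x ∈ c.map.source) :
    ∃ z : c.S.amb.lvl m, c.S.amb.emb m z = c.map x := by
  obtain ⟨c', hc', hx', y, hy⟩ := hx
  obtain ⟨g, -, hg⟩ := (P.compatible c' hc' c hc 0).scCont m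
  have h1 : c'.S.amb.emb m ((c'.map x).1, y) = c'.map x := by
    rw [BanachScale.emb_prod, scaleR_emb]
    exact Prod.ext rfl hy
  have h2 : ((c'.map x).1, y) ∈ c'.S.amb.levels (c'.dom c.map.source) m := by
    rw [ScBanach.levels, mem_preimage, h1]
    exact c'.map_mem_dom hx' hxc
  refine ⟨g ((c'.map x).1, y), ?_⟩
  rw [hg _ h2, h1]
  exact congrArg c.map (c'.inv_map hx')

theorem mem_level_of_map {m : ℕ} {x : X} {c : PolyfoldChart.{u} X}
    (hc : c ∈ P.atlas) (hxc : x ∈ c.map.source) {z : c.S.amb.lvl m}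
    (hz : c.S.amb.emb m z = c.map x) : x ∈ P.level m := by
  rw [BanachScale.emb_prod] at hz
  exact ⟨c, hc, hxc, z.2, congrArg Prod.snd hz⟩

end MPolyfold

end Charts

/-! ### Sc-derivatives of fibrewise linear maps along the zero section. -/

section FiberLinear

universe u₁ u₂ u₃

variable {E : ScBanach.{u₁}} {F : ScBanach.{u₂}} {G : ScBanach.{u₃}}

theorem mem_levels {A : Set (E.lvl 0)} {m : ℕ} {x : E.lvl m} :
    x ∈ E.levels A m ↔ E.emb m x ∈ A := Iff.rfl

theorem mem_levels_one {A : Set (E.lvl 0)} {x : E.lvl 1} :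
    x ∈ E.levels A 1 ↔ E.incl 0 x ∈ A := Iff.rfl

theorem scDeriv_eq {f : E.lvl 0 → F.lvl 0} {A : Set (E.lvl 0)} {A' : Set (E.lvl 1)}
    {x : E.lvl 1} {D : E.lvl 0 →L[ℝ] F.lvl 0} (hD : HasScDeriv f A' x D) (hA' : A' ∈ 𝓝 x)
    (hA : A ∈ 𝓝 (E.incl 0 x)) : scDeriv f A (E.incl 0 x) = D := by
  have hA1 : E.incl 0 ⁻¹' A ∈ 𝓝 x := (E.incl 0).continuous.continuousAt hA
  have h : ∃ D : E.lvl 0 →L[ℝ] F.lvl 0, ∃ x₁ : E.lvl 1,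
      E.incl 0 x₁ = E.incl 0 x ∧ HasScDeriv f (E.incl 0 ⁻¹' A) x₁ D :=
    ⟨D, x, rfl, (hD.hasFDerivAt hA').hasFDerivWithinAt⟩
  rw [scDeriv, dif_pos h]
  obtain ⟨x₁, hx₁, h1⟩ := h.choose_spec
  obtain rfl := E.incl_injective 0 hx₁
  exact h1.unique hA1 hD hA'

/-- The sc-derivative at `(x, 0)` of a map that is linear on fibres. -/
theorem HasScDeriv.apply_of_linear {g : E.lvl 0 × F.lvl 0 → G.lvl 0} {U : ∀ m, Set (E.lvl m)}
    (hU : ∀ m, IsOpen (U m)) (hUn : NestedFamily U)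
    (hg : ScCont (E := E.prod F) (F := G) g (fun m => {p : E.lvl m × F.lvl m | p.1 ∈ U m}))
    {ℓ : E.lvl 0 → F.lvl 0 →ₗ[ℝ] G.lvl 0} (hℓ : ∀ x ∈ U 0, ∀ h, g (x, h) = ℓ x h)
    {x : E.lvl 1} (hx : x ∈ U 1) {V : Set (E.lvl 1 × F.lvl 1)} (hV : V ∈ 𝓝 (x, 0))
    {D : E.lvl 0 × F.lvl 0 →L[ℝ] G.lvl 0}
    (hD : HasScDeriv (E := E.prod F) (F := G) g V (x, 0) D) (ξ : E.lvl 0) (η : F.lvl 0) :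
    D (ξ, η) = ℓ (E.incl 0 x) η := by
  have hd := hD.hasFDerivAt hV
  have hx0 : E.incl 0 x ∈ U 0 := hUn 0 hx
  have hgc : Continuous fun h => g (E.incl 0 x, h) :=
    hg.continuousOn_zero.comp_continuous (by fun_prop) fun h => hx0
  -- `g` vanishes on the zero section, hence so does its derivative in base directions, first on
  -- `E₁` and then by density.
  have h1 : ∀ ξ, D (ξ, 0) = 0 := by
    have h2 : HasFDerivAt (fun y : E.lvl 1 => (y, (0 : F.lvl 1)))
        (ContinuousLinearMap.inl ℝ (E.lvl 1) (F.lvl 1)) x := hasFDerivAt_prodMk_left x 0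
    have h3 := HasFDerivAt.comp x hd h2
    have h4 : HasFDerivAt (fun _ : E.lvl 1 => (0 : G.lvl 0)) (0 : E.lvl 1 →L[ℝ] G.lvl 0) x :=
      hasFDerivAt_const _ _
    have h5 := h3.unique (h4.congr_of_eventuallyEq (by
      filter_upwards [(hU 1).mem_nhds hx] with y hy
      have h6 := hℓ _ (hUn 0 hy) 0
      rw [map_zero] at h6
      refine Eq.trans ?_ h6
      exact congrArg (fun z => g (E.incl 0 y, z)) (map_zero (F.incl 0))))
    have h6 : (fun ξ => D (ξ, 0)) = fun _ => 0 :=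
      (E.denseRange_incl 0).equalizer (by fun_prop) continuous_const (funext fun ξ => by
        have h7 := DFunLike.congr_fun h5 ξ
        refine Eq.trans ?_ h7
        exact congrArg (fun z => D (E.incl 0 ξ, z)) (map_zero (F.incl 0)).symm)
    exact fun ξ => congrFun h6 ξ
  have h2 : (fun η => D (0, η)) = fun η => ℓ (E.incl 0 x) η := by
    refine (F.denseRange_incl 0).equalizer (by fun_prop)
      (hgc.congr fun h => hℓ _ hx0 h) (funext fun η => ?_)
    have h3 : HasDerivAt (fun s : ℝ => (x, s • η)) ((0 : E.lvl 1), η) 0 := by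
      have h4 := (hasDerivAt_id (0 : ℝ)).smul_const η
      rw [one_smul] at h4
      exact (hasDerivAt_const _ _).prodMk h4
    have h4 := HasFDerivAt.comp_hasDerivAt_of_eq 0 hd h3 (by rw [zero_smul])
    have h5 : HasDerivAt (fun s : ℝ => s • ℓ (E.incl 0 x) (F.incl 0 η))
        (ℓ (E.incl 0 x) (F.incl 0 η)) 0 := by
      have h4 := (hasDerivAt_id (0 : ℝ)).smul_const (ℓ (E.incl 0 x) (F.incl 0 η))
      rwa [one_smul] at h4
    have h6 := h4.unique (h5.congr_of_eventuallyEq (Eventually.of_forall fun s => by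
      beta_reduce
      rw [← map_smul, ← map_smul, ← hℓ _ hx0]
      rfl))
    refine Eq.trans ?_ h6
    exact congrArg (fun z => D (z, F.incl 0 η)) (map_zero (E.incl 0)).symm
  have h3 : ((ξ, η) : E.lvl 0 × F.lvl 0) = (ξ, 0) + (0, η) := by simp
  rw [h3, map_add, h1, zero_add]
  exact congrFun h2 η

end FiberLinear

/-! ### Transition maps and the derivative of a section at a zero. -/

section Linearization

variable {X : Type v} [TopologicalSpace X] {Y : X → Type w}
    [∀ x, AddCommGroup (Y x)] [∀ x, Module ℝ (Y x)] [TopologicalSpace (Tot Y)]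
    {P : MPolyfold.{u} X} {b : StrongBundle P Y} {f : ∀ x, Y x}

theorem BundleChart.toFib_ofFib_toFib (c : BundleChart.{u} Y) {x : X}
    (hx : x ∈ c.base.map.source) (y : Y x) : c.fib.proj (c.base.map x).1 (c.toFib x y) = c.toFib x y := by
  rw [← c.toFib_ofFib x hx, c.ofFib_toFib x hx]

namespace MPolyfold

/-- The chain rule for the transition maps, at a point of `X₁`. -/
theorem hasScDeriv_trans_comp (hX : P.boundary = ∅) {c c' c'' : PolyfoldChart.{u} X}
    (hc : c ∈ P.atlas) (hc' : c' ∈ P.atlas) (hc'' : c'' ∈ P.atlas) {x : X}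
    (hx : x ∈ c.map.source) (hx' : x ∈ c'.map.source) (hx'' : x ∈ c''.map.source)
    {p : c.S.amb.lvl 1} (hp : c.S.amb.incl 0 p = c.map x)
    {p' : c'.S.amb.lvl 1} (hp' : c'.S.amb.incl 0 p' = c'.map x)
    {A : c.S.amb.lvl 0 →L[ℝ] c'.S.amb.lvl 0} {B : c'.S.amb.lvl 0 →L[ℝ] c''.S.amb.lvl 0}
    (hA : HasScDeriv (E := c.S.amb) (F := c'.S.amb) (fun z => c'.map (c.inv z))
      (c.S.amb.levels (c.dom c'.map.source) 1) p A)
    (hB : HasScDeriv (E := c'.S.amb) (F := c''.S.amb) (fun z => c''.map (c'.inv z))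
      (c'.S.amb.levels (c'.dom c''.map.source) 1) p' B) :
    HasScDeriv (E := c.S.amb) (F := c''.S.amb) (fun z => c''.map (c.inv z))
      (c.S.amb.levels (c.dom (c'.map.source ∩ c''.map.source)) 1) p (B.comp A) := by
  have hUV : ∀ z ∈ c.dom (c'.map.source ∩ c''.map.source), c'.inv (c'.map (c.inv z)) = c.inv z :=
    fun z hz => c'.inv_map hz.2.2.1
  have hpm : p ∈ c.S.amb.levels (c.dom (c'.map.source ∩ c''.map.source)) 1 := by
    refine mem_levels_one.2 ?_
    rw [hp]; exact c.map_mem_dom hx ⟨hx', hx''⟩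
  have hp'm : p' ∈ c'.S.amb.levels (c'.dom c''.map.source) 1 := by
    refine mem_levels_one.2 ?_
    rw [hp']; exact c'.map_mem_dom hx' hx''
  have hs : c.dom (c'.map.source ∩ c''.map.source) ⊆ c.dom c'.map.source :=
    PolyfoldChart.dom_mono inter_subset_left
  have ho := fun m => isOpen_levels (E := c'.S.amb) (isOpen_dom hX hc' c''.open_source) m
  have h := HasScDeriv.comp (E := c.S.amb) (F := c'.S.amb) (G := c''.S.amb)
    (U := c.S.amb.levels (c.dom (c'.map.source ∩ c''.map.source)))
    (V := c'.S.amb.levels (c'.dom c''.map.source))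
    (P.compatible c' hc' c'' hc'' 1) ho
    ((P.compatible c hc c' hc' 0).scCont.mono fun m z hz => hs hz) hpm (y := p')
    (by rw [hp', hp, c.inv_map hx]) hp'm
    (HasFDerivWithinAt.mono hA fun z hz => hs hz) ((ho 1).mem_nhds hp'm) hB
  refine HasFDerivWithinAt.congr h (fun z hz => ?_) ?_
  · exact congrArg c''.map (hUV _ hz).symm
  · exact congrArg c''.map (hUV _ hpm).symm

end MPolyfold

namespace StrongBundle

/-- The principal part of `f` in the base chart `d` and the fibre coordinates of `c'`, and its
derivative at a zero of `f`, computed from the chart `c`. -/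
theorem hasScDeriv_mixed (hX : P.boundary = ∅) (hf : b.IsScSmoothSection f)
    {c c' : BundleChart.{u} Y} (hc : c ∈ b.atlas) (hc' : c' ∈ b.atlas)
    {d : PolyfoldChart.{u} X} (hd : d ∈ P.atlas) {x : X} (hxc : x ∈ c.base.map.source)
    (hxc' : x ∈ c'.base.map.source) (hxd : x ∈ d.map.source) (hfx : f x = 0)
    {p : c.base.S.amb.lvl 1} (hp : c.base.S.amb.incl 0 p = c.base.map x)
    {p' : d.S.amb.lvl 1} (hp' : d.S.amb.incl 0 p' = d.map x)
    {L : c.base.S.amb.lvl 0 →L[ℝ] c.fib.E.lvl 0}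
    (hL : HasScDeriv (E := c.base.S.amb) (F := c.fib.E) (c.principal f)
      (c.base.S.amb.levels (c.base.dom univ) 1) p L)
    {A : d.S.amb.lvl 0 →L[ℝ] c.base.S.amb.lvl 0}
    (hA : HasScDeriv (E := d.S.amb) (F := c.base.S.amb) (fun z => c.base.map (d.inv z))
      (d.S.amb.levels (d.dom c.base.map.source) 1) p' A) :
    ∃ T : d.S.amb.lvl 0 →L[ℝ] c'.fib.E.lvl 0,
      HasScDeriv (E := d.S.amb) (F := c'.fib.E) (fun z => c'.toFib (d.inv z) (f (d.inv z)))
        (d.S.amb.levels (d.dom (c.base.map.source ∩ c'.base.map.source)) 1) p' T ∧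
      ∀ ξ, T ξ = c'.toFib x (c.ofFib x (L (A ξ))) := by
  have hcP := b.base_mem c hc
  set Q := d.dom (c.base.map.source ∩ c'.base.map.source) with hQ
  have hs : Q ⊆ d.dom c.base.map.source := PolyfoldChart.dom_mono inter_subset_left
  have hp'm : p' ∈ d.S.amb.levels Q 1 := by
    refine mem_levels_one.2 ?_
    rw [hp']; exact d.map_mem_dom hxd ⟨hxc, hxc'⟩
  have hpm : p ∈ c.base.S.amb.levels (c.base.dom univ) 1 := by
    refine mem_levels_one.2 ?_
    rw [hp]; exact c.base.map_mem_dom hxc (mem_univ _)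
  have hpm' : p ∈ c.base.S.amb.levels (c.base.dom c'.base.map.source) 1 := by
    refine mem_levels_one.2 ?_
    rw [hp]; exact c.base.map_mem_dom hxc hxc'
  have hxp : c.base.S.amb.incl 0 p = c.base.map (d.inv (d.S.amb.incl 0 p')) := by
    rw [hp, hp', d.inv_map hxd]
  have ho : ∀ m, IsOpen (c.base.S.amb.levels (c.base.dom univ) m) :=
    isOpen_levels (MPolyfold.isOpen_dom hX hcP isOpen_univ)
  have ho' : ∀ m, IsOpen (c.base.S.amb.levels (c.base.dom c'.base.map.source) m) :=
    isOpen_levels (MPolyfold.isOpen_dom hX hcP c'.base.open_source)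
  have hα : ScDiff (E := d.S.amb) (F := c.base.S.amb) 1 (fun z => c.base.map (d.inv z))
      (d.S.amb.levels Q) := (P.compatible d hd c.base hcP 1).mono fun m z hz => hs hz
  have hA' : HasScDeriv (E := d.S.amb) (F := c.base.S.amb) (fun z => c.base.map (d.inv z))
      (d.S.amb.levels Q 1) p' A := HasFDerivWithinAt.mono hA fun z hz => hs hz
  have hmaps : ∀ m, ∀ z ∈ d.S.amb.levels Q m, ∀ y : c.base.S.amb.lvl m,
      c.base.S.amb.emb m y = c.base.map (d.inv (d.S.amb.emb m z)) →
      y ∈ c.base.S.amb.levels (c.base.dom c'.base.map.source) m := by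
    intro m z hz y hy
    refine mem_levels.2 ?_
    rw [hy]
    exact c.base.map_mem_dom hz.2.2.1 hz.2.2.2
  have hLA := HasScDeriv.comp (E := d.S.amb) (F := c.base.S.amb) (G := c.fib.E)
    (U := d.S.amb.levels Q) (hf c hc 1) ho hα.scCont hp'm hxp hpm hA' ((ho 1).mem_nhds hpm) hL
  have hfα : ScDiff (E := d.S.amb) (F := c.fib.E) 1
      (fun z => c.principal f (c.base.map (d.inv z))) (d.S.amb.levels Q) :=
    (hf c hc 1).comp hα (nestedFamily_levels _) ho fun m z hz y hy =>
      PolyfoldChart.dom_mono (subset_univ _) (hmaps m z hz y hy)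
  -- the transition map on the fibres
  have hτ := (b.compatible c hc c' hc' 1).1
  have hVn : NestedFamily (E := c.base.S.amb.prod c.fib.E) (fun m =>
      {p : c.base.S.amb.lvl m × c.fib.E.lvl m |
        p.1 ∈ c.base.S.amb.levels (c.base.dom c'.base.map.source) m}) :=
    fun m z hz => hz
  have hVo : ∀ m, IsOpen {p : c.base.S.amb.lvl m × c.fib.E.lvl m |
      p.1 ∈ c.base.S.amb.levels (c.base.dom c'.base.map.source) m} := fun m =>
    (ho' m).preimage continuous_fst
  have hτ2 := ScDiff.snd (F := c'.base.S.amb) (G := c'.fib.E) hτ hVn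
  obtain ⟨K, hK⟩ := hτ2.exists_hasScDeriv (x := ((p, 0) : c.base.S.amb.lvl 1 × c.fib.E.lvl 1)) hpm'
  -- Because `f x = 0`, the fibre transition is differentiated at a zero vector, so the variation of
  -- the transition with the base point contributes nothing.
  have hKL := fun ξ η => HasScDeriv.apply_of_linear (E := c.base.S.amb) (F := c.fib.E)
    (G := c'.fib.E) (U := c.base.S.amb.levels (c.base.dom c'.base.map.source)) ho'
    (nestedFamily_levels _) hτ2.scCont
    (ℓ := fun z => (c'.toFib (c.base.inv z)).comp (c.ofFib (c.base.inv z)))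
    (fun z _ h => rfl) hpm' ((hVo 1).mem_nhds hpm') hK ξ η
  have hmain := HasScDeriv.comp (E := d.S.amb) (F := c.base.S.amb.prod c.fib.E) (G := c'.fib.E)
    (f := fun z => (c.base.map (d.inv z), c.principal f (c.base.map (d.inv z))))
    (U := d.S.amb.levels Q) (A := A.prod (L.comp A)) hτ2 hVo
    (hα.scCont.prodMk hfα.scCont) hp'm
    (y := ((p, 0) : c.base.S.amb.lvl 1 × c.fib.E.lvl 1)) ?_ hpm'
    (HasFDerivWithinAt.prodMk hA' hLA) ((hVo 1).mem_nhds hpm') hK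
  · refine ⟨K.comp (A.prod (L.comp A)), ?_, fun ξ => ?_⟩
    · have hcong : ∀ z ∈ Q, c'.toFib (d.inv z) (f (d.inv z)) =
          c'.toFib (c.base.inv (c.base.map (d.inv z))) (c.ofFib (c.base.inv (c.base.map (d.inv z)))
            (c.principal f (c.base.map (d.inv z)))) := by
        intro z hz
        rw [BundleChart.principal, c.base.inv_map hz.2.2.1, c.ofFib_toFib _ hz.2.2.1]
      exact HasFDerivWithinAt.congr hmain (fun z hz => hcong _ hz) (hcong _ hp'm)
    · refine (hKL (A ξ) (L (A ξ))).trans ?_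
      rw [hp, c.base.inv_map hxc]
      rfl
  · refine Prod.ext hxp ?_
    change c.fib.E.incl 0 0 = _
    rw [map_zero, ← hxp, hp, BundleChart.principal, c.base.inv_map hxc, hfx, map_zero]

end StrongBundle

end Linearization

/-! ### The linearization in an arbitrary bundle chart. -/

section Linearization

variable {X : Type v} [TopologicalSpace X] {Y : X → Type w}
    [∀ x, AddCommGroup (Y x)] [∀ x, Module ℝ (Y x)] [TopologicalSpace (Tot Y)]
    {P : MPolyfold.{u} X} {b : StrongBundle P Y} {f : ∀ x, Y x}

namespace MPolyfold

theorem levels_dom_mem_nhds (hX : P.boundary = ∅) {c : PolyfoldChart.{u} X} (hc : c ∈ P.atlas)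
    {A : Set X} (hA : IsOpen A) {x : X} (hx : x ∈ c.map.source) (hxA : x ∈ A)
    {p : c.S.amb.lvl 1} (hp : c.S.amb.incl 0 p = c.map x) :
    c.S.amb.levels (c.dom A) 1 ∈ 𝓝 p := by
  refine (isOpen_levels (isOpen_dom hX hc hA) 1).mem_nhds (mem_levels_one.2 ?_)
  rw [hp]
  exact c.map_mem_dom hx hxA

theorem levels_full_mem_nhds (hX : P.boundary = ∅) {c : PolyfoldChart.{u} X} (hc : c ∈ P.atlas)
    {x : X} (hx : x ∈ c.map.source) {p : c.S.amb.lvl 1} (hp : c.S.amb.incl 0 p = c.map x) :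
    c.S.amb.levels c.S.full 1 ∈ 𝓝 p :=
  mem_of_superset (levels_dom_mem_nhds hX hc isOpen_univ hx (mem_univ _) hp) fun _ hz => hz.1

theorem hasScDeriv_map_inv {c : PolyfoldChart.{u} X} {x : X} (hx : x ∈ c.map.source) {p : c.S.amb.lvl 1} (hp : c.S.amb.incl 0 p = c.map x)
    {ρ : c.S.amb.lvl 0 →L[ℝ] c.S.amb.lvl 0}
    (hρ : HasScDeriv (E := c.S.amb) (F := c.S.amb) c.S.retr (c.S.amb.levels c.S.full 1) p ρ)
    (A : Set X) (hxA : x ∈ A) :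
    HasScDeriv (E := c.S.amb) (F := c.S.amb) (fun z => c.map (c.inv z))
      (c.S.amb.levels (c.dom A) 1) p ρ := by
  refine HasFDerivWithinAt.congr (HasFDerivWithinAt.mono hρ fun z hz => hz.1)
    (fun z hz => PolyfoldChart.map_inv (mem_levels_one.1 hz)) ?_
  refine PolyfoldChart.map_inv (A := A) ?_
  rw [hp]
  exact c.map_mem_dom hx hxA

/-- The derivatives of mutually inverse transition maps compose to the derivative of the
retraction. -/
theorem hasScDeriv_trans_inverse (hX : P.boundary = ∅) {c c' : PolyfoldChart.{u} X}
    (hc : c ∈ P.atlas) (hc' : c' ∈ P.atlas) {x : X}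
    (hx : x ∈ c.map.source) (hx' : x ∈ c'.map.source)
    {p : c.S.amb.lvl 1} (hp : c.S.amb.incl 0 p = c.map x)
    {p' : c'.S.amb.lvl 1} (hp' : c'.S.amb.incl 0 p' = c'.map x)
    {A : c.S.amb.lvl 0 →L[ℝ] c'.S.amb.lvl 0} {B : c'.S.amb.lvl 0 →L[ℝ] c.S.amb.lvl 0}
    (hA : HasScDeriv (E := c.S.amb) (F := c'.S.amb) (fun z => c'.map (c.inv z))
      (c.S.amb.levels (c.dom c'.map.source) 1) p A)
    (hB : HasScDeriv (E := c'.S.amb) (F := c.S.amb) (fun z => c.map (c'.inv z))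
      (c'.S.amb.levels (c'.dom c.map.source) 1) p' B)
    {ρ : c.S.amb.lvl 0 →L[ℝ] c.S.amb.lvl 0}
    (hρ : HasScDeriv (E := c.S.amb) (F := c.S.amb) c.S.retr (c.S.amb.levels c.S.full 1) p ρ) :
    B.comp A = ρ :=
  (hasScDeriv_trans_comp hX hc hc' hc hx hx' hx hp hp' hA hB).unique
    (levels_dom_mem_nhds hX hc (c'.open_source.inter c.open_source) hx ⟨hx', hx⟩ hp)
    (hasScDeriv_map_inv hx hp hρ _ (mem_univ x))
    (levels_dom_mem_nhds hX hc isOpen_univ hx (mem_univ _) hp)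

end MPolyfold

namespace StrongBundle

open MPolyfold

variable {c : BundleChart.{u} Y} {x : X} {p : c.base.S.amb.lvl 1}
  {L : c.base.S.amb.lvl 0 →L[ℝ] c.fib.E.lvl 0}
  {ρ : c.base.S.amb.lvl 0 →L[ℝ] c.base.S.amb.lvl 0}

/-- The principal part is unchanged by the retraction on the source and by `σ` on the target.
Comparing a chart with itself in `hasScDeriv_mixed` differentiates this to `L = σ L ρ`, and
comparing it with itself in `hasScDeriv_trans_inverse` gives `ρ ρ = ρ`. -/
theorem deriv_principal_eq (hX : P.boundary = ∅) (hf : b.IsScSmoothSection f) (hc : c ∈ b.atlas)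
    (hx : x ∈ c.base.map.source) (hfx : f x = 0) (hp : c.base.S.amb.incl 0 p = c.base.map x)
    (hL : HasScDeriv (E := c.base.S.amb) (F := c.fib.E) (c.principal f)
      (c.base.S.amb.levels (c.base.dom univ) 1) p L)
    (hρ : HasScDeriv (E := c.base.S.amb) (F := c.base.S.amb) c.base.S.retr
      (c.base.S.amb.levels c.base.S.full 1) p ρ) :
    (∀ ξ, ρ (ρ ξ) = ρ ξ) ∧ (∀ ξ, L (ρ ξ) = L ξ) ∧
      ∀ ξ, c.fib.proj (c.base.map x).1 (L ξ) = L ξ := by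
  have hcP := b.base_mem c hc
  have hmi := fun A hA => hasScDeriv_map_inv hx hp hρ A hA
  have hρρ : ∀ ξ, ρ (ρ ξ) = ρ ξ := DFunLike.congr_fun
    (hasScDeriv_trans_inverse hX hcP hcP hx hx hp hp (hmi _ hx) (hmi _ hx) hρ)
  obtain ⟨T, hT, hT'⟩ := hasScDeriv_mixed hX hf hc hc hcP hx hx hx hfx hp hp hL (hmi _ hx)
  have hTL : T = L := hT.unique
    (levels_dom_mem_nhds hX hcP (c.base.open_source.inter c.base.open_source) hx ⟨hx, hx⟩ hp)
    hL (levels_dom_mem_nhds hX hcP isOpen_univ hx (mem_univ _) hp)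
  have h1 : ∀ ξ, L ξ = c.fib.proj (c.base.map x).1 (L (ρ ξ)) := fun ξ => by
    rw [← c.toFib_ofFib x hx, ← hT', hTL]
  have hv : (c.base.map x).1 ∈ c.base.D.V :=
    (c.base.target_subset_core (c.base.map.map_source hx)).1
  refine ⟨hρρ, fun ξ => ?_, fun ξ => ?_⟩
  · rw [h1, hρρ, ← h1]
  · rw [h1, c.fib.idem _ hv]

/-- The linearization in a bundle chart. -/
theorem linearization_chart (hX : P.boundary = ∅) (hf : b.IsScSmoothSection f) (hc : c ∈ b.atlas)
    (hx : x ∈ c.base.map.source) (hfx : f x = 0) (hp : c.base.S.amb.incl 0 p = c.base.map x)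
    (hL : HasScDeriv (E := c.base.S.amb) (F := c.fib.E) (c.principal f)
      (c.base.S.amb.levels (c.base.dom univ) 1) p L)
    (hρ : HasScDeriv (E := c.base.S.amb) (F := c.base.S.amb) c.base.S.retr
      (c.base.S.amb.levels c.base.S.full 1) p ρ) :
    ∃ e : P.tangentSpace x ≃ₗ[ℝ] LinearMap.eqLocus ρ.toLinearMap LinearMap.id,
      ∀ ξ, b.linearization f x ξ = c.ofFib x (L (e ξ)) := by
  have hcP := b.base_mem c hc
  set d := P.chartAt x with hd_def
  obtain ⟨hd, hxd⟩ : d ∈ P.atlas ∧ x ∈ d.map.source := (P.cover x).choose_spec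
  set c' := b.chartAt x with hc'_def
  obtain ⟨hc', hxc'⟩ : c' ∈ b.atlas ∧ x ∈ c'.base.map.source := (b.cover x).choose_spec
  have hxl : x ∈ P.level 1 := mem_level_of_map (m := 1) hcP hx hp
  obtain ⟨p', hp'⟩ := map_mem_level hxl hd hxd
  have hp' : d.S.amb.incl 0 p' = d.map x := hp'
  have hp'm : p' ∈ d.S.amb.levels (d.dom c.base.map.source) 1 := by
    refine mem_levels_one.2 ?_
    rw [hp']; exact d.map_mem_dom hxd hx
  have hpm : p ∈ c.base.S.amb.levels (c.base.dom d.map.source) 1 := by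
    refine mem_levels_one.2 ?_
    rw [hp]; exact c.base.map_mem_dom hx hxd
  obtain ⟨A, hA⟩ := ScDiff.exists_hasScDeriv (P.compatible d hd c.base hcP 1) hp'm
  obtain ⟨B, hB⟩ := ScDiff.exists_hasScDeriv (P.compatible c.base hcP d hd 1) hpm
  have hfull := levels_full_mem_nhds hX hd hxd hp'
  obtain ⟨ρd, hρd⟩ := ScDiff.exists_hasScDeriv (d.S.scDiff_retr 1) (mem_of_mem_nhds hfull)
  have hBA := DFunLike.congr_fun (hasScDeriv_trans_inverse hX hd hcP hxd hx hp' hp hA hB hρd)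
  have hAB := DFunLike.congr_fun (hasScDeriv_trans_inverse hX hcP hd hx hxd hp hp' hB hA hρ)
  obtain ⟨T, hT, hT'⟩ := hasScDeriv_mixed hX hf hc hc' hd hx hxc' hxd hfx hp hp' hL hA
  have htan : ∀ ξ, ξ ∈ P.tangentSpace x ↔ ρd ξ = ξ := by
    intro ξ
    have h1 : scDeriv (E := d.S.amb) (F := d.S.amb) d.S.retr d.S.full (d.map x) = ρd := by
      rw [← hp']
      refine scDeriv_eq hρd hfull ?_
      rw [hp']
      exact full_mem_nhds hX hd (d.map_mem_dom hxd (mem_univ x))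
    rw [← h1]
    exact Iff.rfl
  have hlin : ∀ ξ : P.tangentSpace x, b.linearization f x ξ = c.ofFib x (L (A ξ)) := by
    intro ξ
    have h1 : scDeriv (E := d.S.amb) (F := c'.fib.E)
        (fun z => c'.toFib (d.inv z) (f (d.inv z))) (d.dom c'.base.map.source) (d.map x) = T := by
      rw [← hp']
      refine scDeriv_eq hT (levels_dom_mem_nhds hX hd
        (c.base.open_source.inter c'.base.open_source) hxd ⟨hx, hxc'⟩ hp') ?_
      rw [hp']
      exact (isOpen_dom hX hd c'.base.open_source).mem_nhds (d.map_mem_dom hxd hxc')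
    have h2 : b.linearization f x ξ = c'.ofFib x (T ξ) := by
      rw [← h1]; rfl
    rw [h2, hT', c'.ofFib_toFib x hxc']
  let e : P.tangentSpace x ≃ₗ[ℝ] LinearMap.eqLocus ρ.toLinearMap LinearMap.id :=
    { toFun := fun ξ => ⟨A ξ, by
        have h := (htan ξ).1 ξ.2
        refine (hAB (A ξ)).symm.trans ?_
        exact congrArg A ((hBA ξ).trans h)⟩
      map_add' := fun ξ ζ => Subtype.ext (map_add A _ _)
      map_smul' := fun t ξ => Subtype.ext (map_smul A _ _)
      invFun := fun ζ => ⟨B ζ, (htan _).2 (by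
        have h : ρ (ζ : _) = ζ := ζ.2
        refine (hBA (B ζ)).symm.trans ?_
        exact congrArg B ((hAB ζ).trans h))⟩
      left_inv := fun ξ => Subtype.ext ((hBA ξ).trans ((htan ξ).1 ξ.2))
      right_inv := fun ζ => Subtype.ext ((hAB ζ).trans ζ.2) }
  exact ⟨e, hlin⟩

/-- As `L` factors through `ρ` and has values in the image of `σ`, surjectivity on the tangent space
can be tested with arbitrary vectors of the ambient space. -/
theorem surjective_linearization_iff (hX : P.boundary = ∅) (hf : b.IsScSmoothSection f)
    (hc : c ∈ b.atlas)
    (hx : x ∈ c.base.map.source) (hfx : f x = 0) (hp : c.base.S.amb.incl 0 p = c.base.map x)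
    (hL : HasScDeriv (E := c.base.S.amb) (F := c.fib.E) (c.principal f)
      (c.base.S.amb.levels (c.base.dom univ) 1) p L) :
    Function.Surjective (b.linearization f x) ↔
      ∀ η, c.fib.proj (c.base.map x).1 η = η → ∃ ξ, L ξ = η := by
  obtain ⟨ρ, hρ⟩ := ScDiff.exists_hasScDeriv (c.base.S.scDiff_retr 1)
    (mem_of_mem_nhds (levels_full_mem_nhds hX (b.base_mem c hc) hx hp))
  obtain ⟨h1, h2, h3⟩ := deriv_principal_eq hX hf hc hx hfx hp hL hρ
  obtain ⟨e, he⟩ := linearization_chart hX hf hc hx hfx hp hL hρ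
  refine ⟨fun h η hη => ?_, fun h y => ?_⟩
  · obtain ⟨ξ, hξ⟩ := h (c.ofFib x η)
    refine ⟨e ξ, ?_⟩
    have := congrArg (c.toFib x) hξ
    rwa [he, c.toFib_ofFib x hx, c.toFib_ofFib x hx, h3, hη] at this
  · obtain ⟨ξ, hξ⟩ := h (c.toFib x y) (c.toFib_ofFib_toFib hx y)
    refine ⟨e.symm ⟨ρ ξ, h1 ξ⟩, ?_⟩
    rw [he, e.apply_symm_apply]
    change c.ofFib x (L (ρ ξ)) = y
    rw [h2, hξ, c.ofFib_toFib x hx]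

theorem ker_linearization_equiv (hX : P.boundary = ∅) (hf : b.IsScSmoothSection f)
    (hc : c ∈ b.atlas)
    (hx : x ∈ c.base.map.source) (hfx : f x = 0) (hp : c.base.S.amb.incl 0 p = c.base.map x)
    (hL : HasScDeriv (E := c.base.S.amb) (F := c.fib.E) (c.principal f)
      (c.base.S.amb.levels (c.base.dom univ) 1) p L)
    (hρ : HasScDeriv (E := c.base.S.amb) (F := c.base.S.amb) c.base.S.retr
      (c.base.S.amb.levels c.base.S.full 1) p ρ) :
    Nonempty (LinearMap.ker (b.linearization f x) ≃ₗ[ℝ]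
      ↥(LinearMap.eqLocus ρ.toLinearMap LinearMap.id ⊓ LinearMap.ker L.toLinearMap)) := by
  obtain ⟨h1, h2, h3⟩ := deriv_principal_eq hX hf hc hx hfx hp hL hρ
  obtain ⟨e, he⟩ := linearization_chart hX hf hc hx hfx hp hL hρ
  have hker : ∀ ξ, b.linearization f x ξ = 0 ↔ L (e ξ) = 0 := by
    intro ξ
    rw [he]
    refine ⟨fun h => ?_, fun h => by rw [h, map_zero]⟩
    have := congrArg (c.toFib x) h
    rwa [c.toFib_ofFib x hx, h3, map_zero] at this
  exact ⟨
    { toFun := fun ξ => ⟨e ξ, (e ξ).2, (hker ξ).1 ξ.2⟩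
      map_add' := fun ξ ζ => Subtype.ext (by simp)
      map_smul' := fun t ξ => Subtype.ext (by simp)
      invFun := fun ζ => ⟨e.symm ⟨ζ, ζ.2.1⟩, (hker _).2 (by
        rw [e.apply_symm_apply]; exact ζ.2.2)⟩
      left_inv := fun ξ => Subtype.ext (by simp)
      right_inv := fun ζ => Subtype.ext (by simp) }⟩

end StrongBundle

end Linearization

/-! ### Germs on open domains and their composition with plots. -/

section GermLemmas

universe u₁ u₂ u₃ u₄

variable {E : ScBanach.{u₁}} {F : ScBanach.{u₂}} {G : ScBanach.{u₃}}

theorem IsGermDomain.exists_isOpen {C : Set (E.lvl 0)} (hC : C ∈ 𝓝 0) {U : ∀ m, Set (E.lvl m)}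
    (hU : IsGermDomain C U) : ∃ U' : ∀ m, Set (E.lvl m), (∀ m, IsOpen (U' m)) ∧
      (∀ m, (0 : E.lvl m) ∈ U' m) ∧ NestedFamily U' ∧ ∀ m, U' m ⊆ U m := by
  refine ⟨fun m => U m ∩ E.levels (interior C) m, fun m => ?_, fun m => ?_, fun m x hx => ?_,
    fun m => inter_subset_left⟩
  · obtain ⟨O, hO, -, h⟩ := (hU m).1
    have : U m ∩ E.levels (interior C) m = O ∩ E.levels (interior C) m := by
      rw [h, inter_assoc]
      congr 1
      exact inter_eq_right.2 fun x (hx : E.emb m x ∈ interior C) => mem_levels.2 (interior_subset hx)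
    beta_reduce
    rw [this]
    exact hO.inter (isOpen_levels isOpen_interior m)
  · obtain ⟨O, -, h0, h⟩ := (hU m).1
    have h1 : E.emb m (0 : E.lvl m) ∈ interior C := (by rw [map_zero]; exact mem_interior_iff_mem_nhds.2 hC)
    refine ⟨?_, h1⟩
    rw [h]
    exact ⟨h0, mem_levels.2 (interior_subset h1)⟩
  · exact ⟨(hU m).2 hx.1, hx.2⟩

theorem IsScSmoothGerm.scGermDiff {C : Set (E.lvl 0)} (hC : C ∈ 𝓝 0) {f : E.lvl 0 → F.lvl 0}
    (hf : IsScSmoothGerm f C) (k : ℕ) : ScGermDiff k f := by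
  obtain ⟨U, hU, h⟩ := hf k
  obtain ⟨U', h1, h2, h3, h4⟩ := hU.exists_isOpen hC
  exact ⟨U', h1, h2, h3, h.mono h4⟩

/-- Shrinking the domain of a germ so that it is mapped into a given open family. -/
theorem ScCont.exists_scMapsTo {f : E.lvl 0 → F.lvl 0} {U : ∀ m, Set (E.lvl m)}
    (hU : ∀ m, IsOpen (U m)) (hUn : NestedFamily U) (hf : ScCont f U) {V : ∀ m, Set (F.lvl m)}
    (hV : ∀ m, IsOpen (V m)) (hVn : NestedFamily V) :
    ∃ U' : ∀ m, Set (E.lvl m), (∀ m, IsOpen (U' m)) ∧ NestedFamily U' ∧ (∀ m, U' m ⊆ U m) ∧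
      ScMapsTo f U' V ∧ ∀ m, ∀ x ∈ U m, ∀ y ∈ V m, F.emb m y = f (E.emb m x) → x ∈ U' m := by
  refine ⟨fun m => {x | x ∈ U m ∧ ∃ y ∈ V m, F.emb m y = f (E.emb m x)}, fun m => ?_,
    fun m x hx => ?_, fun m x hx => hx.1, fun m x hx y hy => ?_,
    fun m x hx y hy h => ⟨hx, y, hy, h⟩⟩
  · obtain ⟨g, hg, hg'⟩ := hf m
    have : {x | x ∈ U m ∧ ∃ y ∈ V m, F.emb m y = f (E.emb m x)} = U m ∩ g ⁻¹' V m := by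
      ext x
      refine and_congr_right fun hx => ⟨?_, fun h => ⟨g x, h, hg' x hx⟩⟩
      rintro ⟨y, hy, hyx⟩
      obtain rfl := F.emb_injective m (hyx.trans (hg' x hx).symm)
      exact hy
    beta_reduce
    rw [this]
    exact hg.isOpen_inter_preimage (hU m) (hV m)
  · obtain ⟨hx, y, hy, hyx⟩ := hx
    exact ⟨hUn m hx, F.incl m y, hVn m hy, hyx⟩
  · obtain ⟨hx, z, hz, hzx⟩ := hx
    obtain rfl := F.emb_injective m (hy.trans hzx.symm)
    exact hz

variable {P : Type u₄} [NormedAddCommGroup P] [NormedSpace ℝ P]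

theorem ScPlotAt.contDiffAt {k : ℕ} {δ : P → E.lvl 0} {t : P} (h : ScPlotAt k δ t) :
    ContDiffAt ℝ k δ t := by
  obtain ⟨d, hd, hd'⟩ := h 0
  refine hd.congr_of_eventuallyEq ?_
  filter_upwards [hd'] with b hb
  exact hb.symm

theorem ScPlotAt.prodMk {k : ℕ} {δ : P → E.lvl 0} {ε : P → F.lvl 0} {t : P}
    (h : ScPlotAt k δ t) (h' : ScPlotAt k ε t) :
    ScPlotAt (W := E.prod F) k (fun b => (δ b, ε b)) t := fun m => by
  obtain ⟨d, hd, hd'⟩ := h m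
  obtain ⟨e, he, he'⟩ := h' m
  refine ⟨fun b => (d b, e b), hd.prodMk he, ?_⟩
  filter_upwards [hd', he'] with b h1 h2
  rw [BanachScale.emb_prod]
  exact Prod.ext h1 h2

theorem scPlotAt_scConst [FiniteDimensional ℝ P] {Q : Type*} [NormedAddCommGroup Q]
    [NormedSpace ℝ Q] {k : ℕ} {δ : Q → P} {t : Q} (h : ContDiffAt ℝ k δ t) :
    ScPlotAt (W := scConst P) k δ t := fun m =>
  ⟨δ, h, Eventually.of_forall fun b => scConst_emb P m (δ b)⟩

theorem ScPlotAt.comp_contDiffAt {Q : Type*} [NormedAddCommGroup Q] [NormedSpace ℝ Q] {k : ℕ}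
    {δ : P → E.lvl 0} {j : Q → P} {t : Q} (h : ScPlotAt k δ (j t)) (hj : ContDiffAt ℝ k j t) :
    ScPlotAt k (fun s => δ (j s)) t := fun m => by
  obtain ⟨d, hd, hd'⟩ := h m
  exact ⟨fun s => d (j s), hd.comp t hj, hj.continuousAt.eventually hd'⟩

/-- The `k` levels that `f` loses are regained by lifting the plot to level `m + k`; this is why
plots are required to lift to all levels. -/
theorem ScDiff.comp_scPlotAt [FiniteDimensional ℝ P] {k : ℕ} {f : E.lvl 0 → F.lvl 0}
    {U : ∀ m, Set (E.lvl m)} (hf : ScDiff k f U) (hU : ∀ m, IsOpen (U m)) (hUn : NestedFamily U)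
    {γ : P → E.lvl 0} {t : P} (hγ : ScPlotAt k γ t)
    (ht : ∀ m, ∀ y, E.emb m y = γ t → y ∈ U m) : ScPlotAt k (fun s => f (γ s)) t := by
  intro m
  obtain ⟨d, hd, hd'⟩ := hγ (m + k)
  obtain ⟨S, hS, hSo, htS⟩ := mem_nhds_iff.1 (hd'.and ((hd.eventually (by simp)).and
    (hd.continuousAt.eventually_mem ((hU _).mem_nhds (ht _ _ hd'.self_of_nhds)))))
  obtain ⟨g, hg, hg'⟩ := hf.exists_contDiffOn_comp hUn hSo (m := m) (γ := d)
    (fun s hs => (hS hs).2.1.contDiffWithinAt) (fun s hs => (hS hs).2.2)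
  refine ⟨g, hg.contDiffAt (hSo.mem_nhds htS), ?_⟩
  filter_upwards [hSo.mem_nhds htS] with s hs
  rw [hg' s hs, (hS hs).1]

theorem ScGermDiff.comp_scPlotAt [FiniteDimensional ℝ P] {k : ℕ} {f : E.lvl 0 → F.lvl 0}
    (hf : ScGermDiff k f) {γ : P → E.lvl 0} {t : P} (hγ : ScPlotAt k γ t) (ht : γ t = 0) :
    ScPlotAt k (fun s => f (γ s)) t := by
  obtain ⟨U, hU, hU0, hUn, hf⟩ := hf
  refine hf.comp_scPlotAt hU hUn hγ fun m y hy => ?_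
  obtain rfl : y = 0 := E.emb_injective m (by rw [hy, ht, map_zero])
  exact hU0 m

/-- The derivative of a curve composed with an sc-differentiable map. -/
theorem HasScDeriv.comp_hasFDerivAt {f : E.lvl 0 → F.lvl 0} {V : Set (E.lvl 1)} {γ₁ : P → E.lvl 1}
    {γ : P → E.lvl 0} {t : P} (hγ : ∀ᶠ s in 𝓝 t, E.incl 0 (γ₁ s) = γ s)
    {D : E.lvl 0 →L[ℝ] F.lvl 0} (hD : HasScDeriv f V (γ₁ t) D) (hV : V ∈ 𝓝 (γ₁ t))
    (hγ₁ : DifferentiableAt ℝ γ₁ t) {γ' : P →L[ℝ] E.lvl 0} (hγ' : HasFDerivAt γ γ' t) :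
    HasFDerivAt (fun s => f (γ s)) (D.comp γ') t := by
  have h1 := HasFDerivAt.comp t (hD.hasFDerivAt hV) hγ₁.hasFDerivAt
  have h2 : (E.incl 0).comp (fderiv ℝ γ₁ t) = γ' :=
    ((E.incl 0).hasFDerivAt.comp t hγ₁.hasFDerivAt).unique
      (hγ'.congr_of_eventuallyEq hγ)
  rw [ContinuousLinearMap.comp_assoc, h2] at h1
  refine h1.congr_of_eventuallyEq ?_
  filter_upwards [hγ] with s hs
  exact congrArg f hs.symm

/-- The derivative of `y ↦ φ (a y) (f (a y))` at a zero of `f ∘ a`. -/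
theorem HasScDeriv.fiber_comp {H : ScBanach.{u₄}} {U : ∀ m, Set (E.lvl m)}
    (hU : ∀ m, IsOpen (U m)) (hUn : NestedFamily U) {φ : E.lvl 0 → F.lvl 0 →ₗ[ℝ] G.lvl 0}
    (hφ : ScDiff (E := E.prod F) (F := G) 1 (fun p : E.lvl 0 × F.lvl 0 => φ p.1 p.2)
      (fun m => {p : E.lvl m × F.lvl m | p.1 ∈ U m}))
    {f : E.lvl 0 → F.lvl 0} (hf : ScDiff 1 f U) {V : ∀ m, Set (H.lvl m)}
    (hVn : NestedFamily V)
    {a : H.lvl 0 → E.lvl 0} (ha : ScDiff 1 a V) (hm : ScMapsTo a V U) {y : H.lvl 1} (hy : y ∈ V 1)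
    {x : E.lvl 1} (hxy : E.incl 0 x = a (H.incl 0 y)) (hfx : f (E.incl 0 x) = 0)
    {A : H.lvl 0 →L[ℝ] E.lvl 0} (hA : HasScDeriv a (V 1) y A) {U' : Set (E.lvl 1)} (hU' : U' ∈ 𝓝 x)
    {L : E.lvl 0 →L[ℝ] F.lvl 0} (hL : HasScDeriv f U' x L) :
    ∃ T : H.lvl 0 →L[ℝ] G.lvl 0, HasScDeriv (fun z => φ (a z) (f (a z))) (V 1) y T ∧
      ∀ ζ, T ζ = φ (E.incl 0 x) (L (A ζ)) := by
  have hxU : x ∈ U 1 := hm 1 y hy x hxy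
  have hLA := HasScDeriv.comp hf hU ha.scCont hy hxy hxU hA hU' hL
  have hfa := hf.comp ha hVn hU hm
  have hWo : ∀ m, IsOpen {p : E.lvl m × F.lvl m | p.1 ∈ U m} := fun m =>
    (hU m).preimage continuous_fst
  obtain ⟨K, hK⟩ := hφ.exists_hasScDeriv (x := ((x, 0) : E.lvl 1 × F.lvl 1)) hxU
  have hKL := HasScDeriv.apply_of_linear hU hUn hφ.scCont (ℓ := φ) (fun z _ h => rfl) hxU
    ((hWo 1).mem_nhds hxU) hK
  refine ⟨K.comp (A.prod (L.comp A)), ?_, fun ζ => hKL (A ζ) (L (A ζ))⟩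
  refine HasScDeriv.comp (E := H) (F := E.prod F) (G := G) (f := fun z => (a z, f (a z)))
    hφ hWo (ha.scCont.prodMk hfa.scCont) hy (y := ((x, 0) : E.lvl 1 × F.lvl 1)) ?_ hxU
    (A := A.prod (L.comp A)) (HasFDerivWithinAt.prodMk hA hLA) ((hWo 1).mem_nhds hxU) hK
  refine Prod.ext hxy ?_
  change F.incl 0 0 = _
  rw [map_zero, ← hxy, hfx]

end GermLemmas

/-! ### Sc-derivatives of germs and of their inverses. -/

section GermDerivatives

universe u₁ u₂

variable {E : ScBanach.{u₁}} {F : ScBanach.{u₂}}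

theorem eventually_incl_of_eventually {p : E.lvl 0 → Prop} (h : ∀ᶠ x in 𝓝 0, p x) :
    ∀ᶠ x in 𝓝 (0 : E.lvl 1), p (E.incl 0 x) := by
  have h1 : Tendsto (E.incl 0) (𝓝 0) (𝓝 0) := by
    have := (E.incl 0).continuous.tendsto 0
    rwa [map_zero] at this
  exact h1.eventually h

theorem ScGermDiff.exists_hasScDeriv {f : E.lvl 0 → F.lvl 0} (hf : ScGermDiff 1 f) :
    ∃ D, ∃ V ∈ 𝓝 0, HasScDeriv f V 0 D := by
  obtain ⟨U, hU, hU0, -, hf⟩ := hf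
  obtain ⟨D, hD⟩ := hf.exists_hasScDeriv (hU0 1)
  exact ⟨D, U 1, (hU 1).mem_nhds (hU0 1), hD⟩

theorem HasScDeriv.comp_eq_id {f : E.lvl 0 → F.lvl 0} {g : F.lvl 0 → E.lvl 0}
    (hf : ScGermDiff 1 f) (hf0 : f 0 = 0) (hg : ScGermDiff 1 g)
    (hfg : ∀ᶠ x in 𝓝 0, g (f x) = x) {V : Set (E.lvl 1)} (hV : V ∈ 𝓝 0)
    {A : E.lvl 0 →L[ℝ] F.lvl 0} (hA : HasScDeriv f V 0 A) {V' : Set (F.lvl 1)} (hV' : V' ∈ 𝓝 0)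
    {B : F.lvl 0 →L[ℝ] E.lvl 0} (hB : HasScDeriv g V' 0 B) (ξ : E.lvl 0) : B (A ξ) = ξ := by
  obtain ⟨U, hU, hU0, -, hf⟩ := hf
  obtain ⟨U', hU', hU'0, -, hg⟩ := hg
  have h1 := HasScDeriv.comp hg hU' hf.scCont (hU0 1) (y := 0) (by simp only [map_zero, hf0])
    (hU'0 1) ((hA.hasFDerivAt hV).hasFDerivWithinAt) hV' hB
  have h2 : HasScDeriv (fun z => g (f z)) univ (0 : E.lvl 1) (ContinuousLinearMap.id ℝ _) := by
    have h3 : HasFDerivAt (fun y : E.lvl 1 => E.incl 0 y) (E.incl 0) 0 := (E.incl 0).hasFDerivAt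
    exact (h3.congr_of_eventuallyEq (eventually_incl_of_eventually (p := fun x => g (f x) = x) hfg)).hasFDerivWithinAt
  exact DFunLike.congr_fun (h1.unique ((hU 1).mem_nhds (hU0 1)) h2 univ_mem) ξ

end GermDerivatives

/-! ### Filled sections in contraction form. -/

/-- A filled Fredholm section near a point, together with the change of coordinates
`(a, φ)` that brings it into contraction form. -/
structure FilledGerm (E H W : ScBanach.{u}) (n r : ℕ) where
  a : E.lvl 0 → Rn n × W.lvl 0
  a' : Rn n × W.lvl 0 → E.lvl 0
  φ : E.lvl 0 → H.lvl 0 →ₗ[ℝ] Rn r × W.lvl 0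
  φ' : Rn n × W.lvl 0 → Rn r × W.lvl 0 →ₗ[ℝ] H.lvl 0
  f : E.lvl 0 → H.lvl 0
  a_smooth : ∀ k, ScGermDiff (F := (scR n).prod W) k a
  a'_smooth : ∀ k, ScGermDiff (E := (scR n).prod W) k a'
  φ_smooth : ∀ k, ∃ U : ∀ m, Set (E.lvl m), (∀ m, IsOpen (U m)) ∧ (∀ m, (0 : E.lvl m) ∈ U m) ∧
    NestedFamily U ∧ ScDiff (E := E.prod H) (F := (scR r).prod W) k
      (fun p : E.lvl 0 × H.lvl 0 => φ p.1 p.2) (fun m => {p : E.lvl m × H.lvl m | p.1 ∈ U m})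
  f_smooth : ∀ k, ScGermDiff k f
  a_zero : a 0 = 0
  a'_zero : a' 0 = 0
  f_zero : f 0 = 0
  left_inv : ∀ᶠ x in 𝓝 0, a' (a x) = x ∧ ∀ h, φ' (a x) (φ x h) = h
  right_inv : ∀ᶠ y in 𝓝 0, a (a' y) = y ∧ ∀ k, φ (a' y) (φ' y k) = k
  contraction : IsLevelContraction (fun y : Rn n × W.lvl 0 => (φ (a' y) (f (a' y))).2)

namespace FilledGerm

variable {E H W : ScBanach.{u}} {n r : ℕ} (S : FilledGerm E H W n r)

/-- The section in the coordinates in which it is a contraction germ. -/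
def g (y : Rn n × W.lvl 0) : Rn r × W.lvl 0 := S.φ (S.a' y) (S.f (S.a' y))

theorem g_zero : S.g 0 = 0 := by rw [g, S.a'_zero, S.f_zero, map_zero]

theorem exists_families (k : ℕ) : ∃ (U : ∀ m, Set (E.lvl m))
    (V : ∀ m, Set (((scR n).prod W).lvl m)),
    (∀ m, IsOpen (U m)) ∧ NestedFamily U ∧ ScDiff k S.f U ∧
    ScDiff (E := E.prod H) (F := (scR r).prod W) k
      (fun p : E.lvl 0 × H.lvl 0 => S.φ p.1 p.2)
      (fun m => {p : E.lvl m × H.lvl m | p.1 ∈ U m}) ∧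
    (∀ m, IsOpen (V m)) ∧ (∀ m, (0 : ((scR n).prod W).lvl m) ∈ V m) ∧
    NestedFamily V ∧ ScDiff (E := (scR n).prod W) k S.a' V ∧
    ScMapsTo (E := (scR n).prod W) S.a' V U := by
  obtain ⟨U₁, h1, h10, h1n, hφ⟩ := S.φ_smooth k
  obtain ⟨U₂, h2, h20, h2n, hf⟩ := S.f_smooth k
  obtain ⟨V, h3, h30, h3n, ha⟩ := S.a'_smooth k
  have hUo : ∀ m, IsOpen (U₁ m ∩ U₂ m) := fun m => (h1 m).inter (h2 m)
  have hUn : NestedFamily (fun m => U₁ m ∩ U₂ m) := fun m x hx => ⟨h1n m hx.1, h2n m hx.2⟩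
  obtain ⟨V', hV', hV'n, hV'V, hmaps, hmem⟩ :=
    ScCont.exists_scMapsTo (E := (scR n).prod W) h3 h3n ha.scCont hUo hUn
  refine ⟨fun m => U₁ m ∩ U₂ m, V', hUo, hUn, hf.mono fun m => inter_subset_right,
    hφ.mono fun m p hp => hp.1, hV', fun m => ?_, hV'n, ha.mono hV'V, hmaps⟩
  refine hmem m 0 (h30 m) 0 ⟨h10 m, h20 m⟩ ?_
  rw [map_zero, map_zero, S.a'_zero]

theorem scDiff_g {k : ℕ} {U : ∀ m, Set (E.lvl m)} {V : ∀ m, Set (((scR n).prod W).lvl m)}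
    (hU : ∀ m, IsOpen (U m)) (hf : ScDiff k S.f U)
    (hφ : ScDiff (E := E.prod H) (F := (scR r).prod W) k
      (fun p : E.lvl 0 × H.lvl 0 => S.φ p.1 p.2)
      (fun m => {p : E.lvl m × H.lvl m | p.1 ∈ U m}))
    (hVn : NestedFamily V) (ha : ScDiff (E := (scR n).prod W) k S.a' V)
    (hm : ScMapsTo (E := (scR n).prod W) S.a' V U) :
    ScDiff (E := (scR n).prod W) (F := (scR r).prod W) k S.g V := by
  refine ScDiff.comp (F := E.prod H) (f := fun y => (S.a' y, S.f (S.a' y))) hφ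
    (ha.prodMk (hf.comp ha hVn hU hm) hVn) hVn (fun m => (hU m).preimage continuous_fst) ?_
  intro m y hy z hz
  rw [BanachScale.emb_prod] at hz
  exact hm m y hy z.1 (congrArg Prod.fst hz)

theorem scGermDiff_g (k : ℕ) : ScGermDiff (E := (scR n).prod W) (F := (scR r).prod W) k S.g := by
  obtain ⟨U, V, hU, -, hf, hφ, hV, hV0, hVn, ha, hm⟩ := S.exists_families k
  exact ⟨V, hV, hV0, hVn, S.scDiff_g hU hf hφ hVn ha hm⟩

/-- The solution germ of the contraction part. -/
theorem exists_implicit : ∃ δ : Rn n → W.lvl 0, δ 0 = 0 ∧ (∀ k, ScPlotAt k δ 0) ∧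
    ∀ᶠ y in 𝓝 (0 : Rn n × W.lvl 0), (S.g y).2 = 0 ↔ y.2 = δ y.1 := by
  have hF : ∀ k, ScGermDiff (E := (scConst (Rn n)).prod W) (F := W) k (fun y => (S.g y).2) := by
    intro k
    obtain ⟨V, h1, h2, h3, h4⟩ := S.scGermDiff_g k
    exact ⟨V, h1, h2, h3, h4.snd (F := scR r) (G := W) h3⟩
  have hF0 : (S.g 0).2 = 0 := by rw [S.g_zero]; rfl
  obtain ⟨δ, h1, h2, h3⟩ := IsLevelContraction.exists_solution (P := Rn n)
    (F := fun y => (S.g y).2) S.contraction hF0 (hF 0)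
  have hδc : ContinuousAt δ 0 := h2.contDiffAt.continuousAt
  have h4 : Tendsto (fun b => (b, δ b)) (𝓝 0) (𝓝 (0 : Rn n × W.lvl 0)) := by
    have : ContinuousAt (fun b => (b, δ b)) 0 := continuousAt_id.prodMk hδc
    rw [ContinuousAt, h1] at this
    exact this
  refine ⟨δ, h1, fun k => ?_, h3⟩
  exact IsLevelContraction.scPlotAt (P := Rn n) (F := fun y => (S.g y).2) S.contraction hF0 (hF k)
    h1 hδc (by filter_upwards [h4.eventually h3] with b hb using hb.2 rfl)

/-- The derivatives along the solution germ. -/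
theorem eventually_deriv {δ : Rn n → W.lvl 0} (hδ0 : δ 0 = 0) (hδ : ScPlotAt 1 δ 0) :
    ∀ᶠ b in 𝓝 0, ∃ (y₁ : Rn n × W.lvl 1) (x₁ : E.lvl 1) (δ' : Rn n →L[ℝ] W.lvl 0)
      (A' : Rn n × W.lvl 0 →L[ℝ] E.lvl 0) (L : E.lvl 0 →L[ℝ] H.lvl 0) (V : Set (Rn n × W.lvl 1))
      (U : Set (E.lvl 1)), (y₁.1, W.incl 0 y₁.2) = (b, δ b) ∧ V ∈ 𝓝 y₁ ∧
      HasScDeriv (E := (scR n).prod W) S.a' V y₁ A' ∧ E.incl 0 x₁ = S.a' (b, δ b) ∧ U ∈ 𝓝 x₁ ∧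
      HasScDeriv S.f U x₁ L ∧
      HasFDerivAt (fun t => S.a' (t, δ t)) (A'.comp ((ContinuousLinearMap.id ℝ _).prod δ')) b ∧
      (S.f (S.a' (b, δ b)) = 0 → ∃ T : Rn n × W.lvl 0 →L[ℝ] Rn r × W.lvl 0,
        (∀ ζ, T ζ = S.φ (S.a' (b, δ b)) (L (A' ζ))) ∧
        HasFDerivAt (fun t => S.g (t, δ t)) (T.comp ((ContinuousLinearMap.id ℝ _).prod δ')) b ∧
        (∀ w, (T (0, w)).2 = 0 → w = 0) ∧ ∀ z, ∃ w, (T (0, w)).2 = z) := by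
  obtain ⟨U, V, hU, hUn, hf, hφ, hV, hV0, hVn, ha, hm⟩ := S.exists_families 1
  have hg := S.scDiff_g hU hf hφ hVn ha hm
  have hF : ScDiff (E := (scConst (Rn n)).prod W) (F := W) 1 (fun y => (S.g y).2) V :=
    hg.snd (F := scR r) (G := W) hVn
  obtain ⟨D, hD, hDk⟩ := ScDiff.exists_deriv_family (k := 0) hF hVn
  obtain ⟨Θ, hΘ0, hΘ, N, hN, hN0, hc⟩ := S.contraction 0
  obtain ⟨δ₁, hδ₁, hδ₁'⟩ := hδ 1
  have hδ₁0 : δ₁ 0 = 0 := W.emb_injective 1 (by rw [hδ₁'.self_of_nhds, hδ0, map_zero])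
  have e1 : ∀ᶠ b in 𝓝 0, (b, δ₁ b) ∈ V 1 :=
    (continuousAt_id.prodMk hδ₁.continuousAt).eventually_mem
      ((hV 1).mem_nhds (by rw [hδ₁0]; exact hV0 1))
  have e2 : ∀ᶠ b in 𝓝 0, (b, δ b) ∈ N :=
    (continuousAt_id.prodMk hδ.contDiffAt.continuousAt).eventually_mem
      (hN.mem_nhds (by rw [hδ0]; exact hN0))
  have e3 := hδ.contDiffAt.eventually (by simp)
  have e4 := hδ₁.eventually (by simp)
  filter_upwards [e1, e2, e3, e4, hδ₁'.eventually_nhds] with b h1 h2 h3 h4 h5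
  have h5b : W.incl 0 (δ₁ b) = δ b := h5.self_of_nhds
  obtain ⟨A', hA'⟩ := ScDiff.exists_hasScDeriv ha h1
  obtain ⟨g₁, -, hg₁⟩ := ha.scCont 1
  have hx : E.incl 0 (g₁ (b, δ₁ b)) = S.a' (b, W.incl 0 (δ₁ b)) := hg₁ _ h1
  have hxU : g₁ (b, δ₁ b) ∈ U 1 := hm 1 _ h1 _ hx
  obtain ⟨L, hL⟩ := ScDiff.exists_hasScDeriv hf hxU
  have hδ' : HasFDerivAt δ (fderiv ℝ δ b) b := (h3.differentiableAt (by simp)).hasFDerivAt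
  have hγ' : HasFDerivAt (fun t => (t, δ t))
      ((ContinuousLinearMap.id ℝ (Rn n)).prod (fderiv ℝ δ b)) b := (hasFDerivAt_id b).prodMk hδ'
  have hγ₁ : DifferentiableAt ℝ (fun t => (t, δ₁ t)) b :=
    differentiableAt_id.prodMk (h4.differentiableAt (by simp))
  have hγ : ∀ᶠ t in 𝓝 b, ((scR n).prod W).incl 0 (t, δ₁ t) = (t, δ t) := by
    filter_upwards [h5] with t ht
    exact Prod.ext rfl ht
  refine ⟨(b, δ₁ b), g₁ (b, δ₁ b), fderiv ℝ δ b, A', L, V 1, U 1, by rw [h5b],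
    (hV 1).mem_nhds h1, hA', by rw [hx, h5b], (hU 1).mem_nhds hxU, hL, ?_, fun hfx => ?_⟩
  · exact HasScDeriv.comp_hasFDerivAt (E := (scR n).prod W) hγ hA' ((hV 1).mem_nhds h1) hγ₁ hγ'
  · rw [← h5b, ← hx] at hfx
    obtain ⟨T, hT, hT'⟩ := HasScDeriv.fiber_comp (G := (scR r).prod W) (H := (scR n).prod W)
      hU hUn hφ hf hVn ha hm h1 hx hfx hA' ((hU 1).mem_nhds hxU) hL
    have hT2 : HasScDeriv (E := (scR n).prod W) (F := W) (fun y => (S.g y).2) (V 1) (b, δ₁ b)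
        ((ContinuousLinearMap.snd ℝ (Rn r) (W.lvl 0)).comp T) :=
      ((ContinuousLinearMap.snd ℝ (Rn r) (W.lvl 0)).hasFDerivAt.comp_hasFDerivWithinAt _ hT)
    have hTD := hT2.unique ((hV 1).mem_nhds h1) (hD _ h1) ((hV 1).mem_nhds h1)
    -- The `W`-to-`W` block of `T` is within `Θ < 1` of the identity, hence invertible by a Neumann
    -- series.
    obtain ⟨R, hR1, hR2, -⟩ := ContinuousLinearMap.exists_inverse_of_norm_sub_le
      (M := (((ContinuousLinearMap.snd ℝ (Rn r) (W.lvl 0)).comp T).comp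
        (ContinuousLinearMap.inr ℝ (Rn n) (W.lvl 0)))) hΘ0 hΘ (fun w => by
          refine norm_sub_deriv_le (P := Rn n) (m := 0) hV hVn hF hD hDk hΘ0 hN hc (b := b)
            (w := δ₁ b) h1 (by rw [h5b]; exact h2) (w' := w) ?_
          rw [hTD]
          rfl)
    refine ⟨T, fun ζ => ?_, ?_, fun w hw => ?_, fun z => ⟨R z, hR2 z⟩⟩
    · rw [hT', hx, h5b]
    · exact HasScDeriv.comp_hasFDerivAt (E := (scR n).prod W) (F := (scR r).prod W) hγ hT
        ((hV 1).mem_nhds h1) hγ₁ hγ'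
    · have h6 := hR1 w
      have h7 : (((ContinuousLinearMap.snd ℝ (Rn r) (W.lvl 0)).comp T).comp
        (ContinuousLinearMap.inr ℝ (Rn n) (W.lvl 0))) w = 0 := hw
      rw [h7, map_zero] at h6
      exact h6.symm

end FilledGerm

/-! ### Inverse functions, submersions and openness of surjectivity. -/

section FiniteDimensionalLemmas

variable {P Q R : Type*} [NormedAddCommGroup P] [NormedSpace ℝ P]
  [NormedAddCommGroup Q] [NormedSpace ℝ Q] [NormedAddCommGroup R] [NormedSpace ℝ R]

/-- The inverse function theorem for germs that are `Cᵏ` for all finite `k`. -/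
theorem ContDiffAt.exists_local_inverse [CompleteSpace P] [CompleteSpace Q] {f : P → Q}
    {p : P} (hf : ∀ k : ℕ, ContDiffAt ℝ k f p)
    {f' : P →L[ℝ] Q} (hf' : HasFDerivAt f f' p) (hb : Function.Bijective f') :
    ∃ g : Q → P, g (f p) = p ∧ (∀ k : ℕ, ContDiffAt ℝ k g (f p)) ∧
      (∀ᶠ y in 𝓝 (f p), f (g y) = y) ∧ ∀ᶠ x in 𝓝 p, g (f x) = x := by
  let e : P ≃L[ℝ] Q := ContinuousLinearEquiv.ofBijective f'
    (LinearMap.ker_eq_bot.2 hb.1) (LinearMap.range_eq_top.2 hb.2)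
  have he : HasFDerivAt f (e : P →L[ℝ] Q) p := by
    have : (e : P →L[ℝ] Q) = f' := ContinuousLinearMap.ext fun x => rfl
    rwa [this]
  let Φ := (hf 1).toOpenPartialHomeomorph f he (by simp)
  have hp : p ∈ Φ.source := (hf 1).mem_toOpenPartialHomeomorph_source he (by simp)
  have hfp : f p ∈ Φ.target := (hf 1).image_mem_toOpenPartialHomeomorph_target he (by simp)
  have hΦ : Φ.symm (f p) = p := Φ.left_inv hp
  refine ⟨Φ.symm, hΦ, fun k => ?_, ?_, ?_⟩
  · exact Φ.contDiffAt_symm hfp (f₀' := e) (by rw [hΦ]; exact he) (by rw [hΦ]; exact hf k)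
  · exact Φ.eventually_right_inverse hfp
  · exact Φ.eventually_left_inverse hp

/-- Parametrization of the zero set of a submersion germ. -/
theorem ContDiffAt.exists_zero_parametrization [CompleteSpace P] [CompleteSpace Q]
    [CompleteSpace R] {h : P → Q} {κ : P → R}
    (hh : ∀ k : ℕ, ContDiffAt ℝ k h 0) (h0 : h 0 = 0)
    (hκ : ∀ k : ℕ, ContDiffAt ℝ k κ 0) (κ0 : κ 0 = 0)
    {h' : P →L[ℝ] Q} (hh' : HasFDerivAt h h' 0) {κ' : P →L[ℝ] R} (hκ' : HasFDerivAt κ κ' 0)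
    (hb : Function.Bijective (h'.prod κ')) :
    ∃ j : R → P, j 0 = 0 ∧ (∀ k : ℕ, ContDiffAt ℝ k j 0) ∧
      (∀ᶠ t in 𝓝 0, h (j t) = 0 ∧ κ (j t) = t) ∧ ∀ᶠ b in 𝓝 0, h b = 0 → j (κ b) = b := by
  obtain ⟨g, g0, hg, hg1, hg2⟩ := ContDiffAt.exists_local_inverse (f := fun b => (h b, κ b))
    (fun k => (hh k).prodMk (hκ k)) (hh'.prodMk hκ') hb
  rw [h0, κ0] at g0 hg hg1
  have hj : Tendsto (fun t : R => ((0 : Q), t)) (𝓝 0) (𝓝 (0, 0)) :=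
    (Continuous.prodMk_right (0 : Q)).tendsto 0
  refine ⟨fun t => g (0, t), g0, fun k => ?_, ?_, ?_⟩
  · exact ContDiffAt.comp (0 : R) (hg k) (contDiffAt_const.prodMk contDiffAt_id)
  · filter_upwards [hj.eventually hg1] with t ht
    exact ⟨congrArg Prod.fst ht, congrArg Prod.snd ht⟩
  · filter_upwards [hg2] with b hb hb0
    rw [← hb0]; exact hb

/-- If `G` is a right inverse of `D`, which is continuous because `Q` is finite-dimensional, then
`D' ∘ G` is near the identity, so it is invertible. -/
theorem ContinuousLinearMap.eventually_surjective [FiniteDimensional ℝ Q] {D : P →L[ℝ] Q}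
    (hD : Function.Surjective D) : ∀ᶠ D' : P →L[ℝ] Q in 𝓝 D, Function.Surjective D' := by
  obtain ⟨g, hg⟩ := D.toLinearMap.exists_rightInverse_of_surjective (LinearMap.range_eq_top.2 hD)
  let G : Q →L[ℝ] P := LinearMap.toContinuousLinearMap g
  have hDG : D.comp G = 1 := ContinuousLinearMap.ext fun x => LinearMap.congr_fun hg x
  have h1 : Continuous fun D' : P →L[ℝ] Q => D'.comp G := by fun_prop
  have h2 : ∀ᶠ A : Q →L[ℝ] Q in 𝓝 (D.comp G), IsUnit A := by
    rw [hDG]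
    exact Units.isOpen.mem_nhds isUnit_one
  filter_upwards [h1.continuousAt.eventually h2] with D' hD' y
  obtain ⟨A, hA⟩ := hD'
  refine ⟨G ((↑A⁻¹ : Q →L[ℝ] Q) y), ?_⟩
  have : (D'.comp G).comp (↑A⁻¹ : Q →L[ℝ] Q) = 1 := by
    rw [← hA]; exact A.mul_inv
  exact DFunLike.congr_fun this y

/-- A linear coordinate system on the kernel of a surjection. -/
theorem ContinuousLinearMap.exists_complement [FiniteDimensional ℝ P] (D : P →L[ℝ] Q)
    (hD : Function.Surjective D) {N : ℕ}
    (hN : Module.finrank ℝ (LinearMap.ker D.toLinearMap) = N) :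
    ∃ κ : P →L[ℝ] Rn N, Function.Bijective (D.prod κ) := by
  let K := LinearMap.ker D.toLinearMap
  obtain ⟨p, hp⟩ := K.subtype.exists_leftInverse_of_injective K.ker_subtype
  let e : K ≃ₗ[ℝ] Rn N := LinearEquiv.ofFinrankEq _ _ (by rw [hN]; simp)
  have hpe : ∀ x : K, e (p x) = e x := fun x => congrArg e (LinearMap.congr_fun hp x)
  refine ⟨LinearMap.toContinuousLinearMap (e.toLinearMap ∘ₗ p), ?_, ?_⟩
  · rw [injective_iff_map_eq_zero]
    intro b hb
    have h1 : D b = 0 := congrArg Prod.fst hb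
    have h2 : e (p b) = 0 := congrArg Prod.snd hb
    rw [hpe ⟨b, h1⟩] at h2
    have := e.map_eq_zero_iff.1 h2
    exact congrArg Subtype.val this
  · rintro ⟨z, t⟩
    obtain ⟨b, rfl⟩ := hD z
    have hk : D (e.symm (t - e (p b)) : P) = 0 := (e.symm (t - e (p b))).2
    refine ⟨b + (e.symm (t - e (p b)) : P), Prod.ext ?_ ?_⟩
    · change D _ = D b
      rw [map_add, hk, add_zero]
    · change e (p _) = t
      rw [map_add, map_add, hpe, e.apply_symm_apply, add_sub_cancel]

end FiniteDimensionalLemmas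

/-! ### Linear Lyapunov–Schmidt reduction. -/

section GraphLemmas

variable {B W R : Type*} [AddCommGroup B] [Module ℝ B] [AddCommGroup W] [Module ℝ W]
  [AddCommGroup R] [Module ℝ R] {T : B × W →ₗ[ℝ] R × W} {δ' : B →ₗ[ℝ] W}

theorem LinearMap.eq_zero_iff_of_graph (hM : ∀ w, (T (0, w)).2 = 0 → w = 0)
    (hT : ∀ β, (T (β, δ' β)).2 = 0) (ζ : B × W) :
    (T ζ).2 = 0 ↔ ζ.2 = δ' ζ.1 := by
  refine ⟨fun h => ?_, fun h => ?_⟩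
  · have h1 : ζ = (ζ.1, δ' ζ.1) + (0, ζ.2 - δ' ζ.1) := by ext <;> simp
    rw [h1, map_add, Prod.snd_add, hT, zero_add] at h
    exact sub_eq_zero.1 (hM _ h)
  · have h1 : ζ = (ζ.1, δ' ζ.1) := Prod.ext rfl h
    rw [h1, hT]

/-- The `W`-component can be corrected by a vector `(0, w)`, using the invertible block. What
remains is to hit vectors `(z, 0)`, whose preimages lie on the graph of `δ'`. -/
theorem LinearMap.surjective_iff_of_graph (hM : ∀ w, (T (0, w)).2 = 0 → w = 0)
    (hM' : ∀ z, ∃ w, (T (0, w)).2 = z) (hT : ∀ β, (T (β, δ' β)).2 = 0) :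
    Function.Surjective T ↔ Function.Surjective fun β => (T (β, δ' β)).1 := by
  refine ⟨fun h z => ?_, fun h => ?_⟩
  · obtain ⟨ζ, hζ⟩ := h (z, 0)
    have h1 := (LinearMap.eq_zero_iff_of_graph hM hT ζ).1 (by rw [hζ])
    refine ⟨ζ.1, ?_⟩
    beta_reduce
    rw [← h1, hζ]
  · rintro ⟨z, y⟩
    obtain ⟨w, rfl⟩ := hM' y
    obtain ⟨β, hβ⟩ := h (z - (T (0, w)).1)
    refine ⟨(β, δ' β) + (0, w), ?_⟩
    rw [map_add]
    refine Prod.ext ?_ ?_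
    · rw [Prod.fst_add]
      exact (congrArg (· + (T (0, w)).1) hβ).trans (sub_add_cancel _ _)
    · rw [Prod.snd_add, hT, zero_add]

end GraphLemmas

/-! ### Parametrization of the zeros of a filled section. -/

namespace FilledGerm

variable {E H W : ScBanach.{u}} {n r : ℕ} (S : FilledGerm E H W n r)

/-- The solution set of a filled Fredholm section near a point at which the linearization is
onto. -/
theorem exists_solution {L : E.lvl 0 →L[ℝ] H.lvl 0} {V : Set (E.lvl 1)} (hV : V ∈ 𝓝 0)
    (hL : HasScDeriv S.f V 0 L) (hsurj : Function.Surjective L) :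
    FiniteDimensional ℝ (LinearMap.ker L.toLinearMap) ∧
    ∃ (ℓ : E.lvl 0 →L[ℝ] Rn (Module.finrank ℝ (LinearMap.ker L.toLinearMap)))
      (Γ : Rn (Module.finrank ℝ (LinearMap.ker L.toLinearMap)) → E.lvl 0),
      Γ 0 = 0 ∧ (∀ k, ScPlotAt k Γ 0) ∧ (∀ᶠ t in 𝓝 0, S.f (Γ t) = 0 ∧ ℓ (Γ t) = t) ∧
      (∀ᶠ x in 𝓝 0, S.f x = 0 → Γ (ℓ x) = x) ∧
      ∀ᶠ t in 𝓝 0, ∃ x₁, E.incl 0 x₁ = Γ t ∧ ∃ U ∈ 𝓝 x₁, ∃ D, HasScDeriv S.f U x₁ D ∧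
        Function.Surjective D := by
  obtain ⟨δ, hδ0, hδ, hδg⟩ := S.exists_implicit
  have hpair : ∀ k, ScPlotAt (W := (scR n).prod W) k (fun b => (b, δ b)) 0 := fun k =>
    ScPlotAt.prodMk (E := scR n) (F := W) (scPlotAt_scConst (P := Rn n) contDiffAt_id) (hδ k)
  have hpair0 : ((0 : Rn n), δ 0) = (0 : Rn n × W.lvl 0) := by rw [hδ0]; rfl
  have hΓ₀ : ∀ k, ScPlotAt k (fun b => S.a' (b, δ b)) 0 := fun k =>
    (S.a'_smooth k).comp_scPlotAt (hpair k) hpair0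
  have hg : ∀ k : ℕ, ContDiffAt ℝ k (fun b => S.g (b, δ b)) 0 := fun k =>
    ((S.scGermDiff_g k).comp_scPlotAt (hpair k) hpair0).contDiffAt
  have tpair : Tendsto (fun b => (b, δ b)) (𝓝 0) (𝓝 (0 : Rn n × W.lvl 0)) := by
    have := (hpair 0).contDiffAt.continuousAt
    rwa [ContinuousAt, hpair0] at this
  have tΓ₀ : Tendsto (fun b => S.a' (b, δ b)) (𝓝 0) (𝓝 0) := by
    have := (hΓ₀ 0).contDiffAt.continuousAt
    rwa [ContinuousAt, hpair0, S.a'_zero] at this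
  have hg2 : ∀ᶠ b in 𝓝 0, (S.g (b, δ b)).2 = 0 := by
    filter_upwards [tpair.eventually hδg] with b hb using hb.2 rfl
  have hf : ∀ᶠ b in 𝓝 0, (S.g (b, δ b)).1 = 0 → S.f (S.a' (b, δ b)) = 0 := by
    filter_upwards [hg2, tΓ₀.eventually S.left_inv] with b h1 h2 h3
    have h4 : S.φ (S.a' (b, δ b)) (S.f (S.a' (b, δ b))) = 0 := Prod.ext h3 h1
    rw [← h2.2 (S.f _), h4, map_zero]
  have hder := S.eventually_deriv hδ0 (hδ 1)
  -- the derivative of the second component along the graph vanishes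
  have hgraph : ∀ᶠ b in 𝓝 0, ∀ (T : Rn n × W.lvl 0 →L[ℝ] Rn r × W.lvl 0) (δ' : Rn n →L[ℝ] W.lvl 0),
      HasFDerivAt (fun t => S.g (t, δ t)) (T.comp ((ContinuousLinearMap.id ℝ _).prod δ')) b →
      ∀ β, (T (β, δ' β)).2 = 0 := by
    filter_upwards [hg2.eventually_nhds] with b hb T δ' hT β
    have h1 : HasFDerivAt (fun t => (S.g (t, δ t)).2)
        (0 : Rn n →L[ℝ] W.lvl 0) b :=
      (hasFDerivAt_const (0 : W.lvl 0) b).congr_of_eventuallyEq hb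
    exact DFunLike.congr_fun (hT.snd.unique h1) β
  obtain ⟨y₁, x₁, δ', A', L', V', U', hy₁, hV', hA', hx₁, hU', hL', hΓd, hT⟩ := hder.self_of_nhds
  have hy₁0 : y₁ = 0 := by
    refine ((scR n).prod W).incl_injective 0 ?_
    rw [map_zero, ← hpair0, ← hy₁]
    rfl
  have hx₁0 : x₁ = 0 := by
    refine E.incl_injective 0 ?_
    rw [map_zero, hx₁, hpair0, S.a'_zero]
  subst hy₁0 hx₁0
  obtain rfl : L' = L := hL'.unique hU' hL hV
  obtain ⟨A, V'', hV'', hA⟩ := (S.a_smooth 1).exists_hasScDeriv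
  have hA'A : ∀ ξ, A' (A ξ) = ξ := HasScDeriv.comp_eq_id (F := (scR n).prod W) (S.a_smooth 1)
    S.a_zero (S.a'_smooth 1) (S.left_inv.mono fun x hx => hx.1) hV'' hA hV' hA'
  have hAA' : ∀ ζ, A (A' ζ) = ζ := HasScDeriv.comp_eq_id (E := (scR n).prod W) (S.a'_smooth 1)
    S.a'_zero (S.a_smooth 1) (S.right_inv.mono fun x hx => hx.1) hV' hA' hV'' hA
  rw [hpair0, S.a'_zero] at hT
  obtain ⟨T, hTL, hTd, hM, hM'⟩ := hT S.f_zero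
  have hTg := hgraph.self_of_nhds T δ' hTd
  have hφinj : ∀ η, S.φ 0 η = 0 → η = 0 := fun η hη => by
    rw [← S.left_inv.self_of_nhds.2 η, hη, map_zero]
  have hφsurj : ∀ k, S.φ 0 (S.φ' 0 k) = k := fun k => by
    have := S.right_inv.self_of_nhds.2 k
    rwa [S.a'_zero] at this
  have hTsurj : Function.Surjective T := fun k => by
    obtain ⟨ξ, hξ⟩ := hsurj (S.φ' 0 k)
    exact ⟨A ξ, by rw [hTL, hA'A, hξ, hφsurj]⟩
  -- The derivative at `0` of the reduced map `b ↦ (S.g (b, δ b)).1`.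
  let D : Rn n →L[ℝ] Rn r := (ContinuousLinearMap.fst ℝ _ _).comp
    (T.comp ((ContinuousLinearMap.id ℝ _).prod δ'))
  have hDsurj : Function.Surjective D :=
    (LinearMap.surjective_iff_of_graph (T := T.toLinearMap) (δ' := δ'.toLinearMap) hM hM' hTg).1
      hTsurj
  have hTzero := LinearMap.eq_zero_iff_of_graph (T := T.toLinearMap) (δ' := δ'.toLinearMap) hM hTg
  have hkerD : ∀ β, D β = 0 → L' (A' (β, δ' β)) = 0 := fun β hβ => by
    refine hφinj _ ?_
    rw [← hTL]
    exact Prod.ext hβ (hTg β)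
  have hkerL : ∀ ξ, L' ξ = 0 → (A ξ).2 = δ' (A ξ).1 ∧ D (A ξ).1 = 0 := fun ξ hξ => by
    have h1 : T (A ξ) = 0 := by rw [hTL, hA'A, hξ, map_zero]
    have h2 : (A ξ).2 = δ' (A ξ).1 := (hTzero _).1 (congrArg Prod.snd h1)
    refine ⟨h2, ?_⟩
    change (T ((A ξ).1, δ' (A ξ).1)).1 = 0
    rw [← h2]
    exact congrArg Prod.fst h1
  -- `A` carries the kernel of `L'` to the part of the graph of `δ'` over `ker D`. This yields
  -- finite dimensionality and the dimension of the solution set.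
  let e : LinearMap.ker L'.toLinearMap ≃ₗ[ℝ] LinearMap.ker D.toLinearMap :=
    { toFun := fun ξ => ⟨(A ξ).1, (hkerL ξ ξ.2).2⟩
      map_add' := fun ξ ζ => Subtype.ext (by simp)
      map_smul' := fun t ξ => Subtype.ext (by simp)
      invFun := fun β => ⟨A' (β, δ' β), hkerD β β.2⟩
      left_inv := fun ξ => Subtype.ext (by
        change A' ((A ξ).1, δ' (A ξ).1) = ξ
        rw [← (hkerL ξ ξ.2).1]
        exact hA'A ξ)
      right_inv := fun β => Subtype.ext (by
        change (A (A' (β, δ' β))).1 = β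
        rw [hAA']) }
  refine ⟨Module.Finite.equiv e.symm, ?_⟩
  obtain ⟨κ', hκ'⟩ := D.exists_complement hDsurj e.finrank_eq.symm
  -- `κ'` completes `D` to a bijection. Using the derivative `A` in place of `a` keeps `ℓ` linear,
  -- and since `A` inverts `A'` its derivative along `b ↦ a' (b, δ b)` at `0` is still `κ'`.
  let ℓ : E.lvl 0 →L[ℝ] Rn (Module.finrank ℝ (LinearMap.ker L'.toLinearMap)) :=
    (κ'.comp (ContinuousLinearMap.fst ℝ _ _)).comp A
  have hh' : HasFDerivAt (fun b => (S.g (b, δ b)).1) D 0 := hTd.fst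
  have hℓΓ : HasFDerivAt (fun b => ℓ (S.a' (b, δ b))) κ' 0 := by
    have h1 := ℓ.hasFDerivAt.comp (0 : Rn n) hΓd
    have h2 : ℓ.comp (A'.comp ((ContinuousLinearMap.id ℝ _).prod δ')) = κ' :=
      ContinuousLinearMap.ext fun β => congrArg (fun z : Rn n × W.lvl 0 => κ' z.1) (hAA' (β, δ' β))
    rwa [h2] at h1
  obtain ⟨j, j0, hj, hj1, hj2⟩ := ContDiffAt.exists_zero_parametrization
    (h := fun b => (S.g (b, δ b)).1) (κ := fun b => ℓ (S.a' (b, δ b)))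
    (fun k => (hg k).fst) (by rw [hpair0, S.g_zero]; rfl)
    (fun k => ℓ.contDiff.contDiffAt.comp 0 (hΓ₀ k).contDiffAt)
    (by beta_reduce; rw [hpair0, S.a'_zero, map_zero]) hh' hℓΓ hκ'
  have tj : Tendsto j (𝓝 0) (𝓝 0) := by
    have := (hj 0).continuousAt
    rwa [ContinuousAt, j0] at this
  -- `j` parametrizes the zeros of the reduced map by the values of `ℓ`; the graph of `δ` and then
  -- `a'` carry them back to `E`.
  refine ⟨ℓ, fun t => S.a' (j t, δ (j t)), ?_, fun k => ?_, ?_, ?_, ?_⟩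
  · beta_reduce; rw [j0, hpair0, S.a'_zero]
  · refine ScPlotAt.comp_contDiffAt (δ := fun b => S.a' (b, δ b)) ?_ (hj k)
    rw [j0]
    exact hΓ₀ k
  · filter_upwards [hj1, tj.eventually hf] with t h1 h2
    exact ⟨h2 h1.1, h1.2⟩
  · have ta : Tendsto S.a (𝓝 0) (𝓝 0) := by
      obtain ⟨U, hU, hU0, -, ha⟩ := S.a_smooth 0
      have := (ScCont.continuousOn_zero (F := (scR n).prod W) ha.scCont).continuousAt
        ((hU 0).mem_nhds (hU0 0))
      rwa [ContinuousAt, S.a_zero] at this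
    have ta1 : Tendsto (fun x => (S.a x).1) (𝓝 0) (𝓝 0) := (continuous_fst.tendsto _).comp ta
    filter_upwards [S.left_inv, ta.eventually hδg, ta1.eventually hj2] with x h1 h2 h3 hx
    have h4 : S.g (S.a x) = 0 := by rw [g, h1.1, hx, map_zero]
    have h5 : ((S.a x).1, δ (S.a x).1) = S.a x := Prod.ext rfl (h2.1 (by rw [h4]; rfl)).symm
    have h6 := h3 (by rw [h5, h4]; rfl)
    rw [h5, h1.1] at h6
    beta_reduce
    rw [h6, h5, h1.1]
  -- The derivatives of `S.f` need not vary continuously in norm, so openness of surjectivity is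
  -- used for the reduced finite-dimensional map and transferred back by
  -- `LinearMap.surjective_iff_of_graph`.
  · have e1 : ∀ᶠ b in 𝓝 0, Function.Surjective (fderiv ℝ (fun b => (S.g (b, δ b)).1) b) := by
      have h1 : ContinuousAt (fderiv ℝ (fun b => (S.g (b, δ b)).1)) 0 :=
        ((hg 1).fst.fderiv_right (m := 0) (by simp)).continuousAt
      rw [ContinuousAt, hh'.fderiv] at h1
      exact h1.eventually (ContinuousLinearMap.eventually_surjective hDsurj)
    filter_upwards [tj.eventually e1, tj.eventually hder, tj.eventually hgraph, tj.eventually hf,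
      hj1, tj.eventually (tΓ₀.eventually S.left_inv)] with t h1 h2 h3 h4 h5 h6
    obtain ⟨y, x, δt, At, Lt, Vt, Ut, hy, hVt, hAt, hx, hUt, hLt, -, hTt⟩ := h2
    obtain ⟨Tt, hTtL, hTtd, hMt, hMt'⟩ := hTt (h4 h5.1)
    refine ⟨x, hx, Ut, hUt, Lt, hLt, fun η => ?_⟩
    rw [hTtd.fst.fderiv] at h1
    have h7 := (LinearMap.surjective_iff_of_graph (T := Tt.toLinearMap) (δ' := δt.toLinearMap)
      hMt hMt' (h3 Tt δt hTtd)).2 h1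
    obtain ⟨ζ, hζ⟩ := h7 (S.φ (S.a' (j t, δ (j t))) η)
    refine ⟨At ζ, ?_⟩
    have h8 : S.φ (S.a' (j t, δ (j t))) (Lt (At ζ)) = S.φ (S.a' (j t, δ (j t))) η :=
      (hTtL ζ).symm.trans hζ
    rw [← h6.2 (Lt (At ζ)), h8, h6.2]

end FilledGerm

/-! ### Base and fibre parts of strong bundle germs. -/

section BundleGerms

variable {E E' H H' : ScBanach.{u}}

theorem isScOperator_inl : IsScOperator (E := E) (F := E.prod H)
    (ContinuousLinearMap.inl ℝ (E.lvl 0) (H.lvl 0)) := fun m =>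
  ⟨ContinuousLinearMap.inl ℝ (E.lvl m) (H.lvl m), fun x => by
    rw [BanachScale.emb_prod]; exact Prod.ext rfl (map_zero _)⟩

variable {C : Set (E.lvl 0)} {a : E.lvl 0 → E'.lvl 0} {l : E.lvl 0 → H.lvl 0 → H'.lvl 0}

theorem IsScTriSmoothGerm.exists_isOpen (hC : C ∈ 𝓝 0) (h : IsScTriSmoothGerm a l C) (k : ℕ) :
    ∃ U : ∀ m, Set (E.lvl m), (∀ m, IsOpen (U m)) ∧ (∀ m, (0 : E.lvl m) ∈ U m) ∧
      NestedFamily U ∧ ScDiff (E := E.prod H) (F := E'.prod H') k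
        (fun p : E.lvl 0 × H.lvl 0 => (a p.1, l p.1 p.2))
        (fun m => {p : E.lvl m × H.lvl m | p.1 ∈ U m}) := by
  obtain ⟨U, hU, h1, -⟩ := h k
  obtain ⟨U', h2, h3, h4, h5⟩ := hU.exists_isOpen hC
  exact ⟨U', h2, h3, h4, h1.mono fun m p hp => h5 m hp⟩

theorem IsScTriSmoothGerm.scGermDiff_base (hC : C ∈ 𝓝 0) (h : IsScTriSmoothGerm a l C) (k : ℕ) :
    ScGermDiff k a := by
  obtain ⟨U, h1, h2, h3, h4⟩ := h.exists_isOpen hC k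
  refine ⟨U, h1, h2, h3, ?_⟩
  have h5 := h4.comp (E := E) (F := E.prod H) (ScDiff.of_isScOperator isScOperator_inl U) h3
    (fun m => (h1 m).preimage continuous_fst) (fun m x hx y hy => by
      have : y = (x, 0) := (E.prod H).emb_injective m (by
        rw [hy, BanachScale.emb_prod]
        exact Prod.ext rfl (map_zero _).symm)
      rw [this]
      exact hx)
  exact h5.fst (F := E') (G := H') h3

theorem IsScTriSmoothGerm.exists_fiber (hC : C ∈ 𝓝 0) (h : IsScTriSmoothGerm a l C) (k : ℕ) :
    ∃ U : ∀ m, Set (E.lvl m), (∀ m, IsOpen (U m)) ∧ (∀ m, (0 : E.lvl m) ∈ U m) ∧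
      NestedFamily U ∧ ScDiff (E := E.prod H) (F := H') k
        (fun p : E.lvl 0 × H.lvl 0 => l p.1 p.2) (fun m => {p : E.lvl m × H.lvl m | p.1 ∈ U m}) := by
  obtain ⟨U, h1, h2, h3, h4⟩ := h.exists_isOpen hC k
  exact ⟨U, h1, h2, h3, h4.snd (F := E') (G := H') fun m p hp => h3 m hp⟩

/-- On a domain that need not be open, the base map is still differentiable at `0`. -/
theorem IsScTriSmoothGerm.exists_hasScDeriv_base (h : IsScTriSmoothGerm a l C) (h0 : (0 : E.lvl 0) ∈ C) :
    ∃ U, IsGermDomain C U ∧ (∀ m, (0 : E.lvl m) ∈ U m) ∧ ScCont a U ∧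
      ∃ D, HasScDeriv a (U 1) 0 D := by
  obtain ⟨U, hU, h1, -⟩ := h 1
  have hU0 : ∀ m, (0 : E.lvl m) ∈ U m := fun m => by
    obtain ⟨O, -, h2, h3⟩ := (hU m).1
    rw [h3]
    exact ⟨h2, mem_levels.2 (by rwa [map_zero])⟩
  refine ⟨U, hU, hU0, fun m => ?_, ?_⟩
  · obtain ⟨g, hg, hg'⟩ := h1.scCont m
    refine ⟨fun x => (g (x, 0)).1, ?_, fun x hx => ?_⟩
    · exact continuous_fst.comp_continuousOn
        (hg.comp (Continuous.prodMk_left (0 : H.lvl m)).continuousOn fun x hx => hx)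
    · have h2 := hg' (x, 0) hx
      rw [BanachScale.emb_prod, BanachScale.emb_prod] at h2
      exact congrArg Prod.fst h2
  · obtain ⟨D, hD⟩ := ScDiff.exists_hasScDeriv (x := ((0, 0) : E.lvl 1 × H.lvl 1)) h1 (hU0 1)
    refine ⟨(ContinuousLinearMap.fst ℝ _ _).comp (D.comp (ContinuousLinearMap.inl ℝ _ _)), ?_⟩
    have h2 : HasFDerivWithinAt (fun x : E.lvl 1 => ((x, 0) : E.lvl 1 × H.lvl 1))
        (ContinuousLinearMap.inl ℝ _ _) (U 1) 0 :=
      (ContinuousLinearMap.inl ℝ (E.lvl 1) (H.lvl 1)).hasFDerivWithinAt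
    have h3 := HasFDerivWithinAt.comp (g := fun y : E.lvl 1 × H.lvl 1 =>
      (a (E.incl 0 y.1), l (E.incl 0 y.1) (H.incl 0 y.2))) (t := {p | p.1 ∈ U 1})
      (g' := D.comp ((E.prod H).incl 0)) (f := fun x : E.lvl 1 => ((x, 0) : E.lvl 1 × H.lvl 1))
      (0 : E.lvl 1) hD h2 fun x hx => hx
    have h4 := ((ContinuousLinearMap.fst ℝ (E'.lvl 0) (H'.lvl 0)).hasFDerivAt).comp_hasFDerivWithinAt
      _ h3
    refine HasFDerivWithinAt.congr_fderiv h4 ?_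
    ext x
    change (D (E.incl 0 x, H.incl 0 0)).1 = (D (E.incl 0 x, 0)).1
    rw [map_zero]

end BundleGerms

/-! ### Absence of corners in the contraction coordinates. -/

section ConeGerms

variable {E H H' W : ScBanach.{u}} {C : Set (E.lvl 0)}

/-- A strong bundle isomorphism from an open domain has an open range: the target cannot have
boundary or corners at `0`. -/
theorem StrongBundleIsoGerm.cone_mem_nhds (hC : C ∈ 𝓝 0) {Q : ConeDomain} (hQ : 0 ∈ Q.V)
    (Ψ : StrongBundleIsoGerm E ((scR Q.n).prod W) H H' C {p : Rn Q.n × W.lvl 0 | p.1 ∈ Q.V}) :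
    Q.V ∈ 𝓝 0 := by
  obtain ⟨O, hO, hV⟩ := Q.isOpen
  have hO0 : (0 : Rn Q.n) ∈ O := (hV ▸ hQ : (0 : Rn Q.n) ∈ O ∩ _).1
  by_cases hk : ∃ i : Fin Q.n, (i : ℕ) < Q.k
  swap
  · rw [hV]
    refine inter_mem (hO.mem_nhds hO0) (univ_mem' fun x i hi => absurd ⟨i, hi⟩ hk)
  exfalso
  obtain ⟨i, hi⟩ := hk
  let pr : Rn Q.n × W.lvl 0 →L[ℝ] ℝ :=
    (EuclideanSpace.proj i).comp (ContinuousLinearMap.fst ℝ (Rn Q.n) (W.lvl 0))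
  have hpr : ∀ y : Rn Q.n × W.lvl 0, y.1 ∈ Q.V → 0 ≤ pr y := fun y hy => by
    rw [hV] at hy
    exact hy.2 i hi
  obtain ⟨U, hU, hU0, hUn, ha⟩ := Ψ.smooth.scGermDiff_base (E' := (scR Q.n).prod W) hC 1
  obtain ⟨A, hA⟩ := ScDiff.exists_hasScDeriv (F := (scR Q.n).prod W) ha (hU0 1)
  have hU1 := (hU 1).mem_nhds (hU0 1)
  have hleft : ∀ᶠ x in 𝓝 0, (Ψ.a x).1 ∈ Q.V := by
    have := Ψ.left_inv
    rw [nhdsWithin_eq_nhds.2 hC] at this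
    exact this.mono fun x hx => hx.1
  -- The constrained coordinate of `Ψ.a` is nonnegative near `0` and vanishes at `0`. At this
  -- minimum its derivative is zero on `E₁`, hence on `E₀` by density.
  have hA0 : ∀ ξ, pr (A ξ) = 0 := by
    have h1 : HasFDerivAt (fun x : E.lvl 1 => pr (Ψ.a (E.incl 0 x))) (pr.comp (A.comp (E.incl 0)))
        0 := pr.hasFDerivAt.comp _ (HasScDeriv.hasFDerivAt (F := (scR Q.n).prod W) hA hU1)
    have h2 : IsLocalMin (fun x : E.lvl 1 => pr (Ψ.a (E.incl 0 x))) 0 := by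
      filter_upwards [eventually_incl_of_eventually (p := fun x => (Ψ.a x).1 ∈ Q.V) hleft] with x hx
      rw [_root_.map_zero, Ψ.map_zero, _root_.map_zero]
      exact hpr _ hx
    have h3 := h2.hasFDerivAt_eq_zero h1
    have h4 : (pr.comp A : E.lvl 0 → ℝ) = fun _ => 0 :=
      (E.denseRange_incl 0).equalizer (pr.comp A).continuous continuous_const
        (funext fun x => DFunLike.congr_fun h3 x)
    exact fun ξ => congrFun h4 ξ
  obtain ⟨U', hU', hU'0, ha', A', hA'⟩ := Ψ.smooth'.exists_hasScDeriv_base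
    (E := (scR Q.n).prod W) hQ
  have hcomp := HasScDeriv.comp (E := (scR Q.n).prod W) (G := (scR Q.n).prod W) ha hU ha'
    (hU'0 1) (y := 0) (by rw [_root_.map_zero, _root_.map_zero, Ψ.map_zero']) (hU0 1) hA' hU1 hA
  -- the curve along the `i`-th coordinate
  let e : Rn Q.n := EuclideanSpace.single i 1
  let γ : ℝ → Rn Q.n × W.lvl 1 := fun t => (t • e, 0)
  have hγ : Continuous γ := by fun_prop
  have hγ0 : γ 0 = 0 := by simp [γ]
  have tγ : Tendsto γ (𝓝[>] 0) (𝓝 0) := by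
    have := hγ.tendsto 0
    rw [hγ0] at this
    exact this.mono_left nhdsWithin_le_nhds
  have hγV : ∀ᶠ t in 𝓝[>] (0 : ℝ), (γ t).1 ∈ Q.V := by
    have h1 : ∀ᶠ t in 𝓝[>] (0 : ℝ), (γ t).1 ∈ O :=
      ((continuous_fst.tendsto _).comp tγ).eventually_mem (hO.mem_nhds hO0)
    filter_upwards [h1, self_mem_nhdsWithin] with t h1 h2
    rw [hV]
    refine ⟨h1, fun j hj => ?_⟩
    have : (γ t).1 j = t * e j := rfl
    rw [this]
    refine mul_nonneg (le_of_lt h2) ?_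
    simp only [e, PiLp.single_apply]
    split_ifs <;> simp
  have hγU : Tendsto γ (𝓝[>] 0) (𝓝[U' 1] 0) := by
    refine tendsto_nhdsWithin_iff.2 ⟨tγ, ?_⟩
    obtain ⟨O', hO', h0, h1⟩ := (hU' 1).1
    filter_upwards [tγ.eventually_mem (hO'.mem_nhds h0), hγV] with t h2 h3
    rw [h1]
    exact ⟨h2, h3⟩
  have hid : ∀ᶠ t in 𝓝[>] (0 : ℝ), Ψ.a (Ψ.a' (((scR Q.n).prod W).incl 0 (γ t))) =
      ((scR Q.n).prod W).incl 0 (γ t) := by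
    have h1 : Tendsto (fun t => ((scR Q.n).prod W).incl 0 (γ t)) (𝓝[>] 0)
        (𝓝[{p : Rn Q.n × W.lvl 0 | p.1 ∈ Q.V}] 0) := by
      refine tendsto_nhdsWithin_iff.2 ⟨?_, hγV⟩
      have := ((((scR Q.n).prod W).incl 0).continuous.tendsto 0).comp tγ
      rwa [_root_.map_zero] at this
    exact (h1.eventually Ψ.right_inv).mono fun t ht => ht.2.1
  have hlit := (hasFDerivWithinAt_iff_isLittleO.1 hcomp).comp_tendsto hγU
  have h1 := (pr.isBigO_comp _ _).trans_isLittleO hlit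
  -- Along the edge `t e` with `t > 0`, the map `a ∘ a'` is the identity, although its `i`-th
  -- coordinate has derivative zero by `hA0`. Hence `t = o(t)`, which is absurd.
  have h2 : (fun t => t) =o[𝓝[>] (0 : ℝ)] fun t => t := by
    have h3 : ((fun x : Rn Q.n × W.lvl 1 => x - 0) ∘ γ) =O[𝓝[>] (0 : ℝ)] (fun t => t) := by
      refine Asymptotics.IsBigO.of_bound 1 (Eventually.of_forall fun t => ?_)
      simp [γ, e, norm_smul]
    refine (h1.trans_isBigO h3).congr' ?_ EventuallyEq.rfl
    filter_upwards [hid] with t ht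
    have h4 : pr (((scR Q.n).prod W).incl 0 (γ t)) = t := by
      change t * e i = t
      simp [e]
    simp only [Function.comp_apply]
    rw [ht, map_sub, map_sub, h4, _root_.map_zero, Ψ.map_zero', Ψ.map_zero, _root_.map_zero]
    have h5 : pr ((A.comp A').comp (((scR Q.n).prod W).incl 0) (γ t - 0)) = 0 := hA0 _
    rw [h5]; ring
  have h3 := (Asymptotics.isLittleO_irrefl' (f' := fun t : ℝ => t) (l := 𝓝[>] (0 : ℝ))
    (by
      refine Eventually.frequently ?_
      filter_upwards [self_mem_nhdsWithin] with t ht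
      exact norm_ne_zero_iff.2 (ne_of_gt ht)))
  exact h3 h2

theorem IsContractionGerm.isLevelContraction {n : ℕ} {V : Set (Rn n)} (hV : V ∈ 𝓝 0)
    {F : Rn n × W.lvl 0 → W.lvl 0} (h : IsContractionGerm V F) : IsLevelContraction F := by
  intro m
  obtain ⟨Θ, h0, h1, N, hN, B, hB, hB'⟩ := h.2.2 m
  have h2 : {p : Rn n × W.lvl m | p.1 ∈ V} ∈ 𝓝 0 := continuous_fst.continuousAt.preimage_mem_nhds hV
  refine ⟨Θ, h0.le, h1, interior (N ∩ {p : Rn n × W.lvl m | p.1 ∈ V}), isOpen_interior,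
    mem_interior_iff_mem_nhds.2 (inter_mem hN h2), fun b u u' y y' hu hu' hy hy' => ?_⟩
  have hu := interior_subset hu
  have hu' := interior_subset hu'
  have e1 : B (b, u) = u - y := W.emb_injective m (by
    rw [hB b u hu.2 hu.1, map_sub, hy])
  have e2 : B (b, u') = u' - y' := W.emb_injective m (by
    rw [hB b u' hu'.2 hu'.1, map_sub, hy'])
  rw [← e1, ← e2]
  exact hB' b u u' hu.2 hu.1 hu'.1

/-- The data of a filled Fredholm section near a point, over an open domain. -/
def FilledGerm.ofIsoGerm (hC : C ∈ 𝓝 0) {r : ℕ} {Q : ConeDomain} (hQ : 0 ∈ Q.V)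
    (Ψ : StrongBundleIsoGerm E ((scR Q.n).prod W) H ((scR r).prod W) C
      {p : Rn Q.n × W.lvl 0 | p.1 ∈ Q.V})
    {fhat : E.lvl 0 → H.lvl 0} (hf : IsScSmoothGerm fhat C) (hf0 : fhat 0 = 0)
    (hc : IsContractionGerm Q.V (W := W) (fun y =>
        ((Ψ.φ (Ψ.a' y) (fhat (Ψ.a' y)) : Rn r × W.lvl 0)).2 -
          ((Ψ.φ (Ψ.a' 0) (fhat (Ψ.a' 0)) : Rn r × W.lvl 0)).2)) : FilledGerm E H W Q.n r where
  a := Ψ.a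
  a' := Ψ.a'
  φ := Ψ.φ
  φ' := Ψ.φ'
  f := fhat
  a_smooth := Ψ.smooth.scGermDiff_base (E' := (scR Q.n).prod W) hC
  a'_smooth := Ψ.smooth'.scGermDiff_base (E := (scR Q.n).prod W)
    (continuous_fst.continuousAt.preimage_mem_nhds (Ψ.cone_mem_nhds hC hQ))
  φ_smooth := Ψ.smooth.exists_fiber (H' := (scR r).prod W) hC
  f_smooth := hf.scGermDiff hC
  a_zero := Ψ.map_zero
  a'_zero := Ψ.map_zero'
  f_zero := hf0
  left_inv := by
    have := Ψ.left_inv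
    rw [nhdsWithin_eq_nhds.2 hC] at this
    exact this.mono fun x hx => hx.2
  right_inv := by
    have := Ψ.right_inv
    have h1 : {p : Rn Q.n × W.lvl 0 | p.1 ∈ Q.V} ∈ 𝓝 0 :=
      continuous_fst.continuousAt.preimage_mem_nhds (Ψ.cone_mem_nhds hC hQ)
    rw [nhdsWithin_eq_nhds.2 h1] at this
    exact this.mono fun x hx => hx.2
  contraction := by
    have h0 : ((Ψ.φ (Ψ.a' 0) (fhat (Ψ.a' 0)) : Rn r × W.lvl 0)).2 = 0 := by
      rw [Ψ.map_zero', hf0, map_zero]; rfl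
    simp only [h0, sub_zero] at hc
    exact hc.isLevelContraction (Ψ.cone_mem_nhds hC hQ)

end ConeGerms

/-! ### Comparison of a section with its filled version. -/

section Filling

variable {X : Type v} [TopologicalSpace X] {Y : X → Type w}
    [∀ x, AddCommGroup (Y x)] [∀ x, Module ℝ (Y x)] [TopologicalSpace (Tot Y)]
    {P : MPolyfold.{u} X} {b : StrongBundle P Y} {f : ∀ x, Y x}

theorem ConeDomain.mem_nhds_of_full {D : ConeDomain} (S : Splicing.{u} D)
    {p : Rn D.n × S.E.lvl 0} (h : S.full ∈ 𝓝 p) : D.V ∈ 𝓝 p.1 := by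
  have h1 : ContinuousAt (fun v : Rn D.n => (v, p.2)) p.1 := by fun_prop
  exact h1.preimage_mem_nhds h

/-- The derivative of the retraction onto the splicing core at a point `(v, 0)`. -/
theorem Splicing.deriv_retr_zero {D : ConeDomain} (S : Splicing.{u} D) (hS : S.full ∈ 𝓝 0)
    {V : Set (S.amb.lvl 1)} (hV : V ∈ 𝓝 0)
    {ρ : S.amb.lvl 0 →L[ℝ] S.amb.lvl 0}
    (hρ : HasScDeriv (E := S.amb) (F := S.amb) S.retr V 0 ρ) (ξ : S.amb.lvl 0) :
    ρ ξ = (ξ.1, S.proj 0 ξ.2) := by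
  have h0 : D.V ∈ 𝓝 (0 : Rn D.n) := ConeDomain.mem_nhds_of_full S hS
  refine Prod.ext ?_ ?_
  · have h1 : HasScDeriv (E := S.amb) (F := scR D.n) (fun p => (S.retr p).1) V 0
        ((ContinuousLinearMap.fst ℝ _ _).comp ρ) :=
      (ContinuousLinearMap.fst ℝ (Rn D.n) (S.E.lvl 0)).hasFDerivAt.comp_hasFDerivWithinAt _ hρ
    have h2 : HasScDeriv (E := S.amb) (F := scR D.n) (fun p => (S.retr p).1) V 0
        (ContinuousLinearMap.fst ℝ _ _) := by
      have : HasFDerivWithinAt (fun y : S.amb.lvl 1 => (S.amb.incl 0 y).1)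
          ((ContinuousLinearMap.fst ℝ (Rn D.n) (S.E.lvl 0)).comp (S.amb.incl 0)) V 0 :=
        ((ContinuousLinearMap.fst ℝ (Rn D.n) (S.E.lvl 0)).comp (S.amb.incl 0)).hasFDerivWithinAt
      exact this
    exact DFunLike.congr_fun (h1.unique hV h2 hV) ξ
  · have h1 : HasScDeriv (E := (scR D.n).prod S.E) (F := S.E)
        (fun p : Rn D.n × S.E.lvl 0 => S.proj p.1 p.2) V 0
        ((ContinuousLinearMap.snd ℝ _ _).comp ρ) :=
      (ContinuousLinearMap.snd ℝ (Rn D.n) (S.E.lvl 0)).hasFDerivAt.comp_hasFDerivWithinAt _ hρ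
    -- The projection is linear in `e`, so at `e = 0` its dependence on `v` does not enter the
    -- derivative.
    have h2 := HasScDeriv.apply_of_linear (E := scR D.n) (F := S.E) (G := S.E)
      (g := fun p : Rn D.n × S.E.lvl 0 => S.proj p.1 p.2) (U := fun _ => interior D.V)
      (fun _ => isOpen_interior) (fun _ _ hx => hx)
      ((S.smooth 0).scCont.mono fun m p (hp : p.1 ∈ interior D.V) => by
        refine mem_levels.2 ?_
        rw [BanachScale.emb_prod]
        change (scaleR D.n).emb m p.1 ∈ D.V
        rw [scaleR_emb]
        exact interior_subset hp)
      (ℓ := fun v => (S.proj v).toLinearMap) (fun _ _ _ => rfl)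
      (x := (0 : Rn D.n)) (mem_interior_iff_mem_nhds.2 h0) hV h1 ξ.1 ξ.2
    exact h2

variable {c : BundleChart.{u} Y} {fhat : Rn c.base.D.n × c.base.S.E.lvl 0 → c.fib.E.lvl 0}

/-- The zeros of a filled version are the zeros of the section. -/
theorem BundleChart.IsFilling.eventually (hX : P.boundary = ∅) (hc : c.base ∈ P.atlas)
    (h0 : 0 ∈ c.base.dom univ) (h : c.IsFilling f fhat) :
    ∀ᶠ p in 𝓝 0, p ∈ c.base.dom univ ∧ c.fib.proj p.1 (fhat p) = c.principal f p ∧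
      (p ∈ c.base.S.core → fhat p = c.principal f p) ∧
      (fhat p = 0 → c.principal f p = 0 ∧ p ∈ c.base.S.core) := by
  obtain ⟨-, fc, h1, h2⟩ := h
  have hfull : c.base.S.full ∈ 𝓝 0 := MPolyfold.full_mem_nhds hX hc h0
  have hdom : c.base.dom univ ∈ 𝓝 0 := (MPolyfold.isOpen_dom hX hc isOpen_univ).mem_nhds h0
  have hr : Tendsto c.base.S.retr (𝓝 0) (𝓝 0) := by
    have := c.base.S.continuousOn_retr.continuousAt hfull
    rw [ContinuousAt] at this
    have h3 : c.base.S.retr 0 = 0 := Prod.ext rfl (map_zero _)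
    rwa [h3] at this
  rw [nhdsWithin_eq_nhds.2 hfull] at h1
  filter_upwards [h1, hr.eventually (h2 0), hdom] with p h1 h2 hp
  obtain ⟨A, B, hA, -⟩ := h2 (c.base.S.retr_mem_core hp.1)
  set π := c.base.S.proj p.1
  have hπ : π (p.2 - π p.2) = 0 := by rw [map_sub, c.base.S.idem _ hp.1, sub_self]
  obtain ⟨e1, e2, e3⟩ := hA (p.2 - π p.2) hπ
  have e1' : A (p.2 - π p.2) = fc p.1 (π p.2) (p.2 - π p.2) := e1
  have e2' : c.fib.proj p.1 (A (p.2 - π p.2)) = 0 := e2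
  rw [← e1'] at h1
  have hσ : c.fib.proj p.1 (c.principal f p) = c.principal f p := by
    have h3 := c.toFib_ofFib_toFib (PolyfoldChart.inv_mem_source hp) (f (c.base.inv p))
    rw [PolyfoldChart.map_inv hp] at h3
    exact h3
  have hσf : c.fib.proj p.1 (fhat p) = c.principal f p := by
    rw [h1, map_add, hσ, e2', add_zero]
  refine ⟨hp, hσf, fun hcore => ?_, fun hz => ?_⟩
  · rw [h1, show π p.2 = p.2 from hcore.2, sub_self, map_zero, add_zero]
  -- Applying `σ` removes the complementary term, so the principal part vanishes. The complementary
  -- term then vanishes too, and injectivity of the filler puts `p` in the core.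
  · have h3 : c.principal f p = 0 := by rw [← hσf, hz, map_zero]
    refine ⟨h3, hp.1, ?_⟩
    rw [h3, hz, zero_add] at h1
    rw [← h1, map_zero] at e3
    exact (sub_eq_zero.1 e3.symm).symm

/-- The derivative of a filled version at `0` splits into the derivative of the section and an
isomorphism of the complements. -/
theorem BundleChart.IsFilling.exists_deriv_eq (hX : P.boundary = ∅) (hc : c.base ∈ P.atlas)
    (h0 : 0 ∈ c.base.dom univ) (h : c.IsFilling f fhat) (hf0 : c.principal f 0 = 0)
    {V V' : Set (c.base.S.amb.lvl 1)} (hV : V ∈ 𝓝 0) (hV' : V' ∈ 𝓝 0)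
    {L L' : c.base.S.amb.lvl 0 →L[ℝ] c.fib.E.lvl 0}
    (hL : HasScDeriv (E := c.base.S.amb) (F := c.fib.E) (c.principal f) V 0 L)
    (hL' : HasScDeriv (E := c.base.S.amb) (F := c.fib.E) fhat V' 0 L') :
    ∃ (A : c.base.S.E.lvl 0 →L[ℝ] c.fib.E.lvl 0) (B : c.fib.E.lvl 0 →L[ℝ] c.base.S.E.lvl 0),
      (∀ ξ, L' (ξ.1, c.base.S.proj 0 ξ.2) = L ξ) ∧
      (∀ e, c.base.S.proj 0 e = 0 → L' (0, e) = A e ∧ c.fib.proj 0 (A e) = 0 ∧ B (A e) = e) ∧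
      ∀ η, c.fib.proj 0 η = 0 → c.base.S.proj 0 (B η) = 0 ∧ A (B η) = η := by
  have hev := h.eventually hX hc h0
  have hsm := h.1
  obtain ⟨-, fc, h1, h2⟩ := h
  have hfull : c.base.S.full ∈ 𝓝 0 := MPolyfold.full_mem_nhds hX hc h0
  have h0V : (0 : Rn c.base.D.n) ∈ c.base.D.V := h0.1
  rw [nhdsWithin_eq_nhds.2 hfull] at h1
  have hr0 : c.base.S.retr 0 = 0 := Prod.ext rfl (map_zero _)
  have hcore : (0 : Rn c.base.D.n × c.base.S.E.lvl 0) ∈ c.base.S.core := by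
    have := c.base.S.retr_mem_core (p := 0) h0V
    rwa [hr0] at this
  obtain ⟨A, B, hA, hB⟩ := (h2 0).self_of_nhds hcore
  have hA1 : ∀ e, c.base.S.proj 0 e = 0 → A e = fc 0 0 e := fun e he => (hA e he).1
  refine ⟨A, B, ?_, fun e he => ⟨?_, (hA e he).2.1, (hA e he).2.2⟩, fun η hη => hB η hη⟩
  · -- the principal part is the composition of the filled version with the retraction
    obtain ⟨U, hU, hU0, hUn, hfU⟩ := hsm.scGermDiff hfull 1
    have hfull1 : c.base.S.amb.levels c.base.S.full 1 ∈ 𝓝 0 :=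
      ((c.base.S.amb.incl 0).continuous.tendsto 0).eventually (by rw [map_zero]; exact hfull)
    obtain ⟨ρ, hρ⟩ := ScDiff.exists_hasScDeriv (c.base.S.scDiff_retr 1) (mem_of_mem_nhds hfull1)
    have h3 := HasScDeriv.comp (E := c.base.S.amb) (F := c.base.S.amb) hfU hU
      (c.base.S.scDiff_retr 1).scCont (mem_of_mem_nhds hfull1) (y := 0)
      (by rw [map_zero, hr0]) (hU0 1) hρ hV' hL'
    have hrt : Tendsto c.base.S.retr (𝓝 0) (𝓝 0) := by
      have := c.base.S.continuousOn_retr.continuousAt hfull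
      rwa [ContinuousAt, hr0] at this
    have h4 : ∀ᶠ p in 𝓝 0, fhat (c.base.S.retr p) = c.principal f p := by
      filter_upwards [hrt.eventually hev, hfull] with p hp hpf
      rw [hp.2.2.1 (c.base.S.retr_mem_core hpf), BundleChart.principal, BundleChart.principal,
        PolyfoldChart.inv, PolyfoldChart.inv,
        c.base.S.retr_of_mem_core (c.base.S.retr_mem_core hpf)]
    have h5 : HasScDeriv (E := c.base.S.amb) (F := c.fib.E) (fun p => fhat (c.base.S.retr p)) univ 0
        L := by
      refine HasFDerivAt.hasFDerivWithinAt ?_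
      refine (HasScDeriv.hasFDerivAt (E := c.base.S.amb) (F := c.fib.E) hL hV).congr_of_eventuallyEq
        (eventually_incl_of_eventually (E := c.base.S.amb) h4)
    have h6 := h3.unique hfull1 h5 univ_mem
    intro ξ
    rw [← h6]
    change _ = L' (ρ ξ)
    rw [c.base.S.deriv_retr_zero hfull hfull1 hρ]
  -- On `ker π₀` near `0` the filled version equals the linear map `A`. Composing with `κ = 1 - π₀`
  -- extends this comparison to all directions of `E₁`, and density then gives it on `ker π₀` in
  -- level `0`.
  · obtain ⟨π₁, hπ₁⟩ := c.base.S.isScOperator 0 h0V 1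
    let κ : c.base.S.E.lvl 0 →L[ℝ] c.base.S.E.lvl 0 := ContinuousLinearMap.id ℝ _ - c.base.S.proj 0
    let κ₁ : c.base.S.E.lvl 1 →L[ℝ] c.base.S.E.lvl 1 := ContinuousLinearMap.id ℝ _ - π₁
    have hκ₁ : ∀ x, c.base.S.E.incl 0 (κ₁ x) = κ (c.base.S.E.incl 0 x) := fun x => by
      change c.base.S.E.incl 0 (x - π₁ x) = c.base.S.E.incl 0 x - c.base.S.proj 0 (c.base.S.E.incl 0 x)
      rw [map_sub]
      exact congrArg _ (hπ₁ x)
    have hπκ : ∀ x, c.base.S.proj 0 (κ x) = 0 := fun x => by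
      change c.base.S.proj 0 (x - c.base.S.proj 0 x) = 0
      rw [map_sub, c.base.S.idem 0 h0V, sub_self]
    have h3 : ∀ᶠ e in 𝓝 (0 : c.base.S.E.lvl 0), c.base.S.proj 0 e = 0 → fhat (0, e) = A e := by
      have h4 : Tendsto (fun e : c.base.S.E.lvl 0 => ((0 : Rn c.base.D.n), e)) (𝓝 0) (𝓝 (0, 0)) :=
        (Continuous.prodMk_right _).tendsto 0
      filter_upwards [h4.eventually h1] with e h5 he
      have h6 : c.principal f (0, e) = c.principal f 0 := by
        have : c.base.S.retr (0, e) = c.base.S.retr 0 := by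
          rw [hr0]
          exact Prod.ext rfl he
        rw [BundleChart.principal, BundleChart.principal, PolyfoldChart.inv, PolyfoldChart.inv, this]
      rw [h5, h6, hf0, zero_add]
      rw [he, sub_zero, hA1 e he]
    let i₁ : c.base.S.E.lvl 1 →L[ℝ] Rn c.base.D.n × c.base.S.E.lvl 1 :=
      (ContinuousLinearMap.inr ℝ _ _).comp κ₁
    have h4 : HasFDerivAt (fun x => fhat (c.base.S.amb.incl 0 (i₁ x)))
        ((L'.comp (c.base.S.amb.incl 0)).comp i₁) 0 := by
      have h5 := HasScDeriv.hasFDerivAt (E := c.base.S.amb) (F := c.fib.E) hL' hV'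
      refine HasFDerivAt.comp (g := fun y => fhat (c.base.S.amb.incl 0 y)) (0 : c.base.S.E.lvl 1) ?_
        i₁.hasFDerivAt
      rw [map_zero]
      exact h5
    have h5 : HasFDerivAt (fun x => fhat (c.base.S.amb.incl 0 (i₁ x)))
        (A.comp (κ.comp (c.base.S.E.incl 0))) 0 := by
      refine (A.comp (κ.comp (c.base.S.E.incl 0))).hasFDerivAt.congr_of_eventuallyEq ?_
      have h6 : Tendsto (fun x => κ (c.base.S.E.incl 0 x)) (𝓝 0) (𝓝 0) := by
        have := (κ.comp (c.base.S.E.incl 0)).continuous.tendsto 0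
        rwa [map_zero] at this
      filter_upwards [h6.eventually h3] with x hx
      have h7 : c.base.S.amb.incl 0 (i₁ x) = (0, κ (c.base.S.E.incl 0 x)) := Prod.ext rfl (hκ₁ x)
      rw [h7]
      exact hx (hπκ _)
    have h6 := DFunLike.congr_fun (h4.unique h5)
    have h7 : ((L'.comp (ContinuousLinearMap.inr ℝ (Rn c.base.D.n) (c.base.S.E.lvl 0))).comp κ :
        c.base.S.E.lvl 0 → c.fib.E.lvl 0) = A.comp κ := by
      refine (c.base.S.E.denseRange_incl 0).equalizer (ContinuousLinearMap.continuous _)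
        (ContinuousLinearMap.continuous _) (funext fun x => ?_)
      have h8 := h6 x
      have h9 : c.base.S.amb.incl 0 (i₁ x) = (0, κ (c.base.S.E.incl 0 x)) := Prod.ext rfl (hκ₁ x)
      change L' (c.base.S.amb.incl 0 (i₁ x)) = _ at h8
      rw [h9] at h8
      exact h8
    have h8 : κ e = e := by
      change e - c.base.S.proj 0 e = e
      rw [he, sub_zero]
    have h9 := congrFun h7 e
    change L' (0, κ e) = A (κ e) at h9
    rwa [h8] at h9

/-- The derivative of the principal part at a zero of a filled version. -/
theorem BundleChart.deriv_principal_of_proj {U : ∀ m, Set (c.base.S.amb.lvl m)}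
    (hU : ∀ m, IsOpen (U m)) (hUn : NestedFamily U)
    (hUV : ∀ m, U m ⊆ c.base.S.amb.levels (interior c.base.S.full) m)
    (hf : ScDiff (E := c.base.S.amb) (F := c.fib.E) 1 fhat U) {x : c.base.S.amb.lvl 1} (hx : x ∈ U 1)
    (hfx : fhat (c.base.S.amb.incl 0 x) = 0)
    (hp : ∀ᶠ p in 𝓝 (c.base.S.amb.incl 0 x), c.fib.proj p.1 (fhat p) = c.principal f p)
    {V V' : Set (c.base.S.amb.lvl 1)} (hV : V ∈ 𝓝 x) (hV' : V' ∈ 𝓝 x)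
    {L L' : c.base.S.amb.lvl 0 →L[ℝ] c.fib.E.lvl 0}
    (hL : HasScDeriv (E := c.base.S.amb) (F := c.fib.E) (c.principal f) V x L)
    (hL' : HasScDeriv (E := c.base.S.amb) (F := c.fib.E) fhat V' x L') (ξ) :
    L ξ = c.fib.proj (c.base.S.amb.incl 0 x).1 (L' ξ) := by
  let T : (c.base.S.amb.lvl 0) × c.fib.E.lvl 0 →L[ℝ] Rn c.base.D.n × c.fib.E.lvl 0 :=
    (ContinuousLinearMap.fst ℝ (Rn c.base.D.n) (c.base.S.E.lvl 0)).prodMap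
      (ContinuousLinearMap.id ℝ _)
  have hT : IsScOperator (E := c.base.S.amb.prod c.fib.E) (F := (scR c.base.D.n).prod c.fib.E) T := by
    intro m
    refine ⟨(ContinuousLinearMap.fst ℝ (Rn c.base.D.n) (c.base.S.E.lvl m)).prodMap
      (ContinuousLinearMap.id ℝ _), fun z => ?_⟩
    rw [BanachScale.emb_prod, BanachScale.emb_prod, BanachScale.emb_prod]
    rfl
  have hVV : ∀ m, ∀ p ∈ U m, p.1 ∈ interior c.base.D.V := fun m p hp => by
    have h1 : c.base.S.amb.emb m p ∈ interior c.base.S.full := hUV m hp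
    have h2 := ConeDomain.mem_nhds_of_full c.base.S (mem_interior_iff_mem_nhds.1 h1)
    rw [BanachScale.emb_prod] at h2
    have h3 : c.base.D.V ∈ 𝓝 ((scaleR c.base.D.n).emb m p.1) := h2
    rw [scaleR_emb] at h3
    exact mem_interior_iff_mem_nhds.2 h3
  have hσ : ScDiff (E := (scR c.base.D.n).prod c.fib.E) (F := c.fib.E) 1
      (fun p : Rn c.base.D.n × c.fib.E.lvl 0 => c.fib.proj p.1 p.2)
      (fun m => {p : Rn c.base.D.n × c.fib.E.lvl m | p.1 ∈ interior c.base.D.V}) :=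
    (c.fib.smooth 1).mono fun m p (hp : p.1 ∈ interior c.base.D.V) => by
      refine mem_levels.2 ?_
      rw [BanachScale.emb_prod]
      change (scaleR c.base.D.n).emb m p.1 ∈ c.base.D.V
      rw [scaleR_emb]
      exact interior_subset hp
  have hφ : ScDiff (E := c.base.S.amb.prod c.fib.E) (F := c.fib.E) 1
      (fun p : (c.base.S.amb.lvl 0) × c.fib.E.lvl 0 => (c.fib.proj p.1.1).toLinearMap p.2)
      (fun m => {p : c.base.S.amb.lvl m × c.fib.E.lvl m | p.1 ∈ U m}) := by
    refine hσ.comp (E := c.base.S.amb.prod c.fib.E) (F := (scR c.base.D.n).prod c.fib.E)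
      (f := T) (ScDiff.of_isScOperator hT _) (fun m p hp => hUn m hp)
      (fun m => isOpen_interior.preimage continuous_fst) fun m p hp y hy => ?_
    have h1 : y = (p.1.1, p.2) := ((scR c.base.D.n).prod c.fib.E).emb_injective m (by
      rw [hy, BanachScale.emb_prod, BanachScale.emb_prod, BanachScale.emb_prod]
      rfl)
    rw [h1]
    exact hVV m p.1 hp
  have hid : IsScOperator (E := c.base.S.amb) (F := c.base.S.amb)
      (ContinuousLinearMap.id ℝ (c.base.S.amb.lvl 0)) := fun m =>
    ⟨ContinuousLinearMap.id ℝ _, fun _ => rfl⟩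
  -- With the identity as base map, this is the product rule for `σ_v f̂`, whose term containing the
  -- derivative of `σ` drops out at a zero of `f̂`.
  obtain ⟨K, hK, hK'⟩ := HasScDeriv.fiber_comp (E := c.base.S.amb) (H := c.base.S.amb)
    (φ := fun p : c.base.S.amb.lvl 0 => (c.fib.proj p.1).toLinearMap) hU hUn hφ hf hUn
    (a := ContinuousLinearMap.id ℝ (c.base.S.amb.lvl 0)) (ScDiff.of_isScOperator hid U)
    (fun m y hy z hz => by
      obtain rfl := c.base.S.amb.emb_injective m hz
      exact hy) hx rfl hfx (A := ContinuousLinearMap.id ℝ (c.base.S.amb.lvl 0))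
    (c.base.S.amb.incl 0).hasFDerivWithinAt hV' hL'
  have h1 : HasScDeriv (E := c.base.S.amb) (F := c.fib.E) (c.principal f) univ x K := by
    have h2 := HasScDeriv.hasFDerivAt (E := c.base.S.amb) (F := c.fib.E) hK ((hU 1).mem_nhds hx)
    refine HasFDerivAt.hasFDerivWithinAt (h2.congr_of_eventuallyEq ?_)
    filter_upwards [((c.base.S.amb.incl 0).continuous.tendsto x).eventually hp] with z hz
    exact hz.symm
  rw [hL.unique hV h1 univ_mem, hK']
  rfl

end Filling

/-! ### Local parametrization of the solution set of a Fredholm section. -/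

section LocalSections

variable {X : Type v} [TopologicalSpace X] {Y : X → Type w}
    [∀ x, AddCommGroup (Y x)] [∀ x, Module ℝ (Y x)] [TopologicalSpace (Tot Y)]
    {P : MPolyfold.{u} X} {b : StrongBundle P Y} {f : ∀ x, Y x}

theorem BundleChart.principal_eq_zero_iff {c : BundleChart.{u} Y}
    {p : Rn c.base.D.n × c.base.S.E.lvl 0} (hp : p ∈ c.base.dom univ) :
    c.principal f p = 0 ↔ f (c.base.inv p) = 0 := by
  refine ⟨fun h => ?_, fun h => ?_⟩
  · rw [← c.ofFib_toFib _ (PolyfoldChart.inv_mem_source hp) (f (c.base.inv p))]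
    exact (congrArg _ h).trans (map_zero _)
  · rw [BundleChart.principal, h, map_zero]

theorem ScPlotAt.eventually_mem_level_one {E : ScBanach.{u}} {Q : Type*} [NormedAddCommGroup Q]
    [NormedSpace ℝ Q] {k : ℕ} {Γ : Q → E.lvl 0} {t : Q} (h : ScPlotAt k Γ t) {x : E.lvl 1}
    (hx : E.incl 0 x = Γ t) {U : Set (E.lvl 1)} (hU : U ∈ 𝓝 x) :
    ∀ᶠ s in 𝓝 t, ∀ y, E.incl 0 y = Γ s → y ∈ U := by
  obtain ⟨d, hd, hd'⟩ := h 1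
  have h0 : d t = x := E.incl_injective 0 (by rw [hx]; exact hd'.self_of_nhds)
  rw [← h0] at hU
  filter_upwards [hd', hd.continuousAt.eventually_mem hU] with s hs hs' y hy
  have : y = d s := E.incl_injective 0 (hy.trans hs.symm)
  rwa [this]

set_option maxHeartbeats 800000 in
/-- Near a smooth zero at which the linearization is onto, the solution set of a Fredholm section
is parametrized by a smooth plot. -/
theorem StrongBundle.IsFredholm.exists_local_section (hX : P.boundary = ∅) (hf : b.IsFredholm f)
    {q : X} (hq : q ∈ P.smoothPts) (hfq : f q = 0)
    (hsurj : Function.Surjective (b.linearization f q)) :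
    FiniteDimensional ℝ (LinearMap.ker (b.linearization f q)) ∧
    ∃ c ∈ P.atlas, q ∈ c.map.source ∧ c.map q = 0 ∧
      ∃ (ℓ : Rn c.D.n × c.S.E.lvl 0 →L[ℝ]
          Rn (Module.finrank ℝ (LinearMap.ker (b.linearization f q))))
        (Γ : Rn (Module.finrank ℝ (LinearMap.ker (b.linearization f q))) →
          Rn c.D.n × c.S.E.lvl 0),
        Γ 0 = 0 ∧ (∀ k, ScPlotAt (W := c.S.amb) k Γ 0) ∧
        (∀ᶠ t in 𝓝 0, Γ t ∈ c.map.target ∧ f (c.map.symm (Γ t)) = 0 ∧ ℓ (Γ t) = t ∧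
          Function.Surjective (b.linearization f (c.map.symm (Γ t)))) ∧
        ∀ᶠ x in 𝓝 q, f x = 0 → Γ (ℓ (c.map x)) = c.map x := by
  obtain ⟨c, hc, hqc, hq0, fhat, hfill, W, r, Q, hQ, Ψ, hcontr⟩ := hf.2.2 q hq
  have hcP := b.base_mem c hc
  have h0 : (0 : Rn c.base.D.n × c.base.S.E.lvl 0) ∈ c.base.dom univ := by
    rw [← hq0]; exact c.base.map_mem_dom hqc (mem_univ q)
  have hfull : c.base.S.full ∈ 𝓝 0 := MPolyfold.full_mem_nhds hX hcP h0
  have hinv0 : c.base.inv 0 = q := by rw [← hq0, c.base.inv_map hqc]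
  have hpr0 : c.principal f 0 = 0 := by
    rw [BundleChart.principal_eq_zero_iff h0, hinv0, hfq]
  have hev := hfill.eventually hX hcP h0
  have hcore : (0 : Rn c.base.D.n × c.base.S.E.lvl 0) ∈ c.base.S.core := by
    rw [← hq0]; exact c.base.target_subset_core (c.base.map.map_source hqc)
  have hfhat0 : fhat 0 = 0 := by rw [hev.self_of_nhds.2.2.1 hcore, hpr0]
  let S : FilledGerm c.base.S.amb c.fib.E W Q.n r :=
    FilledGerm.ofIsoGerm hfull hQ Ψ hfill.1 hfhat0 hcontr
  obtain ⟨U, hU, hU0, hUn, hUf⟩ := hfill.1.scGermDiff hfull 1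
  have hU1 := (hU 1).mem_nhds (hU0 1)
  obtain ⟨L', hL'⟩ := ScDiff.exists_hasScDeriv hUf (hU0 1)
  have hp0 : c.base.S.amb.incl 0 0 = c.base.map q := by rw [map_zero, hq0]
  have hdom1 := MPolyfold.levels_dom_mem_nhds hX hcP isOpen_univ hqc (mem_univ q) hp0
  have hfull1 := MPolyfold.levels_full_mem_nhds hX hcP hqc hp0
  obtain ⟨L, hL⟩ := ScDiff.exists_hasScDeriv (hf.1 c hc 1) (mem_of_mem_nhds hdom1)
  obtain ⟨ρ, hρ⟩ := ScDiff.exists_hasScDeriv (c.base.S.scDiff_retr 1) (mem_of_mem_nhds hfull1)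
  obtain ⟨A, B, hL'L, hA, hB⟩ := hfill.exists_deriv_eq hX hcP h0 hpr0 hdom1 hU1 hL hL'
  obtain ⟨-, -, hσL⟩ := StrongBundle.deriv_principal_eq hX hf.1 hc hqc hfq hp0 hL hρ
  have hρeq := c.base.S.deriv_retr_zero hfull hfull1 hρ
  have hv0 : (c.base.map q).1 = 0 := by rw [hq0]; rfl
  rw [hv0] at hσL
  have h0V : (0 : Rn c.base.D.n) ∈ c.base.D.V := h0.1
  -- The derivative of the filled version is block diagonal: `L` on the image of the retraction and
  -- the isomorphism `A` on `ker π₀`. Surjectivity and the kernel of `L'` are read off from this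
  -- splitting.
  have hsplit : ∀ ξ : Rn c.base.D.n × c.base.S.E.lvl 0,
      c.base.S.proj 0 (ξ.2 - c.base.S.proj 0 ξ.2) = 0 ∧
      L' ξ = L ξ + A (ξ.2 - c.base.S.proj 0 ξ.2) := fun ξ => by
    have h1 : c.base.S.proj 0 (ξ.2 - c.base.S.proj 0 ξ.2) = 0 := by
      rw [map_sub, c.base.S.idem 0 h0V, sub_self]
    refine ⟨h1, ?_⟩
    rw [← hL'L, ← (hA _ h1).1, ← map_add]
    congr 1
    exact Prod.ext (by simp) (by simp)
  have hsurj' : Function.Surjective L' := fun η => by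
    have h1 := (StrongBundle.surjective_linearization_iff hX hf.1 hc hqc hfq hp0 hL).1 hsurj
    rw [hv0] at h1
    obtain ⟨ξ, hξ⟩ := h1 (c.fib.proj 0 η) (c.fib.idem 0 h0V η)
    have h2 : c.fib.proj 0 (η - c.fib.proj 0 η) = 0 := by
      rw [map_sub, c.fib.idem 0 h0V, sub_self]
    obtain ⟨h3, h4⟩ := hB _ h2
    refine ⟨(ξ.1, c.base.S.proj 0 ξ.2) + (0, B (η - c.fib.proj 0 η)), ?_⟩
    rw [map_add, (hA _ h3).1, h4]
    rw [show L' (ξ.1, c.base.S.proj 0 ξ.2) = L ξ from hL'L ξ, hξ]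
    exact add_sub_cancel _ _
  have hker : LinearMap.ker L'.toLinearMap =
      LinearMap.eqLocus ρ.toLinearMap LinearMap.id ⊓ LinearMap.ker L.toLinearMap := by
    ext ξ
    obtain ⟨h1, h2⟩ := hsplit ξ
    constructor
    · intro hξ
      have hξ : L' ξ = 0 := hξ
      have h3 : L ξ = 0 := by
        have := congrArg (c.fib.proj 0) h2
        rwa [map_add, (hA _ h1).2.1, hσL, hξ, map_zero, add_zero, eq_comm] at this
      rw [h3, hξ, zero_add] at h2
      have h4 := (hA _ h1).2.2
      rw [← h2, map_zero] at h4
      refine ⟨?_, h3⟩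
      change ρ ξ = ξ
      rw [hρeq]
      exact Prod.ext rfl (sub_eq_zero.1 h4.symm).symm
    · rintro ⟨h3, h4⟩
      have h3 : ρ ξ = ξ := h3
      have h4 : L ξ = 0 := h4
      change L' ξ = 0
      rw [hρeq] at h3
      have h5 : c.base.S.proj 0 ξ.2 = ξ.2 := congrArg Prod.snd h3
      rw [h2, h4, h5, sub_self, map_zero, add_zero]
  obtain ⟨e⟩ := StrongBundle.ker_linearization_equiv hX hf.1 hc hqc hfq hp0 hL hρ
  rw [← hker] at e
  have hsol := S.exists_solution hU1 hL' hsurj'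
  rw [← e.finrank_eq] at hsol
  obtain ⟨hfin, ℓ, Γ, hΓ0, hΓ, hz, hu, hs⟩ := hsol
  refine ⟨Module.Finite.equiv e.symm, c.base, hcP, hqc, hq0, ℓ, Γ, hΓ0, hΓ, ?_, ?_⟩
  · have tΓ : Tendsto Γ (𝓝 0) (𝓝 0) := by
      have := (hΓ 0).contDiffAt.continuousAt
      rwa [ContinuousAt, hΓ0] at this
    -- an open family on which the derivatives exist
    let U' : ∀ m, Set (c.base.S.amb.lvl m) := fun m =>
      U m ∩ c.base.S.amb.levels (interior c.base.S.full) m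
    have hU' : ∀ m, IsOpen (U' m) := fun m => (hU m).inter (isOpen_levels isOpen_interior m)
    have hU'n : NestedFamily U' := fun m x hx => ⟨hUn m hx.1, hx.2⟩
    have hU'0 : (0 : c.base.S.amb.lvl 1) ∈ U' 1 := ⟨hU0 1, mem_levels.2 (by
      rw [map_zero]; exact mem_interior_iff_mem_nhds.2 hfull)⟩
    have hmem := (hΓ 0).eventually_mem_level_one (x := (0 : c.base.S.amb.lvl 1))
      (by rw [map_zero, hΓ0]) ((hU' 1).mem_nhds hU'0)
    filter_upwards [hz, hs, hmem, tΓ.eventually hev.eventually_nhds] with t h1 h2 h3 h4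
    have h1f : fhat (Γ t) = 0 := h1.1
    obtain ⟨hdom, hσ, -, hfz⟩ := h4.self_of_nhds
    obtain ⟨hprz, hΓcore⟩ := hfz h1f
    have hretr := c.base.S.retr_of_mem_core hΓcore
    have htar : Γ t ∈ c.base.map.target := by
      have := hdom.2.1
      rwa [hretr] at this
    have hinv : c.base.inv (Γ t) = c.base.map.symm (Γ t) := by rw [PolyfoldChart.inv, hretr]
    have hft : f (c.base.map.symm (Γ t)) = 0 := by
      rw [← hinv]; exact (BundleChart.principal_eq_zero_iff hdom).1 hprz
    refine ⟨htar, hft, h1.2, ?_⟩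
    obtain ⟨x₁, hx₁, V, hV, D, hD, hDs⟩ := h2
    have hxs := c.base.map.map_target htar
    have hp : c.base.S.amb.incl 0 x₁ = c.base.map (c.base.map.symm (Γ t)) := by
      rw [hx₁, c.base.map.right_inv htar]
    have hdomt := MPolyfold.levels_dom_mem_nhds hX hcP isOpen_univ hxs (mem_univ _) hp
    obtain ⟨Lt, hLt⟩ := ScDiff.exists_hasScDeriv (hf.1 c hc 1) (mem_of_mem_nhds hdomt)
    -- At the nearby zero, the derivative of the principal part is `σ` applied to the derivative of
    -- the filled version, which is onto. It therefore hits every vector fixed by `σ`.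
    rw [StrongBundle.surjective_linearization_iff hX hf.1 hc hxs hft hp hLt]
    intro η hη
    obtain ⟨ξ, hξ⟩ := hDs η
    refine ⟨ξ, ?_⟩
    rw [BundleChart.deriv_principal_of_proj hU' hU'n (fun m => inter_subset_right)
      (hUf.mono fun m => inter_subset_left) (h3 x₁ hx₁) (by rw [hx₁]; exact h1f)
      (by rw [hx₁]; exact h4.mono fun p hp => hp.2.1) hdomt hV hLt hD, hξ, hp]
    exact hη
  · have tm : Tendsto c.base.map (𝓝 q) (𝓝 0) := by
      have := c.base.continuousOn.continuousAt (c.base.open_source.mem_nhds hqc)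
      rwa [ContinuousAt, hq0] at this
    filter_upwards [tm.eventually hu, tm.eventually hev, c.base.open_source.mem_nhds hqc]
      with x h1 h2 h3 hfx
    refine h1 ?_
    have h4 := h2.2.2.1 (c.base.target_subset_core (c.base.map.map_source h3))
    refine h4.trans ((BundleChart.principal_eq_zero_iff h2.1).2 ?_)
    rw [c.base.inv_map h3, hfx]

end LocalSections

/-! ### From a smooth parametrization to a manifold structure. -/

section SmoothStructure

variable {X : Type v} [TopologicalSpace X] {P : MPolyfold.{u} X}

/-- Local lifts of a plot are compatible and give a lift on an open set. -/
theorem ScPlotAt.exists_contDiffOn {E : ScBanach.{u}} {Q : Type*} [NormedAddCommGroup Q]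
    [NormedSpace ℝ Q] {k : ℕ} {h : Q → E.lvl 0} {A : Set Q} (hh : ∀ t ∈ A, ScPlotAt k h t) (m : ℕ) :
    ∃ g : Q → E.lvl m, ContDiffOn ℝ k g A ∧ ∀ t ∈ A, E.emb m (g t) = h t := by
  classical
  let g : Q → E.lvl m := fun t => if ht : ∃ y, E.emb m y = h t then ht.choose else 0
  have hg : ∀ t y, E.emb m y = h t → g t = y := fun t y hy => by
    have ht : ∃ y, E.emb m y = h t := ⟨y, hy⟩
    simp only [g, dif_pos ht]
    exact E.emb_injective m (ht.choose_spec.trans hy.symm)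
  refine ⟨g, fun t ht => ?_, fun t ht => ?_⟩
  · obtain ⟨d, hd, hd'⟩ := hh t ht m
    refine (hd.congr_of_eventuallyEq ?_).contDiffWithinAt
    filter_upwards [hd'] with s hs using hg s _ hs
  · obtain ⟨d, hd, hd'⟩ := hh t ht m
    rw [hg t _ hd'.self_of_nhds, hd'.self_of_nhds]

theorem MPolyfold.scPlotAt_map (hX : P.boundary = ∅) {c c' : PolyfoldChart.{u} X}
    (hc : c ∈ P.atlas) (hc' : c' ∈ P.atlas) {Q : Type*} [NormedAddCommGroup Q] [NormedSpace ℝ Q]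
    [FiniteDimensional ℝ Q] {k : ℕ} {γ : Q → X} {t : Q} (hγ : ∀ᶠ s in 𝓝 t, γ s ∈ c.map.source)
    (ht : γ t ∈ c'.map.source) (h : ScPlotAt (W := c.S.amb) k (fun s => c.map (γ s)) t) :
    ScPlotAt (W := c'.S.amb) k (fun s => c'.map (γ s)) t := by
  have h1 := ScDiff.comp_scPlotAt (E := c.S.amb) (F := c'.S.amb) (P.compatible c hc c' hc' k)
    (fun m => isOpen_levels (isOpen_dom hX hc c'.open_source) m) (nestedFamily_levels _) h
    (fun m y hy => by
      refine mem_levels.2 ?_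
      rw [hy]
      exact c.map_mem_dom hγ.self_of_nhds ht)
  refine h1.congr ?_
  filter_upwards [hγ] with s hs
  rw [c.inv_map hs]

/-- A subset of an M-polyfold that is parametrized by a smooth plot with a linear inverse is
a smooth submanifold. -/
theorem MPolyfold.isSmoothSubmanifold_of_plot (hX : P.boundary = ∅) {M : Set X} (hne : M.Nonempty)
    (hM : M ⊆ P.smoothPts) {c : PolyfoldChart.{u} X} (hc : c ∈ P.atlas) (hMc : M ⊆ c.map.source)
    {n : ℕ} {ℓ : Rn c.D.n × c.S.E.lvl 0 →L[ℝ] Rn n} {Γ : Rn n → Rn c.D.n × c.S.E.lvl 0}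
    {Ω : Set (Rn n)} (hΩ : IsOpen Ω)
    (hΓ : ∀ t ∈ Ω, Γ t ∈ c.map.target ∧ c.map.symm (Γ t) ∈ M ∧ ℓ (Γ t) = t)
    (hℓ : ∀ x ∈ M, ℓ (c.map x) ∈ Ω ∧ Γ (ℓ (c.map x)) = c.map x)
    (hs : ∀ t ∈ Ω, ∀ k, ScPlotAt (W := c.S.amb) k Γ t) : P.IsSmoothSubmanifold M n := by
  have : Nonempty M := hne.to_subtype
  refine ⟨hM, ?_⟩
  -- A single global chart, with inverse `c.map.symm ∘ Γ` on the open set `Ω`.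
  let e : M → Rn n := fun x => ℓ (c.map x)
  have hmap : Continuous fun x : M => c.map x :=
    continuousOn_iff_continuous_domRestrict.1 (c.continuousOn.mono hMc)
  have hec : Continuous e := ℓ.continuous.comp hmap
  have hinj : Function.Injective e := fun x y hxy => by
    refine Subtype.ext (c.map.injOn (hMc x.2) (hMc y.2) ?_)
    rw [← (hℓ x x.2).2, ← (hℓ y y.2).2]
    exact congrArg Γ hxy
  have hsc : ∀ t ∈ Ω, ContinuousAt (fun t => c.map.symm (Γ t)) t := fun t ht => by
    have h1 : ContinuousWithinAt c.map.symm c.map.target (Γ t) := c.continuousOn_symm _ (hΓ t ht).1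
    refine Tendsto.comp h1 (tendsto_nhdsWithin_iff.2 ⟨(hs t ht 0).contDiffAt.continuousAt, ?_⟩)
    filter_upwards [hΩ.mem_nhds ht] with s hs using (hΓ s hs).1
  have hopen : IsOpenMap e := by
    refine IsOpenMap.of_nhds_le fun x => ?_
    intro V hV
    obtain ⟨O, hO, hOV⟩ := mem_nhds_subtype M x _ |>.1 (mem_map.1 hV)
    have hx : c.map.symm (Γ (e x)) = x := by
      change c.map.symm (Γ (ℓ (c.map x))) = x
      rw [(hℓ x x.2).2, c.map.left_inv (hMc x.2)]
    have h1 := hsc (e x) (hℓ x x.2).1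
    rw [ContinuousAt, hx] at h1
    filter_upwards [hΩ.mem_nhds (hℓ x x.2).1, h1.eventually_mem hO] with t ht htO
    have h2 := @hOV ⟨c.map.symm (Γ t), (hΓ t ht).2.1⟩ htO
    have h3 : e ⟨c.map.symm (Γ t), (hΓ t ht).2.1⟩ = t := by
      change ℓ (c.map (c.map.symm (Γ t))) = t
      rw [c.map.right_inv (hΓ t ht).1, (hΓ t ht).2.2]
    rw [← h3]
    exact h2
  have he : IsOpenEmbedding e := .of_continuous_injective_isOpenMap hec hinj hopen
  let _ := he.singletonChartedSpace
  refine ⟨he.singletonChartedSpace, he.isManifold_singleton, fun d W hW γ => ?_⟩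
  refine ⟨fun h => ?_, fun h => ?_⟩
  · have hγc : ContinuousOn (fun t => (γ t : X)) W :=
      continuous_subtype_val.comp_continuousOn h.continuousOn
    refine ⟨hγc, fun c' hc' k => ?_⟩
    have hu : ContDiffOn ℝ ∞ (e ∘ γ) W := contMDiffOn_iff_contDiffOn.1
      ((contMDiff_isOpenEmbedding (I := 𝓡 n) he).comp_contMDiffOn h)
    have hA : IsOpen (W ∩ (fun t => (γ t : X)) ⁻¹' c'.map.source) :=
      hγc.isOpen_inter_preimage hW c'.open_source
    -- On the constant scale `ℝᵈ`, sc-smoothness follows from `Cᵏ` lifts to every level. They exist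
    -- because in the chart `c` the map `γ` is the plot `Γ` composed with the smooth map `e ∘ γ`.
    refine ScDiff.of_contDiffOn (E := scR d) (F := c'.S.amb) (isOpen_levels (E := scR d) hA)
      (nestedFamily_levels (E := scR d) _) fun m => ?_
    obtain ⟨g, hg, hg'⟩ := ScPlotAt.exists_contDiffOn (E := c'.S.amb) (k := k)
      (h := fun t => c'.map (γ t)) (A := W ∩ (fun t => (γ t : X)) ⁻¹' c'.map.source)
      (fun t ht => by
        refine MPolyfold.scPlotAt_map hX hc hc' (γ := fun t => (γ t : X))
          (Eventually.of_forall fun s => hMc (γ s).2) ht.2 ?_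
        have h1 : (fun s => c.map (γ s)) = fun s => Γ ((e ∘ γ) s) :=
          funext fun s => (hℓ (γ s) (γ s).2).2.symm
        rw [h1]
        refine ScPlotAt.comp_contDiffAt (E := c.S.amb) (δ := Γ) (j := e ∘ γ)
          (hs _ (hℓ (γ t) (γ t).2).1 k) ?_
        exact (hu.contDiffAt (hW.mem_nhds ht.1)).of_le (by exact_mod_cast le_top)) m
    have hlev : (scR d).levels (W ∩ (fun t => (γ t : X)) ⁻¹' c'.map.source) m =
        W ∩ (fun t => (γ t : X)) ⁻¹' c'.map.source := by
      ext t
      refine mem_levels.trans ?_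
      rw [scaleR_emb]
    refine ⟨g, ?_, fun t ht => ?_⟩
    · rw [hlev]; exact hg
    · rw [hlev] at ht
      rw [scaleR_emb]
      exact hg' t ht
  · have hu : ContDiffOn ℝ ∞ (e ∘ γ) W := by
      refine contDiffOn_infty.2 fun k => ?_
      have h1 := h.2 c hc k
      -- All levels of `ℝᵈ` coincide, so the identity is a plot into level `k` and the loss of
      -- levels is harmless.
      obtain ⟨g, hg, hg'⟩ := h1.exists_contDiffOn_comp (E := scR d) (F := c.S.amb)
        (nestedFamily_levels (E := scR d) _) hW (m := 0) (γ := fun t => t) contDiffOn_id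
        (fun t ht => by
          refine mem_levels.2 ?_
          rw [scaleR_emb]
          exact ⟨ht, hMc (γ t).2⟩)
      refine (ℓ.contDiff.comp_contDiffOn hg).congr fun t ht => ?_
      have h2 := hg' t ht
      rw [scaleR_emb] at h2
      exact congrArg ℓ h2.symm
    have h1 : γ = (he.toOpenPartialHomeomorph e).symm ∘ (e ∘ γ) := by
      funext t
      rw [Function.comp_apply, Function.comp_apply, IsOpenEmbedding.toOpenPartialHomeomorph_left_inv]
    rw [h1]
    exact (contMDiffOn_isOpenEmbedding_symm (I := 𝓡 n) he).comp
      (contMDiffOn_iff_contDiffOn.2 hu) fun t _ => mem_range_self _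

end SmoothStructure

/-! ### Regularity of solutions and smoothness of the parametrization at every point. -/

section SolutionSet

variable {X : Type v} [TopologicalSpace X] {Y : X → Type w}
    [∀ x, AddCommGroup (Y x)] [∀ x, Module ℝ (Y x)] [TopologicalSpace (Tot Y)]
    {P : MPolyfold.{u} X} {b : StrongBundle P Y} {f : ∀ x, Y x}

/-- Bootstrapping: the zero vector lies in every fibre level, so the regularizing property raises
the level of `x` one step at a time. -/
theorem StrongBundle.IsRegularizing.mem_smoothPts (hf : b.IsRegularizing f) {x : X} (hx : f x = 0) :
    x ∈ P.smoothPts := by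
  refine mem_iInter.2 fun m => ?_
  induction m with
  | zero =>
    obtain ⟨c, hc, hxc⟩ := P.cover x
    exact ⟨c, hc, hxc, _, rfl⟩
  | succ m ih =>
    obtain ⟨c, hc, hxc⟩ := b.cover x
    refine hf m x ⟨ih, c, hc, hxc, 0, ?_⟩
    rw [hx, map_zero, map_zero]

/-- The derivative of a map with a local inverse is bijective. -/
theorem HasFDerivAt.bijective_of_inverse {A B : Type*} [NormedAddCommGroup A] [NormedSpace ℝ A]
    [NormedAddCommGroup B] [NormedSpace ℝ B] {v : A → B} {u : B → A} {a : A}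
    {v' : A →L[ℝ] B} {u' : B →L[ℝ] A} (hv : HasFDerivAt v v' a) (hu : HasFDerivAt u u' (v a))
    (huv : ∀ᶠ x in 𝓝 a, u (v x) = x) (hvu : ∀ᶠ y in 𝓝 (v a), v (u y) = y) :
    Function.Bijective v' := by
  have h1 : u'.comp v' = ContinuousLinearMap.id ℝ A :=
    (hu.comp a hv).unique ((hasFDerivAt_id a).congr_of_eventuallyEq huv)
  have hva : HasFDerivAt v v' (u (v a)) := by rwa [huv.self_of_nhds]
  have h2 : v'.comp u' = ContinuousLinearMap.id ℝ B :=
    (hva.comp (v a) hu).unique ((hasFDerivAt_id (v a)).congr_of_eventuallyEq hvu)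
  exact ⟨Function.LeftInverse.injective (g := u') fun x => DFunLike.congr_fun h1 x,
    Function.RightInverse.surjective (g := u') fun x => DFunLike.congr_fun h2 x⟩

/-- A `C¹` parametrization of the solution set with a linear inverse is a smooth plot at a point
where the linearization is onto. -/
theorem StrongBundle.IsFredholm.scPlotAt_of_parametrization (hX : P.boundary = ∅)
    (hf : b.IsFredholm f) {c : PolyfoldChart.{u} X} (hc : c ∈ P.atlas) {N : ℕ}
    {ℓ : Rn c.D.n × c.S.E.lvl 0 →L[ℝ] Rn N} {Γ : Rn N → Rn c.D.n × c.S.E.lvl 0} {t₀ : Rn N}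
    {Γ₁ : Rn N → c.S.amb.lvl 1} (hΓ₁ : DifferentiableAt ℝ Γ₁ t₀)
    (hΓ₁' : ∀ᶠ t in 𝓝 t₀, c.S.amb.incl 0 (Γ₁ t) = Γ t)
    (htar : ∀ᶠ t in 𝓝 t₀, Γ t ∈ c.map.target)
    (hzero : ∀ᶠ t in 𝓝 t₀, f (c.map.symm (Γ t)) = 0) (hℓ : ∀ᶠ t in 𝓝 t₀, ℓ (Γ t) = t)
    (hu : ∀ᶠ x in 𝓝 (c.map.symm (Γ t₀)), f x = 0 → Γ (ℓ (c.map x)) = c.map x)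
    (hsurj : Function.Surjective (b.linearization f (c.map.symm (Γ t₀)))) (k : ℕ) :
    ScPlotAt (W := c.S.amb) k Γ t₀ := by
  set s : Rn N → X := fun t => c.map.symm (Γ t) with hs_def
  have hx0 : s t₀ ∈ c.map.source := c.map.map_target htar.self_of_nhds
  -- The local theorem at the point `s t₀` gives a second parametrization, smooth at its own centre.
  obtain ⟨-, c', hc', hq', hq0', ℓ', Γ', hΓ'0, hΓ', hz', hu'⟩ := hf.exists_local_section hX
    (hf.2.1.mem_smoothPts hzero.self_of_nhds) hzero.self_of_nhds hsurj
  -- The dimensions `N'` and `N` need not be compared beforehand; that the derivative of `v` is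
  -- bijective takes care of it.
  generalize Module.finrank ℝ (LinearMap.ker (b.linearization f (c.map.symm (Γ t₀)))) = N' at *
  have hcs : ∀ᶠ t in 𝓝 t₀, c.map (s t) = Γ t := by
    filter_upwards [htar] with t ht using c.map.right_inv ht
  have hssrc : ∀ᶠ t in 𝓝 t₀, s t ∈ c.map.source := by
    filter_upwards [htar] with t ht using c.map.map_target ht
  have hΓd : HasFDerivAt Γ ((c.S.amb.incl 0).comp (fderiv ℝ Γ₁ t₀)) t₀ :=
    ((c.S.amb.incl 0).hasFDerivAt.comp t₀ hΓ₁.hasFDerivAt).congr_of_eventuallyEq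
      (hΓ₁'.mono fun t ht => ht.symm)
  have hsc : ContinuousAt s t₀ := by
    have h1 : ContinuousWithinAt c.map.symm c.map.target (Γ t₀) :=
      c.continuousOn_symm _ htar.self_of_nhds
    exact Tendsto.comp h1 (tendsto_nhdsWithin_iff.2 ⟨hΓd.continuousAt, htar⟩)
  -- the coordinate change `u` and its inverse `v`
  let w : Rn N → Rn c'.D.n × c'.S.E.lvl 0 := fun t => c'.map (s t)
  let u : Rn N → Rn N' := fun t => ℓ' (w t)
  let v : Rn N' → Rn N := fun t => ℓ (c.map (c'.map.symm (Γ' t)))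
  have hw0 : w t₀ = 0 := hq0'
  have hu0 : u t₀ = 0 := by simp only [u, hw0, map_zero]
  have hs0 : c'.map.symm (Γ' 0) = s t₀ := by
    rw [hΓ'0, ← hq0', c'.map.left_inv hq']
  have hv0 : v 0 = t₀ := by
    simp only [v, hs0]
    rw [hcs.self_of_nhds, hℓ.self_of_nhds]
  have hwd : ∃ w' : Rn N →L[ℝ] Rn c'.D.n × c'.S.E.lvl 0, HasFDerivAt w w' t₀ := by
    have hp : c.S.amb.incl 0 (Γ₁ t₀) = c.map (s t₀) := by
      rw [hΓ₁'.self_of_nhds, hcs.self_of_nhds]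
    have hdom := MPolyfold.levels_dom_mem_nhds hX hc c'.open_source hx0 hq' hp
    obtain ⟨D, hD⟩ := ScDiff.exists_hasScDeriv (E := c.S.amb) (F := c'.S.amb)
      (P.compatible c hc c' hc' 1) (mem_of_mem_nhds hdom)
    refine ⟨_, (HasScDeriv.comp_hasFDerivAt (E := c.S.amb) (F := c'.S.amb) hΓ₁' hD hdom hΓ₁
      hΓd).congr_of_eventuallyEq ?_⟩
    filter_upwards [htar] with t ht
    simp only [w, s, PolyfoldChart.inv, c.S.retr_of_mem_core (c.target_subset_core ht)]
  obtain ⟨w', hw'⟩ := hwd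
  have hud : HasFDerivAt u (ℓ'.comp w') t₀ := ℓ'.hasFDerivAt.comp t₀ hw'
  have hwΓ' : ∀ᶠ t in 𝓝 t₀, Γ' (u t) = w t := by
    filter_upwards [hsc.eventually hu', hzero] with t h1 h2 using h1 h2
  have hΓ'c : ContinuousAt Γ' 0 := (hΓ' 0).contDiffAt.continuousAt
  have hs'c : Tendsto (fun t => c'.map.symm (Γ' t)) (𝓝 0) (𝓝 (s t₀)) := by
    have h2 : Γ' 0 ∈ c'.map.target := hz'.self_of_nhds.1
    have h1 : ContinuousWithinAt c'.map.symm c'.map.target (Γ' 0) := c'.continuousOn_symm _ h2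
    have h3 := Tendsto.comp h1 (tendsto_nhdsWithin_iff.2
      ⟨hΓ'c, hz'.mono fun t ht => ht.1⟩)
    rwa [hs0] at h3
  have hvplot : ∀ k : ℕ, ScPlotAt (W := c.S.amb) k (fun t => c.map (c'.map.symm (Γ' t))) 0 := by
    intro k
    refine MPolyfold.scPlotAt_map hX hc' hc (hz'.mono fun t ht => c'.map.map_target ht.1)
      (by rw [hs0]; exact hx0) ((hΓ' k).congr ?_)
    filter_upwards [hz'] with t ht using (c'.map.right_inv ht.1).symm
  have hvk : ∀ k : ℕ, ContDiffAt ℝ k v 0 := fun k =>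
    ℓ.contDiff.contDiffAt.comp 0 (hvplot k).contDiffAt
  have hvd : HasFDerivAt v (fderiv ℝ v 0) 0 := ((hvk 1).differentiableAt (by simp)).hasFDerivAt
  have huv : ∀ᶠ t in 𝓝 0, u (v t) = t := by
    filter_upwards [hz', hs'c.eventually hu, hs'c.eventually_mem (c.open_source.mem_nhds hx0)]
      with t h1 h2 h3
    have h4 : s (v t) = c'.map.symm (Γ' t) := by
      simp only [s, v]
      rw [h2 h1.2.1, c.map.left_inv h3]
    simp only [u, w]
    rw [h4, c'.map.right_inv h1.1, h1.2.2.1]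
  have hvu : ∀ᶠ t in 𝓝 t₀, v (u t) = t := by
    filter_upwards [hwΓ', hcs, hℓ, hsc.eventually_mem (c'.open_source.mem_nhds hq')] with t h1 h2 h3 h4
    simp only [v]
    rw [h1]
    simp only [w]
    rw [c'.map.left_inv h4, h2, h3]
  -- So far `u` is only known to be differentiable at `t₀`, but it inverts the smooth germ `v`.
  -- Hence `v'` is bijective, the inverse function theorem gives a smooth local inverse of `v`, and
  -- `u` must coincide with it.
  have hbij := HasFDerivAt.bijective_of_inverse hvd (by rw [hv0]; exact hud) huv
    (by rw [hv0]; exact hvu)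
  obtain ⟨g, -, hg, hgv, hvg⟩ := ContDiffAt.exists_local_inverse hvk hvd hbij
  rw [hv0] at hg
  have hug : ∀ᶠ t in 𝓝 t₀, u t = g t := by
    have h1 : Tendsto u (𝓝 t₀) (𝓝 0) := by
      have := hud.continuousAt
      rwa [ContinuousAt, hu0] at this
    filter_upwards [h1.eventually hvg, hvu] with t h2 h3
    rw [← h2, h3]
  have huk : ContDiffAt ℝ k u t₀ := (hg k).congr_of_eventuallyEq hug
  have hwk : ScPlotAt (W := c'.S.amb) k w t₀ := by
    refine ScPlotAt.congr (W := c'.S.amb) (ScPlotAt.comp_contDiffAt (E := c'.S.amb) (δ := Γ') (j := u) ?_ huk) hwΓ'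
    rw [hu0]
    exact hΓ' k
  exact (MPolyfold.scPlotAt_map hX hc' hc
    (hsc.eventually_mem (c'.open_source.mem_nhds hq')) hx0 hwk).congr hcs

end SolutionSet

/-! ### The solution set as a smooth manifold. -/

theorem mainTheorem2 {X : Type v} [TopologicalSpace X] [T2Space X] [SecondCountableTopology X]
    {Y : X → Type w} [∀ x, AddCommGroup (Y x)] [∀ x, Module ℝ (Y x)]
    [TopologicalSpace (Tot Y)] [T2Space (Tot Y)] [SecondCountableTopology (Tot Y)]
    (P : MPolyfold.{u} X) (b : StrongBundle P Y) (hX : P.boundary = ∅)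
    (f : ∀ x, Y x) (hf : b.IsFredholm f) (q : X) (hq : f q = 0)
    (hsurj : Function.Surjective (b.linearization f q)) :
    FiniteDimensional ℝ (LinearMap.ker (b.linearization f q)) ∧
    ∃ U : Set X, IsOpen U ∧ q ∈ U ∧
      P.IsSmoothSubmanifold {x | x ∈ U ∧ f x = 0}
        (Module.finrank ℝ (LinearMap.ker (b.linearization f q))) := by
  obtain ⟨hfin, c, hc, hqc, hq0, ℓ, Γ, hΓ0, hΓ, hz, hu⟩ := hf.exists_local_section hX
    (hf.2.1.mem_smoothPts hq) hq hsurj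
  refine ⟨hfin, ?_⟩
  generalize Module.finrank ℝ (LinearMap.ker (b.linearization f q)) = N at *
  -- Only the `C¹` lift to level `1` is kept, since a single neighbourhood must serve for
  -- everything; all orders and levels are recovered pointwise from `scPlotAt_of_parametrization`.
  obtain ⟨Γ₁, hΓ₁, hΓ₁'⟩ := hΓ 1 1
  obtain ⟨T, hT, hTo, hT0⟩ := mem_nhds_iff.1
    (hz.and ((hΓ₁.eventually (by simp)).and hΓ₁'.eventually_nhds))
  obtain ⟨V, hV, hVo, hqV⟩ := mem_nhds_iff.1 (hu.and (c.open_source.mem_nhds hqc))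
  have hec : ContinuousOn (fun x => ℓ (c.map x)) V :=
    ℓ.continuous.comp_continuousOn (c.continuousOn.mono fun x hx => (hV hx).2)
  have hΓc : ∀ t ∈ T, ContinuousAt Γ t := fun t ht =>
    ((c.S.amb.incl 0).continuous.continuousAt.comp (hT ht).2.1.continuousAt).congr
      (hT ht).2.2
  have hsT : ContinuousOn (fun t => c.map.symm (Γ t)) T :=
    c.continuousOn_symm.comp (fun t ht => (hΓc t ht).continuousWithinAt) fun t ht => (hT ht).1.1
  have hΩ : IsOpen (T ∩ (fun t => c.map.symm (Γ t)) ⁻¹' V) := hsT.isOpen_inter_preimage hTo hVo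
  have hqT : ℓ (c.map q) ∈ T := by rwa [hq0, map_zero]
  refine ⟨V ∩ (fun x => ℓ (c.map x)) ⁻¹' T, hec.isOpen_inter_preimage hVo hTo, ⟨hqV, hqT⟩, ?_⟩
  have hne : {x | x ∈ V ∩ (fun x => ℓ (c.map x)) ⁻¹' T ∧ f x = 0}.Nonempty := ⟨q, ⟨hqV, hqT⟩, hq⟩
  refine MPolyfold.isSmoothSubmanifold_of_plot hX hne
    (fun x hx => hf.2.1.mem_smoothPts hx.2) hc (fun x hx => (hV hx.1.1).2) hΩ (ℓ := ℓ) (Γ := Γ)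
    (fun t ht => ?_) (fun x hx => ?_) fun t ht k => ?_
  · obtain ⟨h1, h2, h3, -⟩ := (hT ht.1).1
    refine ⟨h1, ⟨⟨ht.2, ?_⟩, h2⟩, h3⟩
    change ℓ (c.map (c.map.symm (Γ t))) ∈ T
    rw [c.map.right_inv h1, h3]
    exact ht.1
  · have h1 := (hV hx.1.1).1 hx.2
    refine ⟨⟨hx.1.2, ?_⟩, h1⟩
    change c.map.symm (Γ (ℓ (c.map x))) ∈ V
    rw [h1, c.map.left_inv (hV hx.1.1).2]
    exact hx.1.1
  · have hev := hTo.mem_nhds ht.1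
    refine hf.scPlotAt_of_parametrization hX hc (N := N) (ℓ := ℓ) (Γ₁ := Γ₁)
      ((hT ht.1).2.1.differentiableAt (by simp)) (hT ht.1).2.2
      (mem_of_superset hev fun t ht => (hT ht).1.1)
      (mem_of_superset hev fun t ht => (hT ht).1.2.1)
      (mem_of_superset hev fun t ht => (hT ht).1.2.2.1)
      (mem_of_superset (hVo.mem_nhds ht.2) fun x hx => (hV hx).1) (hT ht.1).1.2.2.2 k
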